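/- Let $N\in\mathbb N$, $1<p<N$, $p^*=\frac{Np}{N-p}$, $\mu>0$, and let $q,r$ satisfy $\max\{p,p^*-1\}<r<q<p^*$. Let $V\in C^1(\mathbb R^N,\mathbb R)$ with $\tilde a\le V\le \tilde b$ for some constants $0<\tilde a<\tilde b$, and let $\mathcal M\subset\mathbb R^N$ be nonempty and bounded (for instance a bounded domain with smooth boundary). Let $\varphi\in C_0^\infty(\mathbb R)$ be even, $\varphi(s)=1$ for $|s|\le1$, $\varphi(s)=0$ for $|s|\ge2$, $|\varphi'|\le2$, $\varphi$ decreasing on $[1,2]$. Let $a>0$ and let $\zeta\in C^1(\mathbb R)$ satisfy $0\le\zeta\le1$, $\zeta'\ge0$, $\zeta(t)=0$ for $t\le0$, $\zeta(t)>0$ for $t>0$, $\zeta(t)=1$ for $t\ge1$, and, for some $C,\rho>0$, $t\zeta'(t)\ge C\zeta(t)$ and $\zeta(t)\ge Ct^a$ for $0\le t\le\rho$. Let $\gamma>\max\left\{\frac{(p+a)p}{N-p},\frac{p^2r}{(r-p)(N-p)}\right\}$ and $1<\beta<r/p$, and, if $p<2$, also $\beta\le\frac1{2-p}$. For $\epsilon>0$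 put $\mathcal M_\epsilon=\{x\in\mathbb R^N:\epsilon x\in\mathcal M\}$, $$b_\epsilon(x,t)=\varphi\left(\epsilon e^{\mathrm{dist}(\epsilon x,\mathcal M)}t\right),\qquad m_\epsilon(x,t)=\int_0^t b_\epsilon(x,\tau)\,d\tau,$$ $$F_\epsilon(x,t)=\frac1{p^*}|t|^r|m_\epsilon(x,t)|^{p^*-r}+\frac\mu q|t|^r|m_\epsilon(x,t)|^{q-r},$$ $\xi_\epsilon(x)=0$ if $x\in\mathcal M_\epsilon$ and $\xi_\epsilon(x)=\epsilon^{-\gamma}\zeta(\mathrm{dist}(x,\mathcal M_\epsilon))$ if $x\notin\mathcal M_\epsilon$, and for $u\in W^{1,p}(\mathbb R^N)$ $$Q_\epsilon(u)=\frac1{p\beta}\left(\int_{\mathbb R^N}\xi_\epsilon|u|^p\,dx-1\right)_+^\beta,$$ $$I_\epsilon(u)=\frac1p\int_{\mathbb R^N}\left(|\nabla u|^p+V(\epsilon x)|u|^p\right)dx+Q_\epsilon(u)-\int_{\mathbb R^N}F_\epsilon(x,u)\,dx .$$ Then for every fixed $\epsilon>0$ the functional $I_\epsilon$ is of class $C^1$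 on $W^{1,p}(\mathbb R^N)$ and satisfies the Palais–Smale condition at every level $c\in\mathbb R$: every sequence $(u_n)$ in $W^{1,p}(\mathbb R^N)$ with $I_\epsilon(u_n)\to c$ and $I_\epsilon'(u_n)\to0$ in the dual space has a subsequence that converges strongly in $W^{1,p}(\mathbb R^N)$. -/

import Mathlib

open MeasureTheory Filter Topology Set
open scoped ENNReal ContDiff

noncomputable section

namespace PSLemma

/-- The Euclidean space `ℝ^N`. -/
abbrev E (N : ℕ) : Type := EuclideanSpace ℝ (Fin N)

instance fact_one_le {p : ℝ} [hp : Fact (1 < p)] : Fact (1 ≤ ENNReal.ofReal p) :=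
  ⟨ENNReal.one_le_ofReal.2 hp.out.le⟩

/-- `g` is the weak (distributional) gradient of `u` on `ℝ^N`:
`∫ u ∂ᵢφ = - ∫ gᵢ φ` for every test function `φ ∈ C_c^∞(ℝ^N)` and every `i`. -/
def IsWeakGradient {N : ℕ} (u : E N → ℝ) (g : E N → E N) : Prop :=
  ∀ φ : E N → ℝ, ContDiff ℝ ∞ φ → HasCompactSupport φ → ∀ i : Fin N,
    ∫ x, u x * fderiv ℝ φ x (EuclideanSpace.single i 1) = - ∫ x, g x i * φ x

/-- `L^p(ℝ^N) × L^p(ℝ^N; ℝ^N)` with the norm `(‖u‖_p ^ p + ‖g‖_p ^ p) ^ (1 / p)`. -/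
abbrev LpPair (N : ℕ) (p : ℝ) : Type :=
  WithLp (ENNReal.ofReal p)
    (Lp ℝ (ENNReal.ofReal p) (volume : Measure (E N)) ×
      Lp (E N) (ENNReal.ofReal p) (volume : Measure (E N)))

theorem integrable_fst {N : ℕ} {p : ℝ} [Fact (1 < p)] (w : LpPair N p) {φ : E N → ℝ}
    (hφ : ContDiff ℝ ∞ φ) (hc : HasCompactSupport φ) (i : Fin N) :
    Integrable (fun x => w.fst x * fderiv ℝ φ x (EuclideanSpace.single i 1)) := by
  have h : LocallyIntegrable (w.fst : E N → ℝ) volume :=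
    (Lp.memLp w.fst).locallyIntegrable Fact.out
  have h1 : Continuous fun x => fderiv ℝ φ x (EuclideanSpace.single i 1) :=
    (hφ.continuous_fderiv (by simp)).clm_apply continuous_const
  have h2 : HasCompactSupport fun x => fderiv ℝ φ x (EuclideanSpace.single i 1) :=
    hc.fderiv_apply (𝕜 := ℝ) (EuclideanSpace.single i 1)
  simpa [smul_eq_mul, mul_comm] using h.integrable_smul_left_of_hasCompactSupport h1 h2

theorem integrable_snd {N : ℕ} {p : ℝ} [Fact (1 < p)] (w : LpPair N p) {φ : E N → ℝ}
    (hφ : ContDiff ℝ ∞ φ) (hc : HasCompactSupport φ) (i : Fin N) :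
    Integrable (fun x => w.snd x i * φ x) := by
  have h : LocallyIntegrable (w.snd : E N → E N) volume :=
    (Lp.memLp w.snd).locallyIntegrable Fact.out
  have h1 := h.integrable_smul_left_of_hasCompactSupport hφ.continuous hc
  have h2 := (EuclideanSpace.proj (𝕜 := ℝ) i).integrable_comp h1
  simpa [mul_comm] using h2

/-- The Sobolev space `W^{1,p}(ℝ^N)`: the pairs `(u, ∇u)` with `u ∈ L^p` whose weak gradient
`∇u` is in `L^p`.  It carries the norm `‖u‖ = (∫ |∇u|^p + |u|^p) ^ (1 / p)`.
(The weak gradient is unique almost everywhere, so such a pair is the same thing as `u`.) -/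
def W1p (N : ℕ) (p : ℝ) [Fact (1 < p)] : Submodule ℝ (LpPair N p) where
  carrier := {w | IsWeakGradient (w.fst : E N → ℝ) (w.snd : E N → E N)}
  zero_mem' := by
    intro φ hφ hc i
    have h1 : ∫ x, ((0 : LpPair N p).fst : E N → ℝ) x *
        fderiv ℝ φ x (EuclideanSpace.single i 1) = ∫ _x : E N, (0 : ℝ) := by
      refine integral_congr_ae ?_
      filter_upwards with x
      simp
    have h2 : ∫ x, ((0 : LpPair N p).snd : E N → E N) x i * φ x = ∫ _x : E N, (0 : ℝ) := by
      refine integral_congr_ae ?_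
      filter_upwards with x
      simp
    rw [h1, h2]; simp
  add_mem' := by
    intro v w hv hw φ hφ hc i
    have h1 : ∫ x, ((v + w).fst : E N → ℝ) x * fderiv ℝ φ x (EuclideanSpace.single i 1)
        = ∫ x, (v.fst x * fderiv ℝ φ x (EuclideanSpace.single i 1)
            + w.fst x * fderiv ℝ φ x (EuclideanSpace.single i 1)) := by
      refine integral_congr_ae ?_
      filter_upwards [Lp.coeFn_add v.fst w.fst] with x hx
      rw [WithLp.add_fst, hx]
      simp [add_mul]
    have h2 : ∫ x, ((v + w).snd : E N → E N) x i * φ x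
        = ∫ x, (v.snd x i * φ x + w.snd x i * φ x) := by
      refine integral_congr_ae ?_
      filter_upwards [Lp.coeFn_add v.snd w.snd] with x hx
      rw [WithLp.add_snd, hx]
      simp [add_mul]
    rw [h1, h2, integral_add (integrable_fst v hφ hc i) (integrable_fst w hφ hc i),
      integral_add (integrable_snd v hφ hc i) (integrable_snd w hφ hc i),
      hv φ hφ hc i, hw φ hφ hc i]
    ring
  smul_mem' := by
    intro k v hv φ hφ hc i
    have h1 : ∫ x, ((k • v).fst : E N → ℝ) x * fderiv ℝ φ x (EuclideanSpace.single i 1)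
        = ∫ x, k * (v.fst x * fderiv ℝ φ x (EuclideanSpace.single i 1)) := by
      refine integral_congr_ae ?_
      filter_upwards [Lp.coeFn_smul k v.fst] with x hx
      rw [WithLp.smul_fst, hx]
      simp [mul_assoc]
    have h2 : ∫ x, ((k • v).snd : E N → E N) x i * φ x = ∫ x, k * (v.snd x i * φ x) := by
      refine integral_congr_ae ?_
      filter_upwards [Lp.coeFn_smul k v.snd] with x hx
      rw [WithLp.smul_snd, hx]
      simp [mul_assoc]
    rw [h1, h2, integral_const_mul, integral_const_mul, hv φ hφ hc i]
    ring

/-- The function `u` underlying an element of `W^{1,p}(ℝ^N)`. -/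
def fn {N : ℕ} {p : ℝ} [Fact (1 < p)] (u : W1p N p) : E N → ℝ := (u : LpPair N p).fst

/-- The weak gradient `∇u` of an element of `W^{1,p}(ℝ^N)`. -/
def grad {N : ℕ} {p : ℝ} [Fact (1 < p)] (u : W1p N p) : E N → E N := (u : LpPair N p).snd

/-- The critical Sobolev exponent `p* = N p / (N - p)`. -/
def pStar (N : ℕ) (p : ℝ) : ℝ := N * p / (N - p)

/-- The admissible cut-off functions `φ` of the truncation. -/
structure IsTruncationCutoff (φ : ℝ → ℝ) : Prop where
  smooth : ContDiff ℝ ∞ φ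
  eq_one : ∀ s, |s| ≤ 1 → φ s = 1
  eq_zero : ∀ s, 2 ≤ |s| → φ s = 0
  abs_deriv_le : ∀ s, |deriv φ s| ≤ 2
  even : ∀ s, φ (-s) = φ s
  antitoneOn : AntitoneOn φ (Icc 1 2)

/-- The admissible cut-off functions `ζ` of the penalization, with growth exponent `a` at `0`. -/
structure IsPenaltyCutoff (ζ : ℝ → ℝ) (a : ℝ) : Prop where
  contDiff : ContDiff ℝ 1 ζ
  nonneg : ∀ t, 0 ≤ ζ t
  le_one : ∀ t, ζ t ≤ 1
  deriv_nonneg : ∀ t, 0 ≤ deriv ζ t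
  eq_zero : ∀ t ≤ 0, ζ t = 0
  pos : ∀ t, 0 < t → 0 < ζ t
  eq_one : ∀ t, 1 ≤ t → ζ t = 1
  growth : ∃ C ρ : ℝ, 0 < C ∧ 0 < ρ ∧ ∀ t, 0 ≤ t → t ≤ ρ →
    C * ζ t ≤ t * deriv ζ t ∧ C * t ^ a ≤ ζ t

/-- `b_ε(x, t) = φ(ε e^{dist(εx, M)} t)`. -/
def bTrunc {N : ℕ} (φ : ℝ → ℝ) (M : Set (E N)) (ε : ℝ) (x : E N) (t : ℝ) : ℝ :=
  φ (ε * Real.exp (Metric.infDist (ε • x) M) * t)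

/-- `m_ε(x, t) = ∫₀ᵗ b_ε(x, τ) dτ`. -/
def mTrunc {N : ℕ} (φ : ℝ → ℝ) (M : Set (E N)) (ε : ℝ) (x : E N) (t : ℝ) : ℝ :=
  ∫ τ in (0 : ℝ)..t, bTrunc φ M ε x τ

/-- `F_ε(x, t) = (1/p*) |t|^r |m_ε(x, t)|^{p* - r} + (μ/q) |t|^r |m_ε(x, t)|^{q - r}`. -/
def FTrunc {N : ℕ} (p q r μ : ℝ) (φ : ℝ → ℝ) (M : Set (E N)) (ε : ℝ) (x : E N) (t : ℝ) : ℝ :=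
  1 / pStar N p * |t| ^ r * |mTrunc φ M ε x t| ^ (pStar N p - r)
    + μ / q * |t| ^ r * |mTrunc φ M ε x t| ^ (q - r)

/-- `M_ε = {x | ε x ∈ M}`. -/
def scaled {N : ℕ} (M : Set (E N)) (ε : ℝ) : Set (E N) := {x | ε • x ∈ M}

open Classical in
/-- `ξ_ε = 0` on `M_ε` and `ξ_ε(x) = ε^{-γ} ζ(dist(x, M_ε))` off `M_ε`. -/
def xi {N : ℕ} (ζ : ℝ → ℝ) (γ : ℝ) (M : Set (E N)) (ε : ℝ) (x : E N) : ℝ :=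
  if x ∈ scaled M ε then 0 else ε ^ (-γ) * ζ (Metric.infDist x (scaled M ε))

/-- `Q_ε(u) = (1/(pβ)) (∫ ξ_ε |u|^p - 1)_+^β`. -/
def penalization {N : ℕ} {p : ℝ} [Fact (1 < p)] (β γ : ℝ) (ζ : ℝ → ℝ) (M : Set (E N)) (ε : ℝ)
    (u : W1p N p) : ℝ :=
  1 / (p * β) * (max ((∫ x, xi ζ γ M ε x * |fn u x| ^ p) - 1) 0) ^ β

/-- The modified functional
`I_ε(u) = (1/p) ∫ (|∇u|^p + V(εx)|u|^p) + Q_ε(u) - ∫ F_ε(x, u)` on `W^{1,p}(ℝ^N)`. -/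
def modifiedFunctional {N : ℕ} {p : ℝ} [Fact (1 < p)] (q r μ β γ : ℝ) (φ ζ : ℝ → ℝ)
    (V : E N → ℝ) (M : Set (E N)) (ε : ℝ) (u : W1p N p) : ℝ :=
  1 / p * (∫ x, (‖grad u x‖ ^ p + V (ε • x) * |fn u x| ^ p))
    + penalization β γ ζ M ε u
    - ∫ x, FTrunc p q r μ φ M ε x (fn u x)

/-- The Palais–Smale condition at level `c` for a functional `I` on a normed space `X`: every
sequence with `I(uₙ) → c` and `I'(uₙ) → 0` in the dual of `X` has a subsequence that converges
in the norm of `X`. -/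
def PalaisSmale {X : Type*} [NormedAddCommGroup X] [NormedSpace ℝ X] (I : X → ℝ) (c : ℝ) : Prop :=
  ∀ u : ℕ → X, Tendsto (fun n => I (u n)) atTop (𝓝 c) →
    Tendsto (fun n => fderiv ℝ I (u n)) atTop (𝓝 0) →
    ∃ (v : X) (θ : ℕ → ℕ), StrictMono θ ∧ Tendsto (fun n => u (θ n)) atTop (𝓝 v)

end PSLemma

end

open MeasureTheory Filter Topology Set
open scoped ENNReal ContDiff

noncomputable section

/-! Regularity. Each integral in the functional is `∫ G(x, Tu)`, where `T` is a continuous linear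
map from `W^{1,p}` to some `L^s` and `|∂ₜG| ≤ C|t|^(s-1)`; such superposition functionals are `C¹`
(`IsNemytskii.hasFDerivAt_integral`). For the gradient, potential and penalty integrals `s = p`, and
`β > 1` makes the outer power of the penalty `C¹`. For the nonlinearity `s = r`, although the
untruncated powers have exponents `p*` and `q`: with `λ(x) = ε e^{dist(εx, M)}` the truncation
forces `|m_ε(x, t)| ≤ 2/λ(x)`, hence `|∂ₜF_ε| ≤ w(x)|t|^(r-1)` with `w` a combination of negative
powers of `λ`. Since `p < r < p*`, the Sobolev embedding reaches `L^r`.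

Boundedness of Palais–Smale sequences. In `I(u) - (1/r) I'(u)u` the nonlinearity contributes a
nonnegative amount, because `r F_ε ≤ t ∂ₜF_ε` (Ambrosetti–Rabinowitz); the penalty contributes an
amount bounded below, because `β < r/p`; what remains is at least `(1/p - 1/r) min(1, a') ‖u‖^p`,
where `a' > 0` is a lower bound of `V` (`exists_coercive`).

Convergence. No weak limit is identified; a subsequence is shown to be Cauchy. In `(I'(u) - I'(v))(u
- v)` the gradient and potential parts are strictly monotone and control `‖u - v‖^p` up to `η(‖u‖^p
+ ‖v‖^p)` with `η` arbitrarily small (`exists_norm_sub_rpow_le`). The penalty part is monotone, as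
for any convex function, so it can be dropped. The nonlinear part tends to zero: by Hölder it is
controlled by the `L^r` norm of `w(u - v)`, and this is small along a subsequence by local
compactness, subcriticality of `r` and the decay of `w` at infinity (`exists_subseq_cauchy_weight`).

The Sobolev inequality on all of `W^{1,p}` and the local compactness are both derived by
mollification, from the inequality for compactly supported `C¹` functions and from a diagonal
argument. -/

namespace PSLemma

/-! ### Differentiability of superposition functionals on `L^s` -/

section Nemytskii

variable {α : Type*} [MeasurableSpace α] {ν : Measure α}

/-- Dominated convergence with dominating functions `d n + D`, where `∫ d n → 0`. -/
theorem tendsto_lintegral_of_le_add {f d : ℕ → α → ℝ≥0∞} {D : α → ℝ≥0∞}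
    (hf : ∀ n, AEMeasurable (f n) ν) (hd : ∀ n, AEMeasurable (d n) ν)
    (bound : ∀ n x, f n x ≤ d n x + D x) (hD : ∫⁻ x, D x ∂ν ≠ ⊤)
    (hd0 : Tendsto (fun n => ∫⁻ x, d n x ∂ν) atTop (𝓝 0))
    (hlim : ∀ᵐ x ∂ν, Tendsto (fun n => f n x) atTop (𝓝 0)) :
    Tendsto (fun n => ∫⁻ x, f n x ∂ν) atTop (𝓝 0) := by
  -- The truncated difference `f n - d n` is dominated by the fixed `D`; afterwards `f n ≤ (f n - d
  -- n) + d n`.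
  have h1 : Tendsto (fun n => ∫⁻ x, (f n x - d n x) ∂ν) atTop (𝓝 (∫⁻ _, 0 ∂ν)) := by
    refine tendsto_lintegral_of_dominated_convergence' D (fun n => (hf n).sub (hd n))
      (fun n => .of_forall fun x => ?_) hD ?_
    · exact tsub_le_iff_left.2 (bound n x)
    · filter_upwards [hlim] with x hx
      exact tendsto_of_tendsto_of_tendsto_of_le_of_le tendsto_const_nhds hx
        (fun _ => zero_le) (fun n => tsub_le_self)
  have h2 := h1.add hd0
  simp only [lintegral_zero, add_zero] at h2
  refine tendsto_of_tendsto_of_tendsto_of_le_of_le tendsto_const_nhds h2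
    (fun _ => zero_le) (fun n => ?_)
  simp only
  rw [← lintegral_add_right' _ (hd n)]
  exact lintegral_mono fun x => le_tsub_add

variable {H : Type*} [NormedAddCommGroup H]

theorem lintegral_enorm_rpow_eq {s : ℝ} (hs : 0 < s) (v : Lp H (ENNReal.ofReal s) ν) :
    ∫⁻ x, ‖v x‖ₑ ^ s ∂ν = ‖v‖ₑ ^ s := by
  rw [Lp.enorm_def, eLpNorm_eq_lintegral_rpow_enorm_toReal (by simpa using hs) (by simp),
    ENNReal.toReal_ofReal hs.le, ← ENNReal.rpow_mul, one_div, inv_mul_cancel₀ hs.ne',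
    ENNReal.rpow_one]

/-- The part `C‖h‖^s` of the bound vanishes in the limit and `D` is a fixed dominating function.
Convergence in `L^s` gives almost everywhere convergence only along a subsequence, which suffices
since every subsequence has a further one with limit zero. -/
theorem tendsto_lintegral_of_growth {s : ℝ} (hs : 1 ≤ s) [Fact (1 ≤ ENNReal.ofReal s)]
    {K : α → H → ℝ≥0∞} {D : α → ℝ≥0∞} {C : ℝ≥0∞} (hC : C ≠ ⊤)
    (hD : ∫⁻ x, D x ∂ν ≠ ⊤)
    (hK : ∀ h : Lp H (ENNReal.ofReal s) ν, AEMeasurable (fun x => K x (h x)) ν)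
    (bound : ∀ x t, K x t ≤ C * ‖t‖ₑ ^ s + D x)
    (hlim : ∀ x, Tendsto (K x) (𝓝 0) (𝓝 0)) :
    Tendsto (fun h : Lp H (ENNReal.ofReal s) ν => ∫⁻ x, K x (h x) ∂ν) (𝓝 0) (𝓝 0) := by
  have hs0 : 0 < s := by linarith
  refine tendsto_of_seq_tendsto fun h hh => tendsto_of_subseq_tendsto fun ns hns => ?_
  have h1 : Tendsto (fun n => h (ns n)) atTop (𝓝 0) := hh.comp hns
  obtain ⟨ms, hms, hae⟩ := (tendstoInMeasure_of_tendsto_Lp h1).exists_seq_tendsto_ae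
  have h2 : Tendsto (fun n => h (ns (ms n))) atTop (𝓝 0) := h1.comp hms.tendsto_atTop
  refine ⟨ms, tendsto_lintegral_of_le_add (d := fun n x => C * ‖h (ns (ms n)) x‖ₑ ^ s) (D := D)
    (fun n => hK _) (fun n => ?_) (fun n x => bound x _) hD ?_ ?_⟩
  · exact ((Lp.aestronglyMeasurable _).enorm.pow_const _).const_mul _
  · have h3 : Tendsto (fun n => C * ‖h (ns (ms n))‖ₑ ^ s) atTop (𝓝 0) := by
      have h4 : Tendsto (fun n => ‖h (ns (ms n))‖ₑ) atTop (𝓝 0) := by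
        simpa using h2.enorm
      have h5 := (ENNReal.continuous_rpow_const (y := s)).continuousAt.tendsto.comp h4
      rw [ENNReal.zero_rpow_of_pos hs0] at h5
      simpa using ENNReal.Tendsto.const_mul h5 (Or.inr hC)
    refine h3.congr fun n => ?_
    rw [lintegral_const_mul'' _ ((Lp.aestronglyMeasurable _).enorm.pow_const _),
      lintegral_enorm_rpow_eq hs0]
  · filter_upwards [hae, Lp.coeFn_zero H (ENNReal.ofReal s) ν] with x hx h0
    rw [h0] at hx
    exact (hlim x).comp hx

variable [NormedSpace ℝ H]

/-- A function `G(x, t)`, differentiable in `t` with derivative `g(x, t)` of growth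
`|t|^(s - 1)`, whose superposition with measurable functions is measurable. -/
structure IsNemytskii (ν : Measure α) (s : ℝ) (G : α → H → ℝ) (g : α → H → H →L[ℝ] ℝ) : Prop where
  hasFDerivAt : ∀ x t, HasFDerivAt (G x) (g x t) t
  continuous : ∀ x, Continuous (g x)
  map_zero : ∀ x, G x 0 = 0
  growth : ∃ C : ℝ, 0 ≤ C ∧ ∀ x t, ‖g x t‖ ≤ C * ‖t‖ ^ (s - 1)
  aesm : ∀ v : α → H, AEStronglyMeasurable v ν → AEStronglyMeasurable (fun x => G x (v x)) ν
  aesm' : ∀ v : α → H, AEStronglyMeasurable v ν → AEStronglyMeasurable (fun x => g x (v x)) ν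

namespace IsNemytskii

variable {s : ℝ} {G : α → H → ℝ} {g : α → H → H →L[ℝ] ℝ}

theorem abs_sub_le {α : Type*} {G : α → H → ℝ} {g : α → H → H →L[ℝ] ℝ}
    {C : ℝ} (hs : 1 < s) (hC : 0 ≤ C)
    (hd : ∀ x t, HasFDerivAt (G x) (g x t) t) (hg : ∀ x t, ‖g x t‖ ≤ C * ‖t‖ ^ (s - 1))
    (x : α) (t h : H) : ‖G x (t + h) - G x t‖ ≤ C * (‖t‖ + ‖h‖) ^ (s - 1) * ‖h‖ := by
  have := (convex_segment (𝕜 := ℝ) t (t + h)).norm_image_sub_le_of_norm_hasFDerivWithin_le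
    (f := G x) (f' := g x) (C := C * (‖t‖ + ‖h‖) ^ (s - 1))
    (fun y _ => (hd x y).hasFDerivWithinAt) (fun y hy => ?_)
    (left_mem_segment ℝ _ _) (right_mem_segment ℝ _ _)
  · simpa using this
  · refine (hg x y).trans ?_
    rw [segment_eq_image'] at hy
    obtain ⟨θ, ⟨hθ0, hθ1⟩, rfl⟩ := hy
    have h1 : ‖t + θ • (t + h - t)‖ ≤ ‖t‖ + ‖h‖ := by
      refine (norm_add_le _ _).trans ?_
      rw [norm_smul, Real.norm_of_nonneg hθ0, add_sub_cancel_left]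
      gcongr
      exact mul_le_of_le_one_left (norm_nonneg _) hθ1
    gcongr

/-- The growth exponent fits because `s / (s - 1)` is the conjugate exponent. -/
theorem memLp_deriv (hN : IsNemytskii ν s G g) (hs : 1 < s) {v : α → H}
    (hv : MemLp v (ENNReal.ofReal s) ν) :
    MemLp (fun x => g x (v x)) (ENNReal.ofReal s.conjExponent) ν := by
  obtain ⟨C, hC, hg⟩ := hN.growth
  have h1 := hv.norm_rpow_div (ENNReal.ofReal (s - 1))
  rw [← ENNReal.ofReal_div_of_pos (by linarith), ENNReal.toReal_ofReal (by linarith)] at h1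
  refine (h1.const_mul C).mono' (hN.aesm' v hv.1) (.of_forall fun x => hg x _)

theorem integrable (hN : IsNemytskii ν s G g) (hs : 1 < s) {v : α → H}
    (hv : MemLp v (ENNReal.ofReal s) ν) : Integrable (fun x => G x (v x)) ν := by
  obtain ⟨C, hC, hg⟩ := hN.growth
  have h1 := hv.norm_rpow_div (ENNReal.ofReal s)
  rw [ENNReal.div_self (by simpa using by linarith) (by simp), memLp_one_iff_integrable,
    ENNReal.toReal_ofReal (by linarith)] at h1
  refine (h1.const_mul C).mono' (hN.aesm v hv.1) (.of_forall fun x => ?_)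
  have := abs_sub_le hs hC hN.hasFDerivAt hg x 0 (v x)
  simp only [zero_add, hN.map_zero, sub_zero, norm_zero] at this
  refine this.trans_eq ?_
  rw [mul_assoc]
  congr 1
  rcases eq_or_ne (v x) 0 with h | h
  · simp [h, Real.zero_rpow (by linarith : s ≠ 0)]
  · rw [← Real.rpow_add_one (by simpa using h)]; simp

theorem integrable_deriv (hN : IsNemytskii ν s G g) (hs : 1 < s) {v h : α → H}
    (hv : MemLp v (ENNReal.ofReal s) ν) (hh : MemLp h (ENNReal.ofReal s) ν) :
    Integrable (fun x => g x (v x) (h x)) ν := by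
  have hpq : (s.conjExponent).HolderConjugate s := (Real.HolderConjugate.conjExponent hs).symm
  have := hpq.ennrealOfReal
  have := (ContinuousLinearMap.id ℝ (H →L[ℝ] ℝ)).memLp_of_bilin 1 (hN.memLp_deriv hs hv) hh
  simpa [memLp_one_iff_integrable] using this

theorem aesm_remainder (hN : IsNemytskii ν s G g) {v h : α → H} (hv : AEStronglyMeasurable v ν)
    (hh : AEStronglyMeasurable h ν) :
    AEStronglyMeasurable (fun x => ‖h x‖⁻¹ * (G x (v x + h x) - G x (v x) - g x (v x) (h x))) ν :=
  (hh.norm.aemeasurable.inv).aestronglyMeasurable.mul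
    (((hN.aesm _ (hv.add hh)).sub (hN.aesm _ hv)).sub
      (isBoundedBilinearMap_apply.continuous.comp_aestronglyMeasurable₂ (hN.aesm' _ hv) hh))

theorem enorm_rpow_conjExponent_le {F H : Type*} [NormedAddCommGroup H] [NormedAddCommGroup F]
    (hs : 1 < s) {A : ℝ}
    (hA : 0 ≤ A) {z : F} {a b : H} (h : ‖z‖ ≤ A * (‖a‖ + ‖b‖) ^ (s - 1)) :
    ‖z‖ₑ ^ s.conjExponent ≤ ENNReal.ofReal A ^ s.conjExponent * 2 ^ s * ‖b‖ₑ ^ s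
      + ENNReal.ofReal A ^ s.conjExponent * 2 ^ s * ‖a‖ₑ ^ s := by
  have hpq := Real.HolderConjugate.conjExponent hs
  have h1 : ‖z‖ₑ ≤ ENNReal.ofReal A * (‖a‖ₑ + ‖b‖ₑ) ^ (s - 1) := by
    rw [← ofReal_norm, ← ofReal_norm, ← ofReal_norm, ← ENNReal.ofReal_add (by positivity)
      (by positivity), ENNReal.ofReal_rpow_of_nonneg (by positivity) (by linarith),
      ← ENNReal.ofReal_mul hA]
    exact ENNReal.ofReal_le_ofReal h
  calc ‖z‖ₑ ^ s.conjExponent ≤ (ENNReal.ofReal A * (‖a‖ₑ + ‖b‖ₑ) ^ (s - 1)) ^ s.conjExponent :=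
        ENNReal.rpow_le_rpow h1 hpq.symm.nonneg
    _ = ENNReal.ofReal A ^ s.conjExponent * (‖a‖ₑ + ‖b‖ₑ) ^ s := by
        rw [ENNReal.mul_rpow_of_nonneg _ _ hpq.symm.nonneg, ← ENNReal.rpow_mul,
          hpq.sub_one_mul_conj]
    _ ≤ ENNReal.ofReal A ^ s.conjExponent * (2 ^ s * (‖a‖ₑ ^ s + ‖b‖ₑ ^ s)) := by
        gcongr
        exact ENNReal.add_rpow_le_two_rpow_mul_rpow_add_rpow _ _ (by linarith)
    _ = _ := by ring

theorem remainder_le {α : Type*} {G : α → H → ℝ} {g : α → H → H →L[ℝ] ℝ}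
    {C : ℝ} (hs : 1 < s) (hC : 0 ≤ C)
    (hd : ∀ x t, HasFDerivAt (G x) (g x t) t) (hg : ∀ x t, ‖g x t‖ ≤ C * ‖t‖ ^ (s - 1))
    (x : α) (t h : H) :
    ‖‖h‖⁻¹ * (G x (t + h) - G x t - g x t h)‖ ≤ 2 * C * (‖t‖ + ‖h‖) ^ (s - 1) := by
  rcases eq_or_ne h 0 with rfl | h0
  · simp only [norm_zero, inv_zero, zero_mul]; positivity
  have h1 := abs_sub_le hs hC hd hg x t h
  have h2 : ‖g x t h‖ ≤ C * (‖t‖ + ‖h‖) ^ (s - 1) * ‖h‖ := by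
    refine ((g x t).le_opNorm h).trans ?_
    gcongr
    refine (hg x t).trans ?_
    have : ‖t‖ ≤ ‖t‖ + ‖h‖ := by simp
    gcongr
  have h3 : 0 < ‖h‖ := by simpa using h0
  rw [norm_mul, norm_inv, norm_norm, inv_mul_le_iff₀ h3]
  refine (norm_sub_le _ _).trans ?_
  linarith

/-- Continuity at `v` of the superposition operator from `L^s` to `L^{s'}`; it yields continuity of
the derivative. -/
theorem tendsto_sub (hN : IsNemytskii ν s G g) (hs : 1 < s) [Fact (1 ≤ ENNReal.ofReal s)]
    (v : Lp H (ENNReal.ofReal s) ν) :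
    Tendsto (fun h : Lp H (ENNReal.ofReal s) ν =>
      ∫⁻ x, ‖g x (v x + h x) - g x (v x)‖ₑ ^ s.conjExponent ∂ν) (𝓝 0) (𝓝 0) := by
  obtain ⟨C, hC, hg⟩ := hN.growth
  have hpq := Real.HolderConjugate.conjExponent hs
  have hD : ∫⁻ x, ENNReal.ofReal (2 * C) ^ s.conjExponent * 2 ^ s * ‖v x‖ₑ ^ s ∂ν ≠ ⊤ := by
    rw [lintegral_const_mul'' _ ((Lp.aestronglyMeasurable _).enorm.pow_const _),
      lintegral_enorm_rpow_eq (by linarith)]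
    have := hpq.symm.nonneg
    have : 0 ≤ s := by linarith
    finiteness
  have hCt : ENNReal.ofReal (2 * C) ^ s.conjExponent * 2 ^ s ≠ ⊤ := by
    have := hpq.symm.nonneg
    have : 0 ≤ s := by linarith
    finiteness
  have hvm := Lp.aestronglyMeasurable v
  refine tendsto_lintegral_of_growth hs.le
    (K := fun x t => ‖g x (v x + t) - g x (v x)‖ₑ ^ s.conjExponent) hCt hD (fun h => ?_)
    (fun x t => ?_) (fun x => ?_)
  · exact (((hN.aesm' _ (hvm.add (Lp.aestronglyMeasurable h))).sub
      (hN.aesm' _ hvm)).enorm.pow_const _)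
  · refine enorm_rpow_conjExponent_le hs (by positivity) ?_
    have h1 : ‖v x‖ ≤ ‖v x‖ + ‖t‖ := by simp
    calc _ ≤ ‖g x (v x + t)‖ + ‖g x (v x)‖ := norm_sub_le _ _
      _ ≤ C * ‖v x + t‖ ^ (s - 1) + C * ‖v x‖ ^ (s - 1) := add_le_add (hg _ _) (hg _ _)
      _ ≤ C * (‖v x‖ + ‖t‖) ^ (s - 1) + C * (‖v x‖ + ‖t‖) ^ (s - 1) := by
        have := norm_add_le (v x) t
        have : 0 ≤ s - 1 := by linarith
        gcongr
      _ = _ := by ring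
  · have hcont : Continuous fun t => ‖g x (v x + t) - g x (v x)‖ₑ ^ s.conjExponent := by
      refine ENNReal.continuous_rpow_const.comp ?_
      have := hN.continuous x
      fun_prop
    have := hcont.tendsto 0
    simp only [add_zero, sub_self] at this
    have h0 : ‖(0 : H →L[ℝ] ℝ)‖ₑ = 0 := by rw [← ofReal_norm, norm_zero, ENNReal.ofReal_zero]
    rwa [h0, ENNReal.zero_rpow_of_pos hpq.symm.pos] at this

/-- The pointwise Taylor remainder is divided by `‖h x‖`, so that Hölder against `‖h‖` in `L^s`
turns this limit into an `o(‖h‖)` bound for the integral. -/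
theorem tendsto_remainder (hN : IsNemytskii ν s G g) (hs : 1 < s) [Fact (1 ≤ ENNReal.ofReal s)]
    (v : Lp H (ENNReal.ofReal s) ν) :
    Tendsto (fun h : Lp H (ENNReal.ofReal s) ν =>
      ∫⁻ x, (‖‖h x‖⁻¹ * (G x (v x + h x) - G x (v x) - g x (v x) (h x))‖ₑ) ^ s.conjExponent ∂ν)
      (𝓝 0) (𝓝 0) := by
  obtain ⟨C, hC, hg⟩ := hN.growth
  have hpq := Real.HolderConjugate.conjExponent hs
  have hD : ∫⁻ x, ENNReal.ofReal (2 * C) ^ s.conjExponent * 2 ^ s * ‖v x‖ₑ ^ s ∂ν ≠ ⊤ := by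
    rw [lintegral_const_mul'' _ ((Lp.aestronglyMeasurable _).enorm.pow_const _),
      lintegral_enorm_rpow_eq (by linarith)]
    have := hpq.symm.nonneg
    have : 0 ≤ s := by linarith
    finiteness
  have hCt : ENNReal.ofReal (2 * C) ^ s.conjExponent * 2 ^ s ≠ ⊤ := by
    have := hpq.symm.nonneg
    have : 0 ≤ s := by linarith
    finiteness
  have hvm := Lp.aestronglyMeasurable v
  refine tendsto_lintegral_of_growth hs.le
    (K := fun x t => ‖‖t‖⁻¹ * (G x (v x + t) - G x (v x) - g x (v x) t)‖ₑ ^ s.conjExponent)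
    hCt hD (fun h => ?_) (fun x t => ?_) (fun x => ?_)
  · exact (hN.aesm_remainder hvm (Lp.aestronglyMeasurable h)).enorm.pow_const _
  · exact enorm_rpow_conjExponent_le hs (by positivity)
      (remainder_le hs hC hN.hasFDerivAt hg x _ _)
  · have h1 := (hN.hasFDerivAt x (v x))
    rw [hasFDerivAt_iff_tendsto] at h1
    have h2 : Tendsto (fun t => v x + t) (𝓝 0) (𝓝 (v x)) := by
      have : Continuous fun t => v x + t := by fun_prop
      simpa using this.tendsto 0
    have h3 := h1.comp h2
    have h4 : Tendsto (fun t => ‖‖t‖⁻¹ * (G x (v x + t) - G x (v x) - g x (v x) t)‖) (𝓝 0) (𝓝 0) := by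
      refine h3.congr fun t => ?_
      simp
    have h5 := h4.enorm
    simp only [enorm_norm, enorm_zero] at h5
    have h6 := (ENNReal.continuous_rpow_const (y := s.conjExponent)).continuousAt.tendsto.comp h5
    rwa [ENNReal.zero_rpow_of_pos hpq.symm.pos] at h6

/-- The superposition operator `v ↦ g(·, v)` from `L^s` to the dual exponent. -/
def derivLp (hN : IsNemytskii ν s G g) (hs : 1 < s) (v : Lp H (ENNReal.ofReal s) ν) :
    Lp (H →L[ℝ] ℝ) (ENNReal.ofReal s.conjExponent) ν :=
  (hN.memLp_deriv hs (Lp.memLp v)).toLp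

theorem hasFDerivAt_integral (hN : IsNemytskii ν s G g) (hs : 1 < s)
    [hs1 : Fact (1 ≤ ENNReal.ofReal s)] :
    ∃ Φ' : Lp H (ENNReal.ofReal s) ν → Lp H (ENNReal.ofReal s) ν →L[ℝ] ℝ,
      Continuous Φ' ∧
      (∀ v, HasFDerivAt (fun v : Lp H (ENNReal.ofReal s) ν => ∫ x, G x (v x) ∂ν) (Φ' v) v) ∧
      ∀ v h, Φ' v h = ∫ x, g x (v x) (h x) ∂ν := by
  have hpq : (s.conjExponent).HolderConjugate s := (Real.HolderConjugate.conjExponent hs).symm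
  have := hpq.ennrealOfReal
  have : Fact (1 ≤ ENNReal.ofReal s.conjExponent) := ⟨ENNReal.one_le_ofReal.2 hpq.lt.le⟩
  set B := (ContinuousLinearMap.id ℝ (H →L[ℝ] ℝ)).lpPairing ν (ENNReal.ofReal s.conjExponent)
    (ENNReal.ofReal s) with hB
  have hval : ∀ v h : Lp H (ENNReal.ofReal s) ν,
      B (hN.derivLp hs v) h = ∫ x, g x (v x) (h x) ∂ν := by
    intro v h
    rw [hB, ContinuousLinearMap.lpPairing_eq_integral]
    refine integral_congr_ae ?_
    filter_upwards [(hN.memLp_deriv hs (Lp.memLp v)).coeFn_toLp] with x hx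
    simp only [derivLp, ContinuousLinearMap.coe_id', id_eq]
    rw [hx]
  refine ⟨fun v => B (hN.derivLp hs v), B.continuous.comp ?_, fun v => ?_, hval⟩
  · rw [continuous_iff_continuousAt]
    intro v
    have h0 := hN.tendsto_sub hs v
    have h1 : Tendsto (fun w : Lp H (ENNReal.ofReal s) ν => w - v) (𝓝 v) (𝓝 0) := by
      have : Continuous (fun w : Lp H (ENNReal.ofReal s) ν => w - v) := by fun_prop
      simpa using this.tendsto v
    have h2 := h0.comp h1
    rw [ContinuousAt, Lp.tendsto_Lp_iff_tendsto_eLpNorm']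
    have h3 := (ENNReal.continuous_rpow_const (y := (s.conjExponent)⁻¹)).continuousAt.tendsto.comp h2
    rw [ENNReal.zero_rpow_of_pos hpq.inv_pos] at h3
    refine h3.congr fun w => ?_
    rw [eLpNorm_eq_lintegral_rpow_enorm_toReal (by simpa using hpq.pos) (by simp),
      ENNReal.toReal_ofReal hpq.nonneg, one_div]
    simp only [Function.comp_apply]
    congr 1
    refine lintegral_congr_ae ?_
    filter_upwards [(hN.memLp_deriv hs (Lp.memLp v)).coeFn_toLp,
      (hN.memLp_deriv hs (Lp.memLp w)).coeFn_toLp, Lp.coeFn_sub w v] with x h1 h2 h3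
    rw [h3]
    simp only [Pi.sub_apply, derivLp]
    rw [h1, h2, add_sub_cancel]
  · rw [hasFDerivAt_iff_isLittleO_nhds_zero, Asymptotics.isLittleO_iff]
    intro c hc
    have h0 := hN.tendsto_remainder hs v
    have h3 := (ENNReal.continuous_rpow_const (y := (s.conjExponent)⁻¹)).continuousAt.tendsto.comp h0
    rw [ENNReal.zero_rpow_of_pos hpq.inv_pos] at h3
    have h4 := h3.eventually (gt_mem_nhds (ENNReal.ofReal_pos.2 hc))
    filter_upwards [h4] with h hh
    have e1 : (∫ x, G x ((v + h) x) ∂ν) - (∫ x, G x (v x) ∂ν) - B (hN.derivLp hs v) h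
        = ∫ x, (G x (v x + h x) - G x (v x) - g x (v x) (h x)) ∂ν := by
      have hvh : MemLp (fun x => v x + h x) (ENNReal.ofReal s) ν := (Lp.memLp v).add (Lp.memLp h)
      have h7 := integral_sub (hN.integrable hs hvh) (hN.integrable hs (Lp.memLp v))
      have h8 := integral_sub ((hN.integrable hs hvh).sub (hN.integrable hs (Lp.memLp v)))
        (hN.integrable_deriv hs (Lp.memLp v) (Lp.memLp h))
      simp only [Pi.sub_apply] at h8
      rw [hval, h8, h7]
      congr 2
      refine integral_congr_ae ?_
      filter_upwards [Lp.coeFn_add v h] with x hx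
      rw [hx]; rfl
    rw [e1]
    have e2 : ‖∫ x, (G x (v x + h x) - G x (v x) - g x (v x) (h x)) ∂ν‖ₑ
        ≤ ENNReal.ofReal c * ‖h‖ₑ := by
      refine (enorm_integral_le_lintegral_enorm _).trans ?_
      have hm := (hN.aesm_remainder (Lp.aestronglyMeasurable v) (Lp.aestronglyMeasurable h)).enorm
      -- Dividing and multiplying by `‖h x‖` loses nothing: where `h x = 0` the remainder is zero.
      calc _ = ∫⁻ x, ((fun x => ‖‖h x‖⁻¹ * (G x (v x + h x) - G x (v x)
              - g x (v x) (h x))‖ₑ) * fun x => ‖h x‖ₑ) x ∂ν := by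
            refine lintegral_congr fun x => ?_
            rcases eq_or_ne (h x) 0 with h0 | h0
            · simp [h0]
            · have h5 : ‖h x‖ ≠ 0 := by simpa using h0
              rw [Pi.mul_apply, ← enorm_norm (h x), ← enorm_mul, mul_right_comm,
                inv_mul_cancel₀ h5, one_mul]
        _ ≤ _ := ENNReal.lintegral_mul_le_Lp_mul_Lq ν hpq hm
            (Lp.aestronglyMeasurable h).enorm
        _ ≤ _ := by
            gcongr
            · rw [one_div]; exact hh.le
            · rw [lintegral_enorm_rpow_eq (by linarith), ← ENNReal.rpow_mul, one_div,
                mul_inv_cancel₀ (by linarith), ENNReal.rpow_one]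
    rw [← ofReal_norm, ← ofReal_norm, ← ENNReal.ofReal_mul hc.le] at e2
    exact (ENNReal.ofReal_le_ofReal_iff (by positivity)).1 e2

end IsNemytskii

end Nemytskii

/-! ### Jensen's inequality for vector-valued averages -/

section Jensen

variable {T : Type*} [MeasurableSpace T] {F : Type*} [NormedAddCommGroup F] [NormedSpace ℝ F]

/-- Hölder against the constant `1`, whose norm is `1` for a probability measure. -/
theorem enorm_integral_rpow_le (P : Measure T) [IsProbabilityMeasure P] {p : ℝ} (hp : 1 < p)
    {f : T → F} (hf : AEStronglyMeasurable f P) :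
    ‖∫ t, f t ∂P‖ₑ ^ p ≤ ∫⁻ t, ‖f t‖ₑ ^ p ∂P := by
  have hpq := Real.HolderConjugate.conjExponent hp
  have h1 : ‖∫ t, f t ∂P‖ₑ ≤ (∫⁻ t, ‖f t‖ₑ ^ p ∂P) ^ (1 / p) := by
    refine (enorm_integral_le_lintegral_enorm _).trans ?_
    have := ENNReal.lintegral_mul_le_Lp_mul_Lq P hpq hf.enorm
      (aemeasurable_const (b := (1 : ℝ≥0∞)))
    simpa using this
  calc _ ≤ ((∫⁻ t, ‖f t‖ₑ ^ p ∂P) ^ (1 / p)) ^ p := ENNReal.rpow_le_rpow h1 hpq.nonneg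
    _ = _ := by rw [← ENNReal.rpow_mul, one_div, inv_mul_cancel₀ hpq.ne_zero, ENNReal.rpow_one]

theorem lintegral_enorm_integral_rpow_le {X : Type*} [MeasurableSpace X] (μ : Measure X)
    [SFinite μ] (P : Measure T) [IsProbabilityMeasure P] {p : ℝ} (hp : 1 < p)
    {f : X → T → F} (hf : StronglyMeasurable (Function.uncurry f)) :
    ∫⁻ x, ‖∫ t, f x t ∂P‖ₑ ^ p ∂μ ≤ ∫⁻ t, ∫⁻ x, ‖f x t‖ₑ ^ p ∂μ ∂P := by
  rw [lintegral_lintegral_swap]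
  · refine lintegral_mono fun x => enorm_integral_rpow_le P hp ?_
    exact (hf.comp_measurable measurable_prodMk_left).aestronglyMeasurable
  · have h1 : StronglyMeasurable fun z : T × X => f z.2 z.1 := hf.comp_measurable measurable_swap
    exact (h1.enorm.pow_const _).aemeasurable

end Jensen

/-! ### Mollification: norm bounds, gradients and approximation rate -/

section Mollification

variable {N : ℕ} {F : Type*} [NormedAddCommGroup F] [NormedSpace ℝ F]

/-- The probability measure whose density is a normalized bump function. -/
def bumpMeasure (φ : ContDiffBump (0 : E N)) : Measure (E N) :=
  volume.withDensity fun t => ENNReal.ofReal (φ.normed volume t)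

/-- The mollification of `u` by a normalized bump function. -/
def mollify (φ : ContDiffBump (0 : E N)) (u : E N → F) (x : E N) : F :=
  ∫ t, u (x - t) ∂bumpMeasure φ

theorem measurable_bump (φ : ContDiffBump (0 : E N)) :
    Measurable fun t => ENNReal.ofReal (φ.normed volume t) :=
  φ.continuous_normed.measurable.ennreal_ofReal

instance (φ : ContDiffBump (0 : E N)) : IsProbabilityMeasure (bumpMeasure φ) := by
  constructor
  rw [bumpMeasure, withDensity_apply _ MeasurableSet.univ, setLIntegral_univ,
    ← ofReal_integral_eq_lintegral_ofReal φ.integrable_normed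
      (.of_forall fun x => φ.nonneg_normed x), φ.integral_normed, ENNReal.ofReal_one]

theorem mollify_eq (φ : ContDiffBump (0 : E N)) (u : E N → F) (x : E N) :
    mollify φ u x = ∫ t, φ.normed volume t • u (x - t) := by
  rw [mollify, bumpMeasure, integral_withDensity_eq_integral_toReal_smul (measurable_bump φ)
    (by simp)]
  refine integral_congr_ae (.of_forall fun t => ?_)
  simp only [ENNReal.toReal_ofReal (φ.nonneg_normed t)]

theorem mollify_eq_convolution (φ : ContDiffBump (0 : E N)) (u : E N → F) :
    mollify φ u = convolution (φ.normed volume) u (ContinuousLinearMap.lsmul ℝ ℝ) volume := by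
  ext x
  rw [mollify_eq]; rfl

theorem mollify_eq_swap (φ : ContDiffBump (0 : E N)) (u : E N → F) (x : E N) :
    mollify φ u x = ∫ y, φ.normed volume (x - y) • u y := by
  rw [mollify_eq_convolution, convolution_eq_swap]; rfl

theorem lintegral_mollify_le (φ : ContDiffBump (0 : E N)) {p : ℝ} (hp : 1 < p) {u : E N → F}
    (hu : StronglyMeasurable u) :
    ∫⁻ x, ‖mollify φ u x‖ₑ ^ p ≤ ∫⁻ x, ‖u x‖ₑ ^ p := by
  refine (lintegral_enorm_integral_rpow_le volume (bumpMeasure φ) hp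
    (f := fun x t => u (x - t)) (hu.comp_measurable measurable_sub)).trans ?_
  simp_rw [lintegral_sub_right_eq_self (fun x => ‖u x‖ₑ ^ p)]
  simp

/-- Jensen, then the boundedness of the bump density. At a fixed scale, an `L^p` bound becomes a
uniform one. -/
theorem exists_mollify_le (φ : ContDiffBump (0 : E N)) {p : ℝ} (hp : 1 < p) :
    ∃ C : ℝ≥0∞, C ≠ ⊤ ∧ ∀ (u : E N → F), StronglyMeasurable u → ∀ x,
      ‖mollify φ u x‖ₑ ^ p ≤ C * ∫⁻ y, ‖u y‖ₑ ^ p := by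
  obtain ⟨C, hC⟩ := φ.hasCompactSupport_normed.exists_bound_of_continuous
    (φ.continuous_normed (μ := (volume : Measure (E N))))
  refine ⟨ENNReal.ofReal C, by simp, fun u hu x => ?_⟩
  have hm : StronglyMeasurable fun t => u (x - t) :=
    hu.comp_measurable (measurable_const.sub measurable_id)
  calc _ ≤ ∫⁻ t, ‖u (x - t)‖ₑ ^ p ∂bumpMeasure φ :=
        enorm_integral_rpow_le _ hp hm.aestronglyMeasurable
    _ = ∫⁻ t, ENNReal.ofReal (φ.normed volume t) * ‖u (x - t)‖ₑ ^ p := by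
        rw [bumpMeasure, lintegral_withDensity_eq_lintegral_mul _ (measurable_bump φ)
          (hm.enorm.pow_const _)]
        rfl
    _ ≤ ∫⁻ t, ENNReal.ofReal C * ‖u (x - t)‖ₑ ^ p := by
        gcongr with t
        exact (le_abs_self _).trans (hC t)
    _ = _ := by
        rw [lintegral_const_mul _ (hm.enorm.pow_const _)]
        congr 1
        exact lintegral_sub_left_eq_self (fun y => ‖u y‖ₑ ^ p) x

theorem contDiff_mollify (φ : ContDiffBump (0 : E N)) {u : E N → ℝ}
    (hu : LocallyIntegrable u) : ContDiff ℝ 1 (mollify φ u) := by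
  rw [mollify_eq_convolution]
  exact φ.hasCompactSupport_normed.contDiff_convolution_left (n := 1) _ φ.contDiff_normed hu

/-- The derivative falls on the kernel `φ(x - y)`, whose `x`-derivative is minus its `y`-derivative;
testing the weak gradient with `y ↦ φ(x - y)` moves it onto `u`, and the two signs cancel. -/
theorem fderiv_mollify (φ : ContDiffBump (0 : E N)) {u : E N → ℝ} {g : E N → E N}
    (hu : LocallyIntegrable u) (hg : LocallyIntegrable g) (h : IsWeakGradient u g) (x : E N) :
    fderiv ℝ (mollify φ u) x = innerSL ℝ (mollify φ g x) := by
  have hs : ContDiff ℝ ∞ (φ.normed (volume : Measure (E N))) := φ.contDiff_normed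
  have hc := φ.hasCompactSupport_normed (μ := (volume : Measure (E N)))
  have h1 := hc.hasFDerivAt_convolution_left (ContinuousLinearMap.lsmul ℝ ℝ)
    (φ.contDiff_normed (n := 1)) hu x
  rw [← mollify_eq_convolution] at h1
  rw [h1.fderiv]
  refine ContinuousLinearMap.coe_injective
    ((EuclideanSpace.basisFun (Fin N) ℝ).toBasis.ext fun i => ?_)
  have hexL : Integrable (fun y => (ContinuousLinearMap.precompL (E N)
      (ContinuousLinearMap.lsmul ℝ ℝ : ℝ →L[ℝ] ℝ →L[ℝ] ℝ))
      (fderiv ℝ (φ.normed volume) (x - y)) (u y)) :=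
    ((hc.fderiv ℝ).convolutionExists_left (ContinuousLinearMap.precompL (E N)
      (ContinuousLinearMap.lsmul ℝ ℝ : ℝ →L[ℝ] ℝ →L[ℝ] ℝ))
      (hs.continuous_fderiv (by simp)) hu x).integrable_swap
  have hexR : Integrable (fun y => φ.normed volume (x - y) • g y) :=
    (hc.convolutionExists_left (ContinuousLinearMap.lsmul ℝ ℝ : ℝ →L[ℝ] E N →L[ℝ] E N)
      hs.continuous hg x).integrable_swap
  have hψ : ContDiff ℝ ∞ fun y => φ.normed volume (x - y) := by fun_prop
  have hψc : HasCompactSupport fun y => φ.normed volume (x - y) :=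
    hc.comp_homeomorph (Homeomorph.subLeft x)
  have hd : ∀ y, fderiv ℝ (fun y => φ.normed volume (x - y)) y
      = - fderiv ℝ (φ.normed volume) (x - y) := by
    intro y
    have h2 : HasFDerivAt (fun y : E N => x - y) (-ContinuousLinearMap.id ℝ (E N)) y := by
      simpa using (hasFDerivAt_id y).const_sub x
    have h3 := ((hs.differentiable (by simp) (x - y)).hasFDerivAt).comp y h2
    rw [show (fun y => φ.normed volume (x - y)) = φ.normed volume ∘ fun y => x - y from rfl,
      h3.fderiv]
    simp
  have hw := h _ hψ hψc i
  simp only [hd, neg_apply, mul_neg, integral_neg, neg_inj] at hw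
  simp only [OrthonormalBasis.coe_toBasis, EuclideanSpace.basisFun_apply,
    ContinuousLinearMap.coe_coe]
  rw [convolution_eq_swap, ContinuousLinearMap.integral_apply hexL, innerSL_apply_apply,
    mollify_eq_swap]
  have h5 := (EuclideanSpace.proj (𝕜 := ℝ) i).integral_comp_comm hexR
  simp only [PiLp.proj_apply, PiLp.smul_apply, smul_eq_mul] at h5
  rw [EuclideanSpace.inner_single_right]
  simp only [ContinuousLinearMap.precompL_apply, ContinuousLinearMap.lsmul_apply, smul_eq_mul,
    one_mul, conj_trivial]
  rw [← h5]
  simp_rw [mul_comm _ (u _), mul_comm _ (g _ i)]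
  exact hw

theorem norm_fderiv_mollify (φ : ContDiffBump (0 : E N)) {u : E N → ℝ} {g : E N → E N}
    (hu : LocallyIntegrable u) (hg : LocallyIntegrable g) (h : IsWeakGradient u g) (x : E N) :
    ‖fderiv ℝ (mollify φ u) x‖ₑ = ‖mollify φ g x‖ₑ := by
  rw [fderiv_mollify φ hu hg h, ← ofReal_norm, innerSL_apply_norm, ofReal_norm]

/-- The difference is the average over `t ∈ (0, 1]` of directional derivatives along the segment;
Jensen and translation invariance conclude. -/
theorem lintegral_translate_sub_le_of_contDiff {v : E N → ℝ} (hv : ContDiff ℝ 1 v) {p : ℝ}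
    (hp : 1 < p) (h : E N) :
    ∫⁻ x, ‖v (x - h) - v x‖ₑ ^ p ≤ ‖h‖ₑ ^ p * ∫⁻ x, ‖fderiv ℝ v x‖ₑ ^ p := by
  have hcont := hv.continuous_fderiv one_ne_zero
  have h1 : ∀ x, v (x - h) - v x =
      ∫ t, fderiv ℝ v (x - t • h) (-h) ∂(volume.restrict (Ioc (0 : ℝ) 1)) := by
    intro x
    rw [← intervalIntegral.integral_of_le zero_le_one]
    have h2 : ∀ t ∈ uIcc (0 : ℝ) 1, HasDerivAt (fun t : ℝ => v (x - t • h))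
        (fderiv ℝ v (x - t • h) (-h)) t := by
      intro t _
      have h3 : HasDerivAt (fun t : ℝ => x - t • h) (-h) t := by
        simpa using ((hasDerivAt_id t).smul_const h).const_sub x
      exact ((hv.differentiable one_ne_zero _).hasFDerivAt).comp_hasDerivAt t h3
    rw [intervalIntegral.integral_eq_sub_of_hasDerivAt h2]
    · simp
    · refine Continuous.intervalIntegrable ?_ _ _
      fun_prop
  have : IsProbabilityMeasure (volume.restrict (Ioc (0 : ℝ) 1)) := ⟨by simp⟩
  simp_rw [h1]
  refine (lintegral_enorm_integral_rpow_le volume _ hp ?_).trans ?_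
  · refine Continuous.stronglyMeasurable ?_
    fun_prop
  · have h4 : ∀ t : ℝ, ∫⁻ x, ‖fderiv ℝ v (x - t • h) (-h)‖ₑ ^ p
        ≤ ‖h‖ₑ ^ p * ∫⁻ x, ‖fderiv ℝ v x‖ₑ ^ p := by
      intro t
      rw [← lintegral_sub_right_eq_self (fun x => ‖fderiv ℝ v x‖ₑ ^ p) (t • h),
        ← lintegral_const_mul _ (by fun_prop)]
      refine lintegral_mono fun x => ?_
      rw [← ENNReal.mul_rpow_of_nonneg _ _ (by linarith)]
      refine ENNReal.rpow_le_rpow ?_ (by linarith)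
      rw [mul_comm, ← enorm_neg h]
      exact ContinuousLinearMap.le_opENorm _ _
    refine (lintegral_mono h4).trans ?_
    simp

/-- A sequence of bump functions whose supports shrink to `0`. -/
def bumpSeq (N : ℕ) (k : ℕ) : ContDiffBump (0 : E N) where
  rIn := (1 / 2) * (1 / ((k : ℝ) + 1))
  rOut := 1 / ((k : ℝ) + 1)
  rIn_pos := by positivity
  rIn_lt_rOut := by
    have : 0 < 1 / ((k : ℝ) + 1) := by positivity
    linarith

theorem ae_tendsto_mollify {u : E N → ℝ} (hu : LocallyIntegrable u) :
    ∀ᵐ x, Tendsto (fun k => mollify (bumpSeq N k) u x) atTop (𝓝 (u x)) := by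
  simp_rw [mollify_eq_convolution]
  -- `K = 2` is the ratio of outer to inner radius, the same for every bump of `bumpSeq`.
  refine ContDiffBump.ae_convolution_tendsto_right_of_locallyIntegrable (K := 2)
    tendsto_one_div_add_atTop_nhds_zero_nat (.of_forall fun k => ?_) hu
  simp only [bumpSeq]
  linarith

variable {p : ℝ} {u : E N → ℝ} {g : E N → E N}

/-- The `C¹` estimate applies to the mollifications with a bound independent of the scale; Fatou
passes to the limit. -/
theorem lintegral_translate_sub_le (hp : 1 < p) (hu : LocallyIntegrable u)
    (hg : LocallyIntegrable g) (hgm : StronglyMeasurable g)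
    (h : IsWeakGradient u g) (z : E N) :
    ∫⁻ x, ‖u (x - z) - u x‖ₑ ^ p ≤ ‖z‖ₑ ^ p * ∫⁻ x, ‖g x‖ₑ ^ p := by
  have h1 := ae_tendsto_mollify hu
  have h2 : ∀ᵐ x, Tendsto (fun k => mollify (bumpSeq N k) u (x - z)) atTop (𝓝 (u (x - z))) :=
    (measurePreserving_sub_right volume z).quasiMeasurePreserving.ae h1
  have h3 : ∀ k, ∫⁻ x, ‖mollify (bumpSeq N k) u (x - z) - mollify (bumpSeq N k) u x‖ₑ ^ p
      ≤ ‖z‖ₑ ^ p * ∫⁻ x, ‖g x‖ₑ ^ p := by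
    intro k
    refine (lintegral_translate_sub_le_of_contDiff (contDiff_mollify _ hu) hp z).trans ?_
    refine mul_le_mul' le_rfl ?_
    simp_rw [norm_fderiv_mollify _ hu hg h]
    exact lintegral_mollify_le _ hp hgm
  calc ∫⁻ x, ‖u (x - z) - u x‖ₑ ^ p
      = ∫⁻ x, liminf (fun k => ‖mollify (bumpSeq N k) u (x - z)
          - mollify (bumpSeq N k) u x‖ₑ ^ p) atTop := by
        refine lintegral_congr_ae ?_
        filter_upwards [h1, h2] with x hx1 hx2
        exact (((ENNReal.continuous_rpow_const (y := p)).continuousAt.tendsto.comp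
          (hx2.sub hx1).enorm).liminf_eq).symm
    _ ≤ liminf (fun k => ∫⁻ x, ‖mollify (bumpSeq N k) u (x - z)
          - mollify (bumpSeq N k) u x‖ₑ ^ p) atTop := by
        refine lintegral_liminf_le fun k => ?_
        have := (contDiff_mollify (bumpSeq N k) hu).continuous
        fun_prop
    _ ≤ _ := liminf_le_of_le (by isBoundedDefault) fun b hb => by
        obtain ⟨k, hk⟩ := hb.exists
        exact hk.trans (h3 k)

/-- The error is an average of translation differences over shifts no longer than the outer radius.
The rate is uniform on bounded sets of `W^{1,p}`, which drives the local compactness. -/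
theorem lintegral_mollify_sub_le (hp : 1 < p) (hu : LocallyIntegrable u)
    (hum : StronglyMeasurable u) (hg : LocallyIntegrable g) (hgm : StronglyMeasurable g)
    (h : IsWeakGradient u g) (φ : ContDiffBump (0 : E N)) :
    ∫⁻ x, ‖mollify φ u x - u x‖ₑ ^ p ≤ ENNReal.ofReal φ.rOut ^ p * ∫⁻ x, ‖g x‖ₑ ^ p := by
  have hint : ∀ x, Integrable (fun t => u (x - t)) (bumpMeasure φ) := by
    intro x
    rw [bumpMeasure, integrable_withDensity_iff_integrable_smul' (measurable_bump φ) (by simp)]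
    have := (φ.hasCompactSupport_normed (μ := (volume : Measure (E N)))).convolutionExists_left
      (ContinuousLinearMap.lsmul ℝ ℝ : ℝ →L[ℝ] ℝ →L[ℝ] ℝ) φ.continuous_normed hu x
    refine Integrable.congr this (.of_forall fun t => ?_)
    simp [ENNReal.toReal_ofReal (φ.nonneg_normed t)]
  have hsupp : ∀ᵐ t ∂bumpMeasure φ, ‖t‖ₑ ≤ ENNReal.ofReal φ.rOut := by
    rw [bumpMeasure, ae_withDensity_iff (measurable_bump φ)]
    refine .of_forall fun t ht => ?_
    have h1 : t ∈ Function.support (φ.normed (volume : Measure (E N))) := by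
      intro h0
      exact ht (by simp [h0])
    rw [φ.support_normed_eq (μ := volume), mem_ball_zero_iff] at h1
    rw [← ofReal_norm]
    exact ENNReal.ofReal_le_ofReal h1.le
  have h1 : ∀ x, mollify φ u x - u x = ∫ t, (u (x - t) - u x) ∂bumpMeasure φ := by
    intro x
    rw [integral_sub (hint x) (integrable_const _)]
    simp [mollify]
  simp_rw [h1]
  refine (lintegral_enorm_integral_rpow_le volume _ hp ?_).trans ?_
  · exact (hum.comp_measurable measurable_sub).sub (hum.comp_measurable measurable_fst)
  · calc _ ≤ ∫⁻ _, (ENNReal.ofReal φ.rOut ^ p * ∫⁻ x, ‖g x‖ₑ ^ p) ∂bumpMeasure φ := by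
          refine lintegral_mono_ae ?_
          filter_upwards [hsupp] with t ht
          refine (lintegral_translate_sub_le hp hu hg hgm h t).trans ?_
          gcongr
      _ = _ := by simp

end Mollification

variable {N : ℕ} {p : ℝ}

theorem eLpNorm_ofReal_eq {α F : Type*} [MeasurableSpace α] [NormedAddCommGroup F]
    {ν : Measure α} (hp : 0 < p) (u : α → F) :
    eLpNorm u (ENNReal.ofReal p) ν = (∫⁻ x, ‖u x‖ₑ ^ p ∂ν) ^ (1 / p) := by
  rw [eLpNorm_eq_lintegral_rpow_enorm_toReal (by simpa using hp) (by simp),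
    ENNReal.toReal_ofReal hp.le]

theorem eLpNorm_mollify_le {F : Type*} [NormedAddCommGroup F] [NormedSpace ℝ F]
    (φ : ContDiffBump (0 : E N)) (hp : 1 < p) {u : E N → F} (hu : StronglyMeasurable u) :
    eLpNorm (mollify φ u) (ENNReal.ofReal p) volume ≤ eLpNorm u (ENNReal.ofReal p) volume := by
  rw [eLpNorm_ofReal_eq (by linarith), eLpNorm_ofReal_eq (by linarith)]
  exact ENNReal.rpow_le_rpow (lintegral_mollify_le φ hp hu) (by positivity)

/-! ### The Sobolev inequality for weakly differentiable functions -/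

section Sobolev

/-- A smooth cut-off function, equal to `1` on the unit ball. -/
def cutoffBump (N : ℕ) : ContDiffBump (0 : E N) where
  rIn := 1
  rOut := 2
  rIn_pos := by norm_num
  rIn_lt_rOut := by norm_num

/-- Smooth cut-off functions `x ↦ χ (x / (k + 1))` with `χ = 1` on the unit ball. -/
def dilatedCutoff (N : ℕ) (k : ℕ) (x : E N) : ℝ := cutoffBump N (((k : ℝ) + 1)⁻¹ • x)

theorem contDiff_dilatedCutoff (k : ℕ) : ContDiff ℝ 1 (dilatedCutoff N k) := by
  unfold dilatedCutoff
  exact (cutoffBump N).contDiff.comp (contDiff_const_smul _)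

theorem hasCompactSupport_dilatedCutoff (k : ℕ) : HasCompactSupport (dilatedCutoff N k) :=
  (cutoffBump N).hasCompactSupport.comp_smul (by positivity)

theorem tendsto_dilatedCutoff (x : E N) :
    Tendsto (fun k => dilatedCutoff N k x) atTop (𝓝 1) := by
  refine tendsto_const_nhds.congr' ?_
  filter_upwards [tendsto_natCast_atTop_atTop.eventually_ge_atTop ‖x‖] with k hk
  refine ((cutoffBump N).one_of_mem_closedBall ?_).symm
  rw [mem_closedBall_zero_iff, norm_smul, norm_inv, Real.norm_of_nonneg (by positivity)]
  rw [inv_mul_le_iff₀ (by positivity)]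
  simp [cutoffBump]
  linarith

theorem exists_norm_fderiv_dilatedCutoff_le (N : ℕ) :
    ∃ C : ℝ, 0 ≤ C ∧ ∀ (k : ℕ) (x : E N), ‖fderiv ℝ (dilatedCutoff N k) x‖ ≤ C := by
  have h1 : ContDiff ℝ 1 (cutoffBump N) := (cutoffBump N).contDiff
  obtain ⟨C, hC⟩ := ((cutoffBump N).hasCompactSupport.fderiv ℝ).exists_bound_of_continuous
    (h1.continuous_fderiv one_ne_zero)
  refine ⟨C, (norm_nonneg _).trans (hC 0), fun k x => ?_⟩
  have h2 : fderiv ℝ (dilatedCutoff N k) x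
      = ((k : ℝ) + 1)⁻¹ • fderiv ℝ (cutoffBump N) (((k : ℝ) + 1)⁻¹ • x) :=
    fderiv_comp_smul _
  rw [h2, norm_smul, norm_inv, Real.norm_of_nonneg (by positivity)]
  refine (mul_le_of_le_one_left (norm_nonneg _) ?_).trans (hC _)
  exact inv_le_one_of_one_le₀ (by simp)

theorem abs_dilatedCutoff_le (k : ℕ) (x : E N) : ‖dilatedCutoff N k x‖ ≤ 1 := by
  rw [dilatedCutoff, Real.norm_of_nonneg (cutoffBump N).nonneg]
  exact (cutoffBump N).le_one

/-- The inequality for compactly supported `C¹` functions is applied to cut-off mollifications of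
`u`. Their gradients are bounded in `L^p` uniformly, and lower semicontinuity of the norm under
almost everywhere convergence gives the bound for `u`. -/
theorem exists_eLpNorm_le (hp : 1 < p) (hpN : p < N) :
    ∃ C : ℝ≥0∞, C ≠ ⊤ ∧ ∀ (u : E N → ℝ) (g : E N → E N), StronglyMeasurable u →
      StronglyMeasurable g → LocallyIntegrable u → LocallyIntegrable g → IsWeakGradient u g →
      eLpNorm u (ENNReal.ofReal (pStar N p)) volume ≤
        C * (eLpNorm u (ENNReal.ofReal p) volume + eLpNorm g (ENNReal.ofReal p) volume) := by
  obtain ⟨C₀, hC₀, hχ⟩ := exists_norm_fderiv_dilatedCutoff_le N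
  set S : ℝ≥0∞ := ((SNormLESNormFDerivOfEqConst ℝ (volume : Measure (E N)) (p.toNNReal : ℝ) :
    NNReal) : ℝ≥0∞) with hS
  refine ⟨S * (1 + ENNReal.ofReal C₀), by finiteness, fun u g hum hgm hu hg h => ?_⟩
  set w : ℕ → E N → ℝ := fun k x => dilatedCutoff N k x * mollify (bumpSeq N k) u x with hw
  have hwC : ∀ k, ContDiff ℝ 1 (w k) := fun k =>
    (contDiff_dilatedCutoff k).mul (contDiff_mollify _ hu)
  have hwc : ∀ k, HasCompactSupport (w k) := fun k => (hasCompactSupport_dilatedCutoff k).mul_right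
  have hae : ∀ᵐ x, Tendsto (fun k => w k x) atTop (𝓝 (u x)) := by
    filter_upwards [ae_tendsto_mollify hu] with x hx
    simpa using (tendsto_dilatedCutoff x).mul hx
  have hder : ∀ k, eLpNorm (fderiv ℝ (w k)) (ENNReal.ofReal p) volume ≤
      (1 + ENNReal.ofReal C₀) *
        (eLpNorm u (ENNReal.ofReal p) volume + eLpNorm g (ENNReal.ofReal p) volume) := by
    intro k
    have hm := contDiff_mollify (bumpSeq N k) hu
    have hmc := hm.continuous
    have hmd := hm.continuous_fderiv one_ne_zero
    -- Product rule: the cut-off is at most `1` and its gradient at most `C₀`, uniformly in the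
    -- dilation.
    have h1 : ∀ x, ‖fderiv ℝ (w k) x‖ ≤
        ‖‖fderiv ℝ (mollify (bumpSeq N k) u) x‖ + C₀ * ‖mollify (bumpSeq N k) u x‖‖ := by
      intro x
      have h2 := ((contDiff_dilatedCutoff k).differentiable one_ne_zero x).hasFDerivAt.mul
        (hm.differentiable one_ne_zero x).hasFDerivAt
      have h3 : fderiv ℝ (w k) x = _ := h2.fderiv
      rw [h3, Real.norm_of_nonneg (by positivity)]
      refine (norm_add_le _ _).trans (add_le_add ?_ ?_)
      · rw [norm_smul]
        exact mul_le_of_le_one_left (norm_nonneg _) (abs_dilatedCutoff_le k x)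
      · rw [norm_smul, mul_comm]
        gcongr
        exact hχ k x
    have hp1 : 1 ≤ ENNReal.ofReal p := ENNReal.one_le_ofReal.2 hp.le
    calc _ ≤ eLpNorm (fun x => ‖fderiv ℝ (mollify (bumpSeq N k) u) x‖
            + C₀ * ‖mollify (bumpSeq N k) u x‖) (ENNReal.ofReal p) volume := eLpNorm_mono h1
      _ ≤ eLpNorm (fun x => ‖fderiv ℝ (mollify (bumpSeq N k) u) x‖) (ENNReal.ofReal p) volume
          + eLpNorm (fun x => C₀ * ‖mollify (bumpSeq N k) u x‖) (ENNReal.ofReal p) volume :=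
        eLpNorm_add_le hmd.norm.aestronglyMeasurable
          (hmc.norm.const_mul C₀).aestronglyMeasurable hp1
      _ = eLpNorm (mollify (bumpSeq N k) g) (ENNReal.ofReal p) volume
          + ENNReal.ofReal C₀ * eLpNorm (mollify (bumpSeq N k) u) (ENNReal.ofReal p) volume := by
        congr 1
        · refine eLpNorm_congr_enorm_ae (.of_forall fun x => ?_)
          rw [enorm_norm, norm_fderiv_mollify _ hu hg h]
        · have := eLpNorm_const_smul (p := ENNReal.ofReal p) (μ := volume) C₀
            (fun x => ‖mollify (bumpSeq N k) u x‖)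
          rw [eLpNorm_norm, Real.enorm_of_nonneg hC₀] at this
          exact this
      _ ≤ eLpNorm g (ENNReal.ofReal p) volume
          + ENNReal.ofReal C₀ * eLpNorm u (ENNReal.ofReal p) volume := by
        gcongr
        · exact eLpNorm_mollify_le _ hp hgm
        · exact eLpNorm_mollify_le _ hp hum
      _ ≤ _ := by
        rw [add_mul, mul_add, mul_add, one_mul, one_mul]
        generalize eLpNorm g (ENNReal.ofReal p) volume = a
        generalize eLpNorm u (ENNReal.ofReal p) volume = b
        calc _ ≤ (b + a) + (ENNReal.ofReal C₀ * b) := by gcongr; exact le_add_self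
          _ ≤ _ := by gcongr; exact le_self_add
  have hsob : ∀ k, eLpNorm (w k) (ENNReal.ofReal (pStar N p)) volume ≤
      S * (1 + ENNReal.ofReal C₀) *
        (eLpNorm u (ENNReal.ofReal p) volume + eLpNorm g (ENNReal.ofReal p) volume) := by
    intro k
    have hN : 0 < (N : ℝ) := by linarith
    have h1 := eLpNorm_le_eLpNorm_fderiv_of_eq (μ := (volume : Measure (E N))) (F := ℝ)
      (hwC k) (hwc k) (p := p.toNNReal) (p' := (pStar N p).toNNReal)
      (by simpa using hp.le) (by simpa using hN) (by
        have h2 : 0 < pStar N p := div_pos (by positivity) (by linarith)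
        push_cast
        rw [Real.coe_toNNReal _ h2.le, Real.coe_toNNReal _ (by linarith), pStar]
        have : (N : ℝ) - p ≠ 0 := by linarith
        have : p ≠ 0 := by linarith
        simp
        field_simp)
    rw [mul_assoc]
    exact h1.trans (by gcongr; exact hder k)
  refine (Lp.eLpNorm_lim_le_liminf_eLpNorm (fun k => (hwC k).continuous.aestronglyMeasurable)
    u hae).trans (liminf_le_of_le (by isBoundedDefault) fun b hb => ?_)
  obtain ⟨k, hk⟩ := hb.exists
  exact hk.trans (hsob k)

end Sobolev

/-! ### Interpolation of powers -/

variable {N : ℕ} {p : ℝ}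

theorem lintegral_rpow_eq_eLpNorm {α F : Type*} [MeasurableSpace α] [NormedAddCommGroup F]
    {ν : Measure α} {s : ℝ} (hs : 0 < s) (u : α → F) :
    ∫⁻ x, ‖u x‖ₑ ^ s ∂ν = eLpNorm u (ENNReal.ofReal s) ν ^ s := by
  rw [eLpNorm_ofReal_eq hs, ← ENNReal.rpow_mul, one_div, inv_mul_cancel₀ hs.ne', ENNReal.rpow_one]

/-- Below the threshold `T` the first term dominates, above it the second. -/
theorem rpow_le_add_rpow {s P T t : ℝ} (hp0 : 0 < p) (hs : p ≤ s) (hs' : s ≤ P) (hT : 0 < T)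
    (ht : 0 ≤ t) : t ^ s ≤ T ^ (s - p) * t ^ p + T ^ (s - P) * t ^ P := by
  rcases ht.eq_or_lt with rfl | ht
  · rw [Real.zero_rpow (by linarith)]; positivity
  rcases le_total t T with h | h
  · have h1 : t ^ s = t ^ (s - p) * t ^ p := by rw [← Real.rpow_add ht]; simp
    have h2 : t ^ (s - p) ≤ T ^ (s - p) := Real.rpow_le_rpow ht.le h (by linarith)
    have h3 : 0 ≤ T ^ (s - P) * t ^ P := by positivity
    have h4 : 0 ≤ t ^ p := by positivity
    nlinarith
  · have h1 : t ^ s = t ^ (s - P) * t ^ P := by rw [← Real.rpow_add ht]; simp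
    have h2 : t ^ (s - P) ≤ T ^ (s - P) := Real.rpow_le_rpow_of_nonpos hT h (by linarith)
    have h3 : 0 ≤ T ^ (s - p) * t ^ p := by positivity
    have h4 : 0 ≤ t ^ P := by positivity
    nlinarith

/-- Subcriticality `s < P` makes `T^(s - P)` as small as desired for large `T`. -/
theorem exists_rpow_le {s P η : ℝ} (hp0 : 0 < p) (hs : p < s) (hs' : s < P) (hη : 0 < η) :
    ∃ C : ℝ, 0 ≤ C ∧ ∀ t, 0 ≤ t → t ^ s ≤ C * t ^ p + η * t ^ P := by
  have h1 := (tendsto_rpow_neg_atTop (by linarith : 0 < P - s)).eventually (gt_mem_nhds hη)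
  obtain ⟨T, h2, h3⟩ := (h1.and (eventually_gt_atTop 0)).exists
  refine ⟨T ^ (s - p), by positivity, fun t ht => ?_⟩
  refine (rpow_le_add_rpow hp0 hs.le hs'.le h3 ht).trans ?_
  rw [neg_sub] at h2
  gcongr

theorem exists_enorm_rpow_le {s P η : ℝ} (hp0 : 0 < p) (hs : p < s) (hs' : s < P) (hη : 0 < η) :
    ∃ C : ℝ, ∀ t : ℝ, ‖t‖ₑ ^ s ≤ ENNReal.ofReal C * ‖t‖ₑ ^ p + ENNReal.ofReal η * ‖t‖ₑ ^ P := by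
  obtain ⟨C, hC, h⟩ := exists_rpow_le hp0 hs hs' hη
  refine ⟨C, fun t => ?_⟩
  have := ENNReal.ofReal_le_ofReal (h ‖t‖ (norm_nonneg t))
  rwa [ENNReal.ofReal_add (by positivity) (by positivity), ENNReal.ofReal_mul hC,
    ENNReal.ofReal_mul hη.le, ← ENNReal.ofReal_rpow_of_nonneg (by positivity) (by linarith),
    ← ENNReal.ofReal_rpow_of_nonneg (by positivity) (by linarith),
    ← ENNReal.ofReal_rpow_of_nonneg (by positivity) (by linarith), ofReal_norm] at this

variable [hp : Fact (1 < p)]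

theorem LpPair.norm_rpow_eq (w : LpPair N p) : ‖w‖ ^ p = ‖w.fst‖ ^ p + ‖w.snd‖ ^ p := by
  have hp0 : 0 < p := by linarith [hp.out]
  rw [WithLp.prod_norm_eq_add (by rw [ENNReal.toReal_ofReal hp0.le]; exact hp0),
    ENNReal.toReal_ofReal hp0.le, ← Real.rpow_mul (by positivity), one_div,
    inv_mul_cancel₀ hp0.ne', Real.rpow_one]

/-! ### The Sobolev space: completeness, embeddings and compactness -/

namespace W1p

/-- The inclusion `W^{1,p} → L^p`. -/
def fnL (N : ℕ) (p : ℝ) [Fact (1 < p)] : W1p N p →L[ℝ]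
    Lp ℝ (ENNReal.ofReal p) (volume : Measure (E N)) :=
  (WithLp.fstL _ ℝ _ _).comp (W1p N p).subtypeL

/-- The weak gradient as a map `W^{1,p} → L^p`. -/
def gradL (N : ℕ) (p : ℝ) [Fact (1 < p)] :
    W1p N p →L[ℝ] Lp (E N) (ENNReal.ofReal p) (volume : Measure (E N)) :=
  (WithLp.sndL _ ℝ _ _).comp (W1p N p).subtypeL

theorem coe_fnL (u : W1p N p) : (fnL N p u : E N → ℝ) = fn u := rfl

theorem norm_rpow_eq (u : W1p N p) : ‖u‖ ^ p = ‖fnL N p u‖ ^ p + ‖gradL N p u‖ ^ p :=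
  LpPair.norm_rpow_eq (u : LpPair N p)

theorem norm_fnL_le (u : W1p N p) : ‖fnL N p u‖ ≤ ‖u‖ := by
  have hp0 : 0 < p := by linarith [hp.out]
  rw [← Real.rpow_le_rpow_iff (by positivity) (by positivity) hp0, norm_rpow_eq]
  simp only [le_add_iff_nonneg_right]; positivity

theorem norm_gradL_le (u : W1p N p) : ‖gradL N p u‖ ≤ ‖u‖ := by
  have hp0 : 0 < p := by linarith [hp.out]
  rw [← Real.rpow_le_rpow_iff (by positivity) (by positivity) hp0, norm_rpow_eq]
  simp only [le_add_iff_nonneg_left]; positivity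

theorem stronglyMeasurable_fn (u : W1p N p) : StronglyMeasurable (fn u) := Lp.stronglyMeasurable _

theorem stronglyMeasurable_grad (u : W1p N p) : StronglyMeasurable (grad u) :=
  Lp.stronglyMeasurable _

theorem memLp_fn (u : W1p N p) : MemLp (fn u) (ENNReal.ofReal p) volume := Lp.memLp (fnL N p u)

theorem memLp_grad (u : W1p N p) : MemLp (grad u) (ENNReal.ofReal p) volume :=
  Lp.memLp (gradL N p u)

theorem locallyIntegrable_fn (u : W1p N p) : LocallyIntegrable (fn u) :=
  (memLp_fn u).locallyIntegrable Fact.out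

theorem locallyIntegrable_grad (u : W1p N p) : LocallyIntegrable (grad u) :=
  (memLp_grad u).locallyIntegrable Fact.out

theorem isWeakGradient (u : W1p N p) : IsWeakGradient (fn u) (grad u) := u.2

theorem fn_sub (u v : W1p N p) : fn (u - v) =ᵐ[volume] fun x => fn u x - fn v x := by
  rw [← coe_fnL, map_sub]
  exact Lp.coeFn_sub _ _

theorem eLpNorm_fn_le (u : W1p N p) :
    eLpNorm (fn u) (ENNReal.ofReal p) volume ≤ ENNReal.ofReal ‖u‖ := by
  have : eLpNorm (fn u) (ENNReal.ofReal p) volume = ‖fnL N p u‖ₑ := (Lp.enorm_def _).symm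
  rw [this, ← ofReal_norm]
  exact ENNReal.ofReal_le_ofReal (norm_fnL_le u)

theorem eLpNorm_grad_le (u : W1p N p) :
    eLpNorm (grad u) (ENNReal.ofReal p) volume ≤ ENNReal.ofReal ‖u‖ := by
  have : eLpNorm (grad u) (ENNReal.ofReal p) volume = ‖gradL N p u‖ₑ := (Lp.enorm_def _).symm
  rw [this, ← ofReal_norm]
  exact ENNReal.ofReal_le_ofReal (norm_gradL_le u)

/-- For a fixed test function both sides of the weak-gradient identity are `L^p`–`L^{p'}` pairings,
hence continuous. -/
theorem isClosed (N : ℕ) (p : ℝ) [hp : Fact (1 < p)] : IsClosed (W1p N p : Set (LpPair N p)) := by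
  have hpq : (p.conjExponent).HolderConjugate p :=
    (Real.HolderConjugate.conjExponent hp.out).symm
  have := hpq.ennrealOfReal
  have : Fact (1 ≤ ENNReal.ofReal p.conjExponent) := ⟨ENNReal.one_le_ofReal.2 hpq.lt.le⟩
  have key : ∀ (ψ : E N → ℝ), Continuous ψ → HasCompactSupport ψ →
      Continuous fun f : Lp ℝ (ENNReal.ofReal p) (volume : Measure (E N)) => ∫ x, f x * ψ x := by
    intro ψ hψ hc
    have hm : MemLp ψ (ENNReal.ofReal p.conjExponent) volume := hψ.memLp_of_hasCompactSupport hc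
    have h1 := ((ContinuousLinearMap.mul ℝ ℝ).lpPairing (volume : Measure (E N))
      (ENNReal.ofReal p.conjExponent) (ENNReal.ofReal p) (hm.toLp ψ)).continuous
    refine h1.congr fun f => ?_
    rw [ContinuousLinearMap.lpPairing_eq_integral]
    refine integral_congr_ae ?_
    filter_upwards [hm.coeFn_toLp] with x hx
    rw [hx, ContinuousLinearMap.mul_apply', mul_comm]
  have e : (W1p N p : Set (LpPair N p)) = ⋂ (φ : E N → ℝ) (_ : ContDiff ℝ ∞ φ)
      (_ : HasCompactSupport φ) (i : Fin N), {w : LpPair N p |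
        ∫ x, w.fst x * fderiv ℝ φ x (EuclideanSpace.single i 1) = - ∫ x, w.snd x i * φ x} := by
    ext w
    simp only [mem_iInter, mem_ofPred_eq]
    rfl
  rw [e]
  refine isClosed_iInter fun φ => isClosed_iInter fun hφ => isClosed_iInter fun hc =>
    isClosed_iInter fun i => isClosed_eq ?_ (Continuous.neg ?_)
  · exact (key (fun x => fderiv ℝ φ x (EuclideanSpace.single i 1))
      ((hφ.continuous_fderiv (by simp)).clm_apply continuous_const) (hc.fderiv_apply (𝕜 := ℝ) _)).comp
      (WithLp.fstL (ENNReal.ofReal p) ℝ _ _).continuous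
  · have h2 := (key φ hφ.continuous hc).comp
      (((EuclideanSpace.proj (𝕜 := ℝ) i : E N →L[ℝ] ℝ).compLpL (ENNReal.ofReal p)
        (volume : Measure (E N))).continuous.comp
      (WithLp.sndL (ENNReal.ofReal p) ℝ (Lp ℝ (ENNReal.ofReal p) (volume : Measure (E N)))
        (Lp (E N) (ENNReal.ofReal p) (volume : Measure (E N)))).continuous)
    refine h2.congr fun w => ?_
    simp only [Function.comp_apply]
    refine integral_congr_ae ?_
    filter_upwards [(EuclideanSpace.proj (𝕜 := ℝ) i : E N →L[ℝ] ℝ).coeFn_compLpL w.snd] with x hx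
    change ((EuclideanSpace.proj (𝕜 := ℝ) i : E N →L[ℝ] ℝ).compLpL (ENNReal.ofReal p)
      (volume : Measure (E N)) w.snd) x * φ x = w.snd x i * φ x
    rw [hx]
    rfl

instance : CompleteSpace (W1p N p) :=
  (isClosed N p).completeSpace_coe

/-- On the unit ball `|t|^s ≤ |t|^p + |t|^{p*}` bounds the integral by some `L ≥ 1`, and `L^(1/s) ≤
L` removes the dependence on `s`; homogeneity does the rest. -/
theorem exists_lintegral_le (hpN : p < N) :
    ∃ K : ℝ, 0 ≤ K ∧ ∀ s, p ≤ s → s ≤ pStar N p → ∀ u : W1p N p,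
      eLpNorm (fn u) (ENNReal.ofReal s) volume ≤ ENNReal.ofReal (K * ‖u‖) := by
  have hp1 := hp.out
  obtain ⟨C, hC, h⟩ := exists_eLpNorm_le (N := N) hp1 hpN
  set L : ℝ≥0∞ := 1 + (C * 2) ^ pStar N p with hL
  have hN : 0 < (N : ℝ) := by linarith
  have hP : 0 < pStar N p := div_pos (by positivity) (by linarith)
  have hLt : L ≠ ⊤ := by finiteness
  have hL1 : 1 ≤ L := le_self_add
  have unit : ∀ s, p ≤ s → s ≤ pStar N p → ∀ u : W1p N p, ‖u‖ ≤ 1 →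
      eLpNorm (fn u) (ENNReal.ofReal s) volume ≤ L := by
    intro s hs hs' u hu
    have h1 : eLpNorm (fn u) (ENNReal.ofReal p) volume ≤ 1 :=
      (eLpNorm_fn_le u).trans (ENNReal.ofReal_le_one.2 hu)
    have h2 : eLpNorm (grad u) (ENNReal.ofReal p) volume ≤ 1 :=
      (eLpNorm_grad_le u).trans (ENNReal.ofReal_le_one.2 hu)
    have h3 : eLpNorm (fn u) (ENNReal.ofReal (pStar N p)) volume ≤ C * 2 := by
      refine (h _ _ (stronglyMeasurable_fn u) (stronglyMeasurable_grad u)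
        (locallyIntegrable_fn u) (locallyIntegrable_grad u) (isWeakGradient u)).trans ?_
      gcongr
      calc _ ≤ (1 : ℝ≥0∞) + 1 := add_le_add h1 h2
        _ = 2 := by norm_num
    have h4 : ∫⁻ x, ‖fn u x‖ₑ ^ s ≤ L := by
      calc _ ≤ ∫⁻ x, (‖fn u x‖ₑ ^ p + ‖fn u x‖ₑ ^ pStar N p) := by
            refine lintegral_mono fun x => ?_
            rcases le_total ‖fn u x‖ₑ 1 with h5 | h5
            · exact (ENNReal.rpow_le_rpow_of_exponent_ge h5 hs).trans le_self_add
            · exact (ENNReal.rpow_le_rpow_of_exponent_le h5 hs').trans le_add_self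
        _ = (∫⁻ x, ‖fn u x‖ₑ ^ p) + ∫⁻ x, ‖fn u x‖ₑ ^ pStar N p :=
            lintegral_add_left ((stronglyMeasurable_fn u).enorm.pow_const _) _
        _ ≤ L := by
            refine add_le_add ?_ ?_
            · rw [lintegral_rpow_eq_eLpNorm (by linarith)]
              exact ENNReal.rpow_le_one h1 (by linarith)
            · rw [lintegral_rpow_eq_eLpNorm hP]
              gcongr
    rw [eLpNorm_ofReal_eq (by linarith)]
    calc _ ≤ L ^ (1 / s) := by
          have : 0 ≤ 1 / s := by have : 0 < s := by linarith
                                 positivity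
          gcongr
      _ ≤ L ^ (1 : ℝ) := by
          refine ENNReal.rpow_le_rpow_of_exponent_le hL1 ?_
          rw [div_le_one (by linarith)]; linarith
      _ = L := ENNReal.rpow_one _
  refine ⟨L.toReal, by positivity, fun s hs hs' u => ?_⟩
  rcases eq_or_ne u 0 with rfl | hu
  · have h0 : fn (0 : W1p N p) =ᵐ[volume] 0 := by
      rw [← coe_fnL, map_zero]
      exact Lp.coeFn_zero _ _ _
    rw [eLpNorm_congr_ae h0]; simp
  · have hu' : 0 < ‖u‖ := by simpa using hu
    have h1 := unit s hs hs' (‖u‖⁻¹ • u) (by rw [norm_smul, norm_inv, norm_norm, inv_mul_cancel₀ hu'.ne'])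
    have h2 : fn u =ᵐ[volume] ‖u‖ • fn (‖u‖⁻¹ • u) := by
      have h3 : u = ‖u‖ • (‖u‖⁻¹ • u) := by rw [smul_smul, mul_inv_cancel₀ hu'.ne', one_smul]
      have h4 := Lp.coeFn_smul ‖u‖ (fnL N p (‖u‖⁻¹ • u))
      rw [← map_smul, ← h3] at h4
      exact h4
    rw [eLpNorm_congr_ae h2, eLpNorm_const_smul, enorm_norm, mul_comm, ENNReal.ofReal_mul (by positivity),
      ENNReal.ofReal_toReal hLt, ofReal_norm]
    gcongr

theorem exists_embedding (hpN : p < N) {s : ℝ} (hs : p ≤ s) (hs' : s ≤ pStar N p)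
    [Fact (1 ≤ ENNReal.ofReal s)] :
    ∃ J : W1p N p →L[ℝ] Lp ℝ (ENNReal.ofReal s) (volume : Measure (E N)),
      ∀ u, (J u : E N → ℝ) =ᵐ[volume] fn u := by
  obtain ⟨K, hK, h⟩ := exists_lintegral_le (N := N) hpN
  have hm : ∀ u : W1p N p, MemLp (fn u) (ENNReal.ofReal s) volume := fun u =>
    ⟨(stronglyMeasurable_fn u).aestronglyMeasurable, (h s hs hs' u).trans_lt (by simp)⟩
  let J₀ : W1p N p →ₗ[ℝ] Lp ℝ (ENNReal.ofReal s) (volume : Measure (E N)) :=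
    { toFun := fun u => (hm u).toLp
      map_add' := fun u v => by
        rw [← MemLp.toLp_add]
        exact MemLp.toLp_congr _ _ (Lp.coeFn_add (fnL N p u) (fnL N p v))
      map_smul' := fun c u => by
        rw [RingHom.id_apply, ← MemLp.toLp_const_smul]
        exact MemLp.toLp_congr _ _ (Lp.coeFn_smul c (fnL N p u)) }
  refine ⟨J₀.mkContinuous K fun u => ?_, fun u => (hm u).coeFn_toLp⟩
  change ‖(hm u).toLp‖ ≤ _
  rw [Lp.norm_toLp]
  exact ENNReal.toReal_le_of_le_ofReal (by positivity) (h s hs hs' u)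

/-- An Arzelà–Ascoli argument at all scales at once: for fixed `k` the mollifications are bounded
and Lipschitz with the same constant `A k`, so convergence on a dense sequence of points spreads to
every point. -/
theorem exists_subseq_pointwise (u : ℕ → W1p N p) {B : ℝ} (hB : ∀ n, ‖u n‖ ≤ B) :
    ∃ (θ : ℕ → ℕ) (V : ℕ → E N → ℝ) (A : ℕ → ℝ), StrictMono θ ∧
      (∀ k n x, ‖mollify (bumpSeq N k) (fn (u n)) x‖ ≤ A k) ∧
      ∀ k x, Tendsto (fun n => mollify (bumpSeq N k) (fn (u (θ n))) x) atTop (𝓝 (V k x)) := by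
  have hp1 := hp.out
  choose C hC hCb using fun k => exists_mollify_le (N := N) (bumpSeq N k) hp1 (F := ℝ)
  choose C' hC' hCb' using fun k => exists_mollify_le (N := N) (bumpSeq N k) hp1 (F := E N)
  set A : ℕ → ℝ := fun k => (((C k + C' k) * ENNReal.ofReal B ^ p) ^ (1 / p)).toReal with hA
  have hAt : ∀ k, ((C k + C' k) * ENNReal.ofReal B ^ p) ^ (1 / p) ≠ ⊤ := by
    intro k
    have := hC k
    have := hC' k
    have : 0 ≤ p := by linarith
    finiteness
  have conv : ∀ {F : Type} [NormedAddCommGroup F] (k : ℕ) (D : ℝ≥0∞) (f : E N → F) (z : F),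
      D ≤ C k + C' k → eLpNorm f (ENNReal.ofReal p) volume ≤ ENNReal.ofReal B →
      ‖z‖ₑ ^ p ≤ D * ∫⁻ y, ‖f y‖ₑ ^ p → ‖z‖ ≤ A k := by
    intro F _ k D f z hD hf hz
    have h1 : ‖z‖ₑ ≤ ((C k + C' k) * ENNReal.ofReal B ^ p) ^ (1 / p) := by
      rw [one_div, ENNReal.le_rpow_inv_iff (by linarith)]
      refine hz.trans ?_
      rw [lintegral_rpow_eq_eLpNorm (by linarith)]
      gcongr
    rw [← toReal_enorm]
    exact ENNReal.toReal_mono (hAt k) h1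
  have b1 : ∀ k n x, ‖mollify (bumpSeq N k) (fn (u n)) x‖ ≤ A k := fun k n x =>
    conv k (C k) (fn (u n)) _ le_self_add ((eLpNorm_fn_le _).trans (ENNReal.ofReal_le_ofReal (hB n)))
      (hCb k _ (stronglyMeasurable_fn _) x)
  have b2 : ∀ k n x, ‖mollify (bumpSeq N k) (grad (u n)) x‖ ≤ A k := fun k n x =>
    conv k (C' k) (grad (u n)) _ le_add_self
      ((eLpNorm_grad_le _).trans (ENNReal.ofReal_le_ofReal (hB n)))
      (hCb' k _ (stronglyMeasurable_grad _) x)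
  have lip : ∀ k n x y, ‖mollify (bumpSeq N k) (fn (u n)) x - mollify (bumpSeq N k) (fn (u n)) y‖
      ≤ A k * ‖x - y‖ := by
    intro k n x y
    refine Convex.norm_image_sub_le_of_norm_fderiv_le (𝕜 := ℝ) (s := univ) (fun z _ =>
      (contDiff_mollify _ (locallyIntegrable_fn _)).differentiable one_ne_zero z) (fun z _ => ?_)
      convex_univ (mem_univ _) (mem_univ _)
    have := norm_fderiv_mollify (bumpSeq N k) (locallyIntegrable_fn (u n))
      (locallyIntegrable_grad (u n)) (isWeakGradient (u n)) z
    rw [← toReal_enorm, this, toReal_enorm]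
    exact b2 k n z
  -- The diagonal extraction is compactness of a countable product, indexed by scale and dense
  -- point.
  have hcpt : IsCompact (Set.univ.pi fun z : ℕ × ℕ => Icc (-A z.1) (A z.1)) :=
    isCompact_univ_pi fun z => isCompact_Icc
  obtain ⟨a, -, θ, hθ, hlim⟩ := hcpt.tendsto_subseq
    (x := fun n (z : ℕ × ℕ) => mollify (bumpSeq N z.1) (fn (u n)) (TopologicalSpace.denseSeq (E N) z.2))
    (fun n z _ => abs_le.1 (b1 z.1 n _))
  rw [tendsto_pi_nhds] at hlim
  have hcau : ∀ k x, CauchySeq fun n => mollify (bumpSeq N k) (fn (u (θ n))) x := by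
    intro k x
    rw [Metric.cauchySeq_iff']
    intro δ hδ
    have hA0 : 0 ≤ A k := ENNReal.toReal_nonneg
    -- The summand `1` keeps the denominator positive when `A k = 0`; the error `δ/4` is spent at
    -- each of the two indices.
    obtain ⟨j, hj⟩ := (TopologicalSpace.denseRange_denseSeq (E N)).exists_dist_lt x
      (ε := δ / (4 * (A k + 1))) (by positivity)
    obtain ⟨n₀, hn₀⟩ := Metric.cauchySeq_iff'.1 (hlim (k, j)).cauchySeq (δ / 4) (by positivity)
    refine ⟨n₀, fun n hn => ?_⟩
    have h1 := hn₀ n hn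
    have h2 := lip k (θ n) x (TopologicalSpace.denseSeq (E N) j)
    have h3 := lip k (θ n₀) x (TopologicalSpace.denseSeq (E N) j)
    have h4 : A k * ‖x - TopologicalSpace.denseSeq (E N) j‖ ≤ δ / 4 := by
      rw [dist_eq_norm, lt_div_iff₀ (by positivity)] at hj
      nlinarith [norm_nonneg (x - TopologicalSpace.denseSeq (E N) j)]
    simp only [Function.comp_apply, Real.dist_eq] at h1
    rw [Real.norm_eq_abs] at h2 h3
    rw [Real.dist_eq]
    rw [abs_lt] at h1 ⊢
    have h2 := abs_le.1 (h2.trans h4)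
    have h3 := abs_le.1 (h3.trans h4)
    constructor <;> linarith [h1.1, h1.2, h2.1, h2.2, h3.1, h3.2]
  choose V hV using fun k x => cauchySeq_tendsto_of_complete (hcau k x)
  exact ⟨θ, V, A, hθ, b1, hV⟩

/-- Rellich's theorem in Cauchy form. At each scale the mollifications converge pointwise and
boundedly, hence in `L^p` of a ball, and they differ from the functions by at most `B/(k + 1)`
uniformly in `n`. -/
theorem exists_subseq_cauchy_ball (u : ℕ → W1p N p) {B : ℝ} (hB : ∀ n, ‖u n‖ ≤ B) :
    ∃ θ : ℕ → ℕ, StrictMono θ ∧ ∀ R : ℝ, Tendsto (fun m : ℕ × ℕ =>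
      eLpNorm (fun x => fn (u (θ m.1)) x - fn (u (θ m.2)) x) (ENNReal.ofReal p)
        (volume.restrict (Metric.ball 0 R))) (atTop ×ˢ atTop) (𝓝 0) := by
  have hp1 := hp.out
  obtain ⟨θ, V, A, hθ, hA, hV⟩ := exists_subseq_pointwise u hB
  refine ⟨θ, hθ, fun R => ?_⟩
  have hpf : (1 : ℝ≥0∞) ≤ ENNReal.ofReal p := Fact.out
  have hfin : IsFiniteMeasure ((volume : Measure (E N)).restrict (Metric.ball 0 R)) :=
    ⟨by simpa using measure_ball_lt_top⟩
  have hmol : ∀ k n, Continuous (mollify (bumpSeq N k) (fn (u n))) := fun k n =>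
    (contDiff_mollify _ (locallyIntegrable_fn _)).continuous
  have hVm : ∀ k, AEStronglyMeasurable (V k)
      ((volume : Measure (E N)).restrict (Metric.ball 0 R)) := fun k =>
    (stronglyMeasurable_of_tendsto atTop (fun n => (hmol k (θ n)).stronglyMeasurable)
      (tendsto_pi_nhds.2 (hV k))).aestronglyMeasurable
  have hVA : ∀ k x, ‖V k x‖ ≤ A k := fun k x =>
    le_of_tendsto (hV k x).norm (.of_forall fun n => hA k _ x)
  have conv1 : ∀ k, Tendsto (fun n => eLpNorm (fun x => mollify (bumpSeq N k) (fn (u (θ n))) x - V k x)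
      (ENNReal.ofReal p) (volume.restrict (Metric.ball 0 R))) atTop (𝓝 0) := by
    intro k
    have h1 : Tendsto (fun n => ∫⁻ x in Metric.ball 0 R,
        ‖mollify (bumpSeq N k) (fn (u (θ n))) x - V k x‖ₑ ^ p) atTop (𝓝 (∫⁻ x in Metric.ball (0 : E N) R, 0)) := by
      refine tendsto_lintegral_of_dominated_convergence' (fun _ => ENNReal.ofReal (A k + A k) ^ p)
        (fun n => ((hmol k _).aestronglyMeasurable.sub (hVm k)).enorm.pow_const _)
        (fun n => .of_forall fun x => ?_) ?_ (.of_forall fun x => ?_)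
      · dsimp only
        rw [← ofReal_norm]
        gcongr
        exact (norm_sub_le _ _).trans (add_le_add (hA k _ x) (hVA k x))
      · rw [lintegral_const]
        have : 0 ≤ p := by linarith
        finiteness
      · have h2 := ((hV k x).sub_const (V k x)).enorm
        have h3 := (ENNReal.continuous_rpow_const (y := p)).continuousAt.tendsto.comp h2
        simpa [Function.comp_def, ENNReal.zero_rpow_of_pos (by linarith : 0 < p)] using h3
    have h4 := (ENNReal.continuous_rpow_const (y := 1 / p)).continuousAt.tendsto.comp h1
    rw [lintegral_zero, ENNReal.zero_rpow_of_pos (by positivity)] at h4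
    refine h4.congr fun n => ?_
    rw [eLpNorm_ofReal_eq (by linarith)]
    rfl
  have approx : ∀ k n, eLpNorm (fun x => mollify (bumpSeq N k) (fn (u n)) x - fn (u n) x)
      (ENNReal.ofReal p) (volume.restrict (Metric.ball 0 R)) ≤
      ENNReal.ofReal (1 / ((k : ℝ) + 1)) * ENNReal.ofReal B := by
    intro k n
    refine (eLpNorm_mono_measure _ Measure.restrict_le_self).trans ?_
    rw [eLpNorm_ofReal_eq (by linarith), one_div p, ENNReal.rpow_inv_le_iff (by linarith)]
    refine (lintegral_mollify_sub_le hp1 (locallyIntegrable_fn _) (stronglyMeasurable_fn _)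
      (locallyIntegrable_grad _) (stronglyMeasurable_grad _) (isWeakGradient _) _).trans ?_
    rw [lintegral_rpow_eq_eLpNorm (by linarith), ENNReal.mul_rpow_of_nonneg _ _ (by linarith)]
    gcongr
    · exact le_rfl
    · exact (eLpNorm_grad_le _).trans (ENNReal.ofReal_le_ofReal (hB n))
  rw [ENNReal.tendsto_nhds_zero]
  intro η hη
  obtain ⟨k, hk⟩ : ∃ k : ℕ, ENNReal.ofReal (1 / ((k : ℝ) + 1)) * ENNReal.ofReal B ≤ η / 4 := by
    have h1 : Tendsto (fun k : ℕ => ENNReal.ofReal (1 / ((k : ℝ) + 1)) * ENNReal.ofReal B) atTop (𝓝 0) := by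
      have h2 := ENNReal.tendsto_ofReal tendsto_one_div_add_atTop_nhds_zero_nat
      have := ENNReal.Tendsto.mul_const (b := ENNReal.ofReal B) h2 (Or.inr (by simp))
      simpa using this
    exact (ENNReal.tendsto_nhds_zero.1 h1 (η / 4) (ENNReal.div_pos hη.ne' (by simp))).exists
  have hev := ENNReal.tendsto_nhds_zero.1 (conv1 k) (η / 4) (ENNReal.div_pos hη.ne' (by simp))
  filter_upwards [hev.prod_mk hev] with m hm
  have tri : ∀ (f g h : E N → ℝ), AEStronglyMeasurable f (volume.restrict (Metric.ball 0 R)) →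
      AEStronglyMeasurable g (volume.restrict (Metric.ball 0 R)) →
      AEStronglyMeasurable h (volume.restrict (Metric.ball 0 R)) →
      eLpNorm (fun x => f x - h x) (ENNReal.ofReal p) (volume.restrict (Metric.ball 0 R)) ≤
      eLpNorm (fun x => g x - f x) (ENNReal.ofReal p) (volume.restrict (Metric.ball 0 R)) +
      eLpNorm (fun x => g x - h x) (ENNReal.ofReal p) (volume.restrict (Metric.ball 0 R)) := by
    intro f g h hf hg hh
    have h1 : (fun x => f x - h x) = (fun x => g x - h x) - (fun x => g x - f x) := by
      ext x; simp
    rw [h1, add_comm]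
    exact eLpNorm_sub_le (hg.sub hh) (hg.sub hf) hpf
  have hum : ∀ n, AEStronglyMeasurable (fn (u n)) (volume.restrict (Metric.ball 0 R)) := fun n =>
    (stronglyMeasurable_fn _).aestronglyMeasurable
  have half : ∀ n, eLpNorm (fun x => mollify (bumpSeq N k) (fn (u n)) x - V k x)
      (ENNReal.ofReal p) (volume.restrict (Metric.ball 0 R)) ≤ η / 4 →
      eLpNorm (fun x => fn (u n) x - V k x)
      (ENNReal.ofReal p) (volume.restrict (Metric.ball 0 R)) ≤ η / 4 + η / 4 := fun n hn =>
    (tri _ _ _ (hum n) (hmol k n).aestronglyMeasurable (hVm k)).trans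
      (add_le_add ((approx k n).trans hk) hn)
  refine (tri _ (V k) _ (hum _) (hVm k) (hum _)).trans ?_
  have e4 : η / 4 + η / 4 + (η / 4 + η / 4) = η := by
    rw [ENNReal.div_add_div_same, ENNReal.div_add_div_same, ← mul_two, ← mul_two, mul_assoc]
    norm_num
    exact ENNReal.mul_div_cancel_right (by simp) (by simp)
  rw [← e4]
  have sym : ∀ f g : E N → ℝ, eLpNorm (fun x => g x - f x) (ENNReal.ofReal p)
      (volume.restrict (Metric.ball 0 R)) = eLpNorm (fun x => f x - g x) (ENNReal.ofReal p)
      (volume.restrict (Metric.ball 0 R)) := fun f g => eLpNorm_sub_comm g f _ _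
  rw [sym, sym (fn (u (θ m.2)))]
  exact add_le_add (half _ hm.1) (half _ hm.2)

/-- Inside a large ball, interpolation reduces `L^s` to the convergent `L^p` norm plus a small
multiple of the bounded `L^{p*}` norm; outside it the weight is small and the `L^s` norm bounded. -/
theorem exists_subseq_cauchy_weight (hpN : p < N) (u : ℕ → W1p N p) {B : ℝ} (hB : ∀ n, ‖u n‖ ≤ B) :
    ∃ θ : ℕ → ℕ, StrictMono θ ∧ ∀ (s : ℝ) (w : E N → ℝ≥0∞) (W : ℝ≥0∞), p < s → s < pStar N p →
      Measurable w → W ≠ ⊤ → (∀ x, w x ≤ W) →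
      (∀ η, 0 < η → ∃ R : ℝ, ∀ x, R ≤ ‖x‖ → w x ≤ η) →
      Tendsto (fun m : ℕ × ℕ => ∫⁻ x, w x * ‖fn (u (θ m.1)) x - fn (u (θ m.2)) x‖ₑ ^ s)
        (atTop ×ˢ atTop) (𝓝 0) := by
  have hp1 := hp.out
  obtain ⟨K, hK, hKb⟩ := exists_lintegral_le (N := N) (p := p) hpN
  obtain ⟨θ, hθ, hball⟩ := exists_subseq_cauchy_ball u hB
  refine ⟨θ, hθ, fun s w W hs hs' hw hW hwW htail => ?_⟩
  set P := pStar N p with hP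
  have hd : ∀ (n m : ℕ) (t : ℝ), p ≤ t → t ≤ P →
      ∫⁻ x, ‖fn (u n) x - fn (u m) x‖ₑ ^ t ≤ ENNReal.ofReal (K * (B + B)) ^ t := by
    intro n m t ht ht'
    rw [lintegral_rpow_eq_eLpNorm (by linarith)]
    refine ENNReal.rpow_le_rpow ?_ (by linarith)
    rw [← eLpNorm_congr_ae (fn_sub (u n) (u m))]
    refine (hKb t ht ht' _).trans (ENNReal.ofReal_le_ofReal ?_)
    gcongr
    exact (norm_sub_le _ _).trans (add_le_add (hB n) (hB m))
  -- `M` collects what `η` multiplies: the critical term from the ball and the `L^s` term from the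
  -- tail.
  set M : ℝ≥0∞ := W * ENNReal.ofReal (K * (B + B)) ^ P + ENNReal.ofReal (K * (B + B)) ^ s with hM
  have hMt : M ≠ ⊤ := by
    have : 0 ≤ P := by linarith
    have : 0 ≤ s := by linarith
    finiteness
  rw [ENNReal.tendsto_nhds_zero]
  intro δ hδ
  obtain ⟨η, hη, hηM⟩ : ∃ η : ℝ, 0 < η ∧ ENNReal.ofReal η * M ≤ δ / 2 := by
    have h1 : Tendsto (fun η : ℝ => ENNReal.ofReal η * M) (𝓝[>] 0) (𝓝 0) := by
      have h2 := (ENNReal.tendsto_ofReal (tendsto_id (x := 𝓝 (0 : ℝ)))).mono_left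
        (nhdsWithin_le_nhds (s := Ioi 0))
      have := ENNReal.Tendsto.mul_const (b := M) h2 (Or.inr hMt)
      simpa using this
    have h3 := ENNReal.tendsto_nhds_zero.1 h1 (δ / 2) (ENNReal.div_pos hδ.ne' (by simp))
    obtain ⟨η, h4, h5⟩ := (h3.and self_mem_nhdsWithin).exists
    exact ⟨η, h5, h4⟩
  obtain ⟨C, hC⟩ := exists_enorm_rpow_le (by linarith : 0 < p) hs hs' hη
  obtain ⟨R, hR⟩ := htail (ENNReal.ofReal η) (by simpa using hη)
  have hb : Tendsto (fun m : ℕ × ℕ => W * (ENNReal.ofReal C * ∫⁻ x in Metric.ball 0 R,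
      ‖fn (u (θ m.1)) x - fn (u (θ m.2)) x‖ₑ ^ p)) (atTop ×ˢ atTop) (𝓝 0) := by
    have h1 := (ENNReal.continuous_rpow_const (y := p)).continuousAt.tendsto.comp (hball R)
    rw [ENNReal.zero_rpow_of_pos (by linarith)] at h1
    have h2 := ENNReal.Tendsto.const_mul (a := W)
      (ENNReal.Tendsto.const_mul (a := ENNReal.ofReal C) h1 (Or.inr (by simp))) (Or.inr hW)
    simp only [mul_zero] at h2
    refine h2.congr fun m => ?_
    simp only [Function.comp_apply]
    rw [lintegral_rpow_eq_eLpNorm (by linarith)]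
  filter_upwards [ENNReal.tendsto_nhds_zero.1 hb (δ / 2) (ENNReal.div_pos hδ.ne' (by simp))] with m hm
  set d : E N → ℝ := fun x => fn (u (θ m.1)) x - fn (u (θ m.2)) x with hdd
  have hdm : StronglyMeasurable d := (stronglyMeasurable_fn _).sub (stronglyMeasurable_fn _)
  have hdp : ∀ t : ℝ, Measurable fun x => ‖d x‖ₑ ^ t := fun t => hdm.enorm.pow_const t
  calc ∫⁻ x, w x * ‖d x‖ₑ ^ s ≤ ∫⁻ x, (W * (ENNReal.ofReal C *
          (Metric.ball 0 R).indicator (fun x => ‖d x‖ₑ ^ p) x)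
        + (W * (ENNReal.ofReal η * ‖d x‖ₑ ^ P) + ENNReal.ofReal η * ‖d x‖ₑ ^ s)) := by
        refine lintegral_mono fun x => ?_
        by_cases hx : x ∈ Metric.ball 0 R
        · rw [indicator_of_mem hx, ← add_assoc, ← mul_add]
          exact (mul_le_mul' (hwW x) (hC (d x))).trans le_self_add
        · have h1 := hR x (by simpa using hx)
          exact (mul_le_mul' h1 le_rfl).trans (le_add_self.trans le_add_self)
    _ = W * (ENNReal.ofReal C * ∫⁻ x in Metric.ball 0 R, ‖d x‖ₑ ^ p)
        + (W * (ENNReal.ofReal η * ∫⁻ x, ‖d x‖ₑ ^ P)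
          + ENNReal.ofReal η * ∫⁻ x, ‖d x‖ₑ ^ s) := by
        have hi : Measurable ((Metric.ball 0 R).indicator (fun x => ‖d x‖ₑ ^ p)) :=
          (hdp p).indicator measurableSet_ball
        rw [lintegral_add_left ((hi.const_mul _).const_mul _),
          lintegral_add_left (((hdp P).const_mul _).const_mul _),
          lintegral_const_mul _ (hi.const_mul _), lintegral_const_mul _ hi,
          lintegral_indicator measurableSet_ball, lintegral_const_mul _ ((hdp P).const_mul _),
          lintegral_const_mul _ (hdp P), lintegral_const_mul _ (hdp s)]
    _ ≤ δ / 2 + ENNReal.ofReal η * M := by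
        refine add_le_add hm ?_
        rw [hM, mul_add, mul_left_comm]
        gcongr
        · exact hd _ _ P (by linarith) le_rfl
        · exact hd _ _ s hs.le hs'.le
    _ ≤ δ / 2 + δ / 2 := by gcongr
    _ = δ := ENNReal.add_halves δ

end W1p

/-! ### Superposition operators with jointly continuous integrands -/

section Instances

theorem IsNemytskii.of_hasDerivAt {α : Type*} [TopologicalSpace α] [MeasurableSpace α]
    [OpensMeasurableSpace α] [SecondCountableTopology α]
    [TopologicalSpace.PseudoMetrizableSpace α] {ν : Measure α} {s C : ℝ}
    {G f : α → ℝ → ℝ} (hd : ∀ x t, HasDerivAt (G x) (f x t) t)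
    (hG : Continuous (Function.uncurry G)) (hf : Continuous (Function.uncurry f))
    (h0 : ∀ x, G x 0 = 0) (hC : 0 ≤ C) (hb : ∀ x t, |f x t| ≤ C * |t| ^ (s - 1)) :
    IsNemytskii ν s G (fun x t => ContinuousLinearMap.toSpanSingleton ℝ (f x t)) where
  hasFDerivAt x t := (hd x t).hasFDerivAt
  continuous x := by
    have h1 : Continuous fun c : ℝ => ContinuousLinearMap.toSpanSingleton ℝ c :=
      (ContinuousLinearMap.toSpanSingletonLE ℝ ℝ ℝ).toLinearMap.continuous_of_finiteDimensional
    exact h1.comp (hf.comp (Continuous.prodMk_right x))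
  map_zero := h0
  growth := ⟨C, hC, fun x t => by
    simpa [ContinuousLinearMap.norm_toSpanSingleton] using hb x t⟩
  aesm v hv := hG.comp_aestronglyMeasurable₂ (f := fun x => x)
    continuous_id.aestronglyMeasurable hv
  aesm' v hv := by
    have h1 : Continuous fun c : ℝ => ContinuousLinearMap.toSpanSingleton ℝ c :=
      (ContinuousLinearMap.toSpanSingletonLE ℝ ℝ ℝ).toLinearMap.continuous_of_finiteDimensional
    exact h1.comp_aestronglyMeasurable (hf.comp_aestronglyMeasurable₂ (f := fun x => x)
      continuous_id.aestronglyMeasurable hv)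

end Instances

/-! ### The one-variable model of the truncated nonlinearity -/

section Truncation

variable {φ : ℝ → ℝ}

namespace IsTruncationCutoff

theorem nonneg (hφ : IsTruncationCutoff φ) (s : ℝ) : 0 ≤ φ s := by
  wlog hs : 0 ≤ s generalizing s
  · rw [← hφ.even s]; exact this (-s) (by linarith)
  rcases le_total s 1 with h | h
  · rw [hφ.eq_one s (abs_le.2 ⟨by linarith, h⟩)]; norm_num
  rcases le_total s 2 with h2 | h2
  · have := hφ.antitoneOn ⟨h, h2⟩ ⟨by norm_num, le_rfl⟩ h2
    rwa [hφ.eq_zero 2 (by norm_num)] at this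
  · rw [hφ.eq_zero s (by rwa [abs_of_nonneg hs])]

theorem antitoneOn_Ici (hφ : IsTruncationCutoff φ) : AntitoneOn φ (Ici 0) := by
  have h1 : AntitoneOn φ (Icc 0 1) := by
    intro x hx y hy _
    rw [hφ.eq_one x (abs_le.2 ⟨by linarith [hx.1], hx.2⟩),
      hφ.eq_one y (abs_le.2 ⟨by linarith [hy.1], hy.2⟩)]
  have h3 : AntitoneOn φ (Ici 2) := by
    intro x hx y hy _
    rw [hφ.eq_zero x (le_trans hx (le_abs_self x)), hφ.eq_zero y (le_trans hy (le_abs_self y))]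
  have h2 := hφ.antitoneOn.union_right h3 (isGreatest_Icc (by norm_num)) isLeast_Ici
  rw [Icc_union_Ici_eq_Ici (by norm_num)] at h2
  have h4 := h1.union_right h2 (isGreatest_Icc (by norm_num)) isLeast_Ici
  rwa [Icc_union_Ici_eq_Ici (by norm_num)] at h4

theorem le_one (hφ : IsTruncationCutoff φ) (s : ℝ) : φ s ≤ 1 := by
  wlog hs : 0 ≤ s generalizing s
  · rw [← hφ.even s]; exact this (-s) (by linarith)
  have := hφ.antitoneOn_Ici self_mem_Ici hs hs
  rwa [hφ.eq_one 0 (by simp)] at this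

end IsTruncationCutoff

/-- The primitive `s ↦ ∫₀ˢ φ` of a truncation cut-off. -/
def primitive (φ : ℝ → ℝ) (s : ℝ) : ℝ := ∫ τ in (0 : ℝ)..s, φ τ

theorem hasDerivAt_primitive (hφ : IsTruncationCutoff φ) (s : ℝ) :
    HasDerivAt (primitive φ) (φ s) s :=
  (hφ.smooth.continuous.integral_hasStrictDerivAt 0 s).hasDerivAt

theorem contDiff_primitive (hφ : IsTruncationCutoff φ) : ContDiff ℝ 1 (primitive φ) := by
  rw [contDiff_one_iff_deriv]
  refine ⟨fun s => (hasDerivAt_primitive hφ s).differentiableAt, ?_⟩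
  rw [funext fun s => (hasDerivAt_primitive hφ s).deriv]
  exact hφ.smooth.continuous

theorem primitive_neg (hφ : IsTruncationCutoff φ) (s : ℝ) : primitive φ (-s) = -primitive φ s := by
  have h := intervalIntegral.integral_comp_neg (a := 0) (b := s) φ
  simp only [hφ.even, neg_zero] at h
  rw [primitive, primitive, h, intervalIntegral.integral_symm]

theorem primitive_of_le_one (hφ : IsTruncationCutoff φ) {s : ℝ} (hs : |s| ≤ 1) :
    primitive φ s = s := by
  have h : EqOn φ (fun _ => (1 : ℝ)) (uIcc 0 s) := by
    intro t ht
    refine hφ.eq_one t ?_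
    rw [mem_uIcc] at ht
    rw [abs_le] at hs ⊢
    rcases ht with h | h <;> constructor <;> linarith [h.1, h.2, hs.1, hs.2]
  rw [primitive, intervalIntegral.integral_congr h]
  simp

/-- `φ` decreases on `[0, ∞)`, so its mean over `[0, s]` is at least its value at `s`. This gives
the upper bound in `mul_deriv_modelPower`. -/
theorem mul_le_primitive (hφ : IsTruncationCutoff φ) {s : ℝ} (hs : 0 ≤ s) :
    s * φ s ≤ primitive φ s := by
  have h : ∫ _ in (0 : ℝ)..s, φ s ≤ primitive φ s := by
    refine intervalIntegral.integral_mono_on hs (by simp)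
      (hφ.smooth.continuous.intervalIntegrable _ _) fun t ht => ?_
    exact hφ.antitoneOn_Ici ht.1 hs ht.2
  simpa using h

/-- `φ ≤ 1`, and `φ` vanishes beyond `2`. -/
theorem primitive_le_two (hφ : IsTruncationCutoff φ) {s : ℝ} (hs : 0 ≤ s) : primitive φ s ≤ 2 := by
  have hc := hφ.smooth.continuous
  have h1 : ∀ s, 0 ≤ s → primitive φ s ≤ s := by
    intro s hs
    have : primitive φ s ≤ ∫ _ in (0 : ℝ)..s, (1 : ℝ) :=
      intervalIntegral.integral_mono_on hs (hc.intervalIntegrable _ _) (by simp)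
        fun t _ => hφ.le_one t
    simpa using this
  rcases le_total s 2 with h | h
  · exact (h1 s hs).trans h
  · have h2 : primitive φ s = primitive φ 2 + ∫ τ in (2 : ℝ)..s, φ τ :=
      (intervalIntegral.integral_add_adjacent_intervals (hc.intervalIntegrable _ _)
        (hc.intervalIntegrable _ _)).symm
    have h3 : ∫ τ in (2 : ℝ)..s, φ τ = ∫ τ in (2 : ℝ)..s, (0 : ℝ) := by
      refine intervalIntegral.integral_congr fun t ht => ?_
      rw [uIcc_of_le h] at ht
      exact hφ.eq_zero t (ht.1.trans (le_abs_self t))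
    rw [h2, h3]
    simpa using h1 2 (by norm_num)

theorem primitive_pos (hφ : IsTruncationCutoff φ) {s : ℝ} (hs : 0 < s) : 0 < primitive φ s := by
  have hm : Monotone (primitive φ) := monotone_of_deriv_nonneg
    (fun s => (hasDerivAt_primitive hφ s).differentiableAt)
    (fun s => by rw [(hasDerivAt_primitive hφ s).deriv]; exact hφ.nonneg s)
  have h1 : (0 : ℝ) < min s 1 := lt_min hs one_pos
  have h2 : primitive φ (min s 1) = min s 1 :=
    primitive_of_le_one hφ (by rw [abs_of_pos h1]; exact min_le_right _ _)
  exact (h2 ▸ h1).trans_le (hm (min_le_left _ _))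

theorem abs_primitive_le_two (hφ : IsTruncationCutoff φ) (s : ℝ) : |primitive φ s| ≤ 2 := by
  wlog hs : 0 < s generalizing s
  · rcases eq_or_lt_of_le (not_lt.1 hs) with rfl | h
    · simp [primitive]
    · have := this (-s) (by linarith)
      rwa [primitive_neg hφ, abs_neg] at this
  rw [abs_of_pos (primitive_pos hφ hs)]
  exact primitive_le_two hφ hs.le

theorem primitive_ne_zero (hφ : IsTruncationCutoff φ) {s : ℝ} (hs : s ≠ 0) : primitive φ s ≠ 0 := by
  rcases lt_or_gt_of_ne hs with h | h
  · have := primitive_pos hφ (neg_pos.2 h)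
    rw [primitive_neg hφ] at this
    linarith
  · exact (primitive_pos hφ h).ne'

/-- The model nonlinearity `s ↦ |s|^r |∫₀ˢ φ|^κ`. -/
def modelPower (φ : ℝ → ℝ) (r κ s : ℝ) : ℝ := |s| ^ r * |primitive φ s| ^ κ

variable {r κ : ℝ}

theorem contDiff_modelPower (hφ : IsTruncationCutoff φ) (hr : 1 < r) (hκ : 0 < κ) :
    ContDiff ℝ 1 (modelPower φ r κ) := by
  have habs : ∀ {t : ℝ}, 1 < t → ContDiff ℝ 1 fun s : ℝ => |s| ^ t := fun ht =>
    contDiff_norm_rpow (E := ℝ) ht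
  rw [contDiff_iff_contDiffAt]
  intro s
  rcases eq_or_ne s 0 with rfl | hs
  -- For `κ < 1` the factor `|∫₀ˢ φ|^κ` is not differentiable at `0`; but there the primitive is the
  -- identity and the product is `|s|^(r + κ)`.
  · refine ((habs (by linarith : 1 < r + κ)).contDiffAt (x := 0)).congr_of_eventuallyEq ?_
    filter_upwards [Metric.ball_mem_nhds (0 : ℝ) one_pos] with s hs
    rw [mem_ball_zero_iff, Real.norm_eq_abs] at hs
    rw [modelPower, primitive_of_le_one hφ hs.le, Real.rpow_add_of_nonneg (abs_nonneg s)
      (by linarith) hκ.le]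
  · have hne := primitive_ne_zero hφ hs
    exact (habs hr).contDiffAt.mul ((((contDiffAt_abs hne)).comp s
      (contDiff_primitive hφ).contDiffAt).rpow_const_of_ne (by simpa using hne))

theorem modelPower_neg (hφ : IsTruncationCutoff φ) (s : ℝ) :
    modelPower φ r κ (-s) = modelPower φ r κ s := by
  rw [modelPower, modelPower, primitive_neg hφ, abs_neg, abs_neg]

theorem modelPower_zero (hr : 1 < r) : modelPower φ r κ 0 = 0 := by
  rw [modelPower, abs_zero, Real.zero_rpow (by linarith), zero_mul]

theorem modelPower_nonneg (s : ℝ) : 0 ≤ modelPower φ r κ s := by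
  unfold modelPower; positivity

/-- For `s > 0`, with `m` the primitive, `s G'(s) = r G(s) + κ s^r (s φ(s)) m(s)^(κ - 1)` and `0 ≤ s
φ(s) ≤ m(s)`. The lower bound is the Ambrosetti–Rabinowitz condition, the upper one yields the
growth of the derivative. -/
theorem mul_deriv_modelPower (hφ : IsTruncationCutoff φ) (hr : 1 < r) (hκ : 0 < κ) (s : ℝ) :
    r * modelPower φ r κ s ≤ s * deriv (modelPower φ r κ) s ∧
      s * deriv (modelPower φ r κ) s ≤ (r + κ) * modelPower φ r κ s := by
  wlog hs : 0 < s generalizing s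
  · rcases eq_or_lt_of_le (not_lt.1 hs) with rfl | h
    · simp [modelPower_zero hr]
    · have h1 := this (-s) (by linarith)
      have h2 : deriv (modelPower φ r κ) (-s) = -deriv (modelPower φ r κ) s := by
        have h3 := deriv_comp_neg (modelPower φ r κ) s
        simp only [modelPower_neg hφ] at h3
        linarith
      rw [modelPower_neg hφ, h2, neg_mul_neg] at h1
      exact h1
  have hm := primitive_pos hφ hs
  have hd : HasDerivAt (fun s => s ^ r * primitive φ s ^ κ)
      (r * s ^ (r - 1) * primitive φ s ^ κ + s ^ r * (φ s * κ * primitive φ s ^ (κ - 1))) s := by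
    refine HasDerivAt.mul ?_ ?_
    · exact Real.hasDerivAt_rpow_const (Or.inl hs.ne')
    · exact (hasDerivAt_primitive hφ s).rpow_const (Or.inl hm.ne')
  have heq : modelPower φ r κ =ᶠ[𝓝 s] fun s => s ^ r * primitive φ s ^ κ := by
    filter_upwards [lt_mem_nhds hs] with t ht
    rw [modelPower, abs_of_pos ht, abs_of_pos (primitive_pos hφ ht)]
  rw [heq.deriv_eq, hd.deriv, heq.eq_of_nhds]
  have e1 : s * s ^ (r - 1) = s ^ r := by
    rw [mul_comm, ← Real.rpow_add_one hs.ne']; simp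
  have e2 : primitive φ s * primitive φ s ^ (κ - 1) = primitive φ s ^ κ := by
    rw [mul_comm, ← Real.rpow_add_one hm.ne']; simp
  have e3 : s * (r * s ^ (r - 1) * primitive φ s ^ κ
      + s ^ r * (φ s * κ * primitive φ s ^ (κ - 1))) =
      r * (s ^ r * primitive φ s ^ κ) + κ * s ^ r * (s * φ s) * primitive φ s ^ (κ - 1) := by
    rw [← e1]; ring
  rw [e3]
  have hA : 0 ≤ κ * s ^ r := by positivity
  have hB : 0 ≤ primitive φ s ^ (κ - 1) := by positivity
  constructor
  · have : 0 ≤ κ * s ^ r * (s * φ s) * primitive φ s ^ (κ - 1) :=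
      mul_nonneg (mul_nonneg hA (mul_nonneg hs.le (hφ.nonneg s))) hB
    linarith
  · have : κ * s ^ r * (s * φ s) * primitive φ s ^ (κ - 1)
        ≤ κ * s ^ r * primitive φ s * primitive φ s ^ (κ - 1) := by
      gcongr
      exact mul_le_primitive hφ hs.le
    rw [mul_assoc _ (primitive φ s), e2] at this
    linarith

/-- Because the primitive is bounded by `2`, the growth exponent drops from `r + κ - 1` to `r - 1`:
this is how truncation makes the problem subcritical. -/
theorem abs_deriv_modelPower_le (hφ : IsTruncationCutoff φ) (hr : 1 < r) (hκ : 0 < κ) (s : ℝ) :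
    |deriv (modelPower φ r κ) s| ≤ (r + κ) * 2 ^ κ * |s| ^ (r - 1) := by
  rcases eq_or_ne s 0 with rfl | hs
  · have h2 : deriv (modelPower φ r κ) (-0) = -deriv (modelPower φ r κ) 0 := by
      have h3 := deriv_comp_neg (modelPower φ r κ) 0
      simp only [modelPower_neg hφ] at h3
      linarith
    have h4 : deriv (modelPower φ r κ) 0 = 0 := by rw [neg_zero] at h2; linarith
    rw [h4, abs_zero]; positivity
  · obtain ⟨h1, h2⟩ := mul_deriv_modelPower hφ hr hκ s
    have h0 : 0 ≤ modelPower φ r κ s := modelPower_nonneg s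
    have h3 : |s| * |deriv (modelPower φ r κ) s| ≤ |s| * ((r + κ) * 2 ^ κ * |s| ^ (r - 1)) := by
      rw [← abs_mul, abs_of_nonneg (le_trans (by positivity) h1)]
      refine h2.trans ?_
      have e1 : |s| * |s| ^ (r - 1) = |s| ^ r := by
        rw [mul_comm, ← Real.rpow_add_one (by simpa using hs)]; simp
      have h5 : modelPower φ r κ s ≤ |s| ^ r * 2 ^ κ := by
        unfold modelPower
        gcongr
        exact abs_primitive_le_two hφ s
      calc (r + κ) * modelPower φ r κ s ≤ (r + κ) * (|s| ^ r * 2 ^ κ) := by gcongr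
        _ = _ := by rw [← e1]; ring
    exact le_of_mul_le_mul_left h3 (by simpa using hs)

/-! ### The truncated nonlinearity and its decaying weight -/

section FTrunc

variable {N : ℕ}

/-- The scale `λ(x) = ε e^{dist(εx, M)}` of the truncation. -/
def scale (M : Set (E N)) (ε : ℝ) (x : E N) : ℝ := ε * Real.exp (Metric.infDist (ε • x) M)

variable {M : Set (E N)} {ε : ℝ}

theorem continuous_scale : Continuous (scale M ε) := by
  unfold scale
  have := Metric.continuous_infDist_pt M
  fun_prop

theorem le_scale (hε : 0 < ε) (x : E N) : ε ≤ scale M ε x :=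
  le_mul_of_one_le_right hε.le (Real.one_le_exp Metric.infDist_nonneg)

theorem scale_pos (hε : 0 < ε) (x : E N) : 0 < scale M ε x := hε.trans_le (le_scale hε x)

/-- If `M` lies in the ball of radius `R`, then `dist(εx, M) ≥ ε‖x‖ - R`. -/
theorem tendsto_scale (hε : 0 < ε) (hM : M.Nonempty) (hMb : Bornology.IsBounded M) :
    Tendsto (scale M ε) (cocompact (E N)) atTop := by
  obtain ⟨R, hR⟩ := hMb.subset_closedBall 0
  refine Tendsto.const_mul_atTop hε (Real.tendsto_exp_atTop.comp ?_)
  have h1 : Tendsto (fun x : E N => ε * ‖x‖ - R) (cocompact (E N)) atTop :=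
    tendsto_atTop_add_const_right _ _ ((tendsto_norm_cocompact_atTop (E := E N)).const_mul_atTop hε)
  refine tendsto_atTop_mono (fun x => ?_) h1
  refine (Metric.le_infDist hM).2 fun y hy => ?_
  have h2 : ‖y‖ ≤ R := by simpa using hR hy
  have h3 : ‖ε • x‖ - ‖y‖ ≤ dist (ε • x) y := by
    rw [dist_eq_norm]; exact norm_sub_norm_le _ _
  rw [norm_smul, Real.norm_of_nonneg hε.le] at h3
  linarith

theorem mTrunc_eq (hε : 0 < ε) (x : E N) (t : ℝ) :
    mTrunc φ M ε x t = (scale M ε x)⁻¹ * primitive φ (scale M ε x * t) := by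
  have h := intervalIntegral.integral_comp_mul_left (a := 0) (b := t) φ (scale_pos (M := M) hε x).ne'
  simpa [mTrunc, primitive, bTrunc, scale] using h

/-- Substituting `λτ` in the integral gives `m_ε(x, t) = λ⁻¹ ∫₀^{λt} φ`, so the dependence on `x` is
a scaling of a single function of one variable. -/
theorem rpow_mul_mTrunc_rpow (hε : 0 < ε) (x : E N) (t : ℝ) :
    |t| ^ r * |mTrunc φ M ε x t| ^ κ
      = scale M ε x ^ (-(r + κ)) * modelPower φ r κ (scale M ε x * t) := by
  have hl := scale_pos (M := M) hε x
  rw [mTrunc_eq hε, modelPower, abs_mul, abs_mul, abs_inv, abs_of_pos hl,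
    Real.mul_rpow hl.le (abs_nonneg _), Real.mul_rpow (by positivity) (abs_nonneg _),
    Real.inv_rpow hl.le, neg_add, Real.rpow_add hl, Real.rpow_neg hl.le, Real.rpow_neg hl.le]
  have : scale M ε x ^ r ≠ 0 := by positivity
  field_simp

/-- The partial derivative in `t` of `|t|^r |m_ε(x, t)|^κ`. -/
def powerDeriv (φ : ℝ → ℝ) (M : Set (E N)) (ε r κ : ℝ) (x : E N) (t : ℝ) : ℝ :=
  scale M ε x ^ (1 - (r + κ)) * deriv (modelPower φ r κ) (scale M ε x * t)

theorem hasDerivAt_power (hφ : IsTruncationCutoff φ) (hε : 0 < ε) (hr : 1 < r) (hκ : 0 < κ)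
    (x : E N) (t : ℝ) : HasDerivAt (fun t => |t| ^ r * |mTrunc φ M ε x t| ^ κ)
      (powerDeriv φ M ε r κ x t) t := by
  have hl := scale_pos (M := M) hε x
  simp_rw [rpow_mul_mTrunc_rpow hε]
  have h1 : HasDerivAt (modelPower φ r κ) (deriv (modelPower φ r κ) (scale M ε x * t))
      (scale M ε x * t) :=
    ((contDiff_modelPower hφ hr hκ).differentiable one_ne_zero _).hasDerivAt
  have h2 : HasDerivAt (fun t => scale M ε x * t) (scale M ε x) t := by
    simpa using (hasDerivAt_id t).const_mul (scale M ε x)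
  have h3 := (h1.comp t h2).const_mul (scale M ε x ^ (-(r + κ)))
  have e : powerDeriv φ M ε r κ x t = scale M ε x ^ (-(r + κ)) *
      (deriv (modelPower φ r κ) (scale M ε x * t) * scale M ε x) := by
    rw [powerDeriv, sub_eq_neg_add, Real.rpow_add_one hl.ne']
    ring
  rw [e]
  exact h3

theorem continuous_power (hφ : IsTruncationCutoff φ) (hε : 0 < ε) (hr : 1 < r) (hκ : 0 < κ) :
    Continuous (Function.uncurry fun (x : E N) t => |t| ^ r * |mTrunc φ M ε x t| ^ κ) := by
  simp_rw [rpow_mul_mTrunc_rpow hε]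
  have h1 := (contDiff_modelPower hφ hr hκ).continuous
  have h2 := continuous_scale (M := M) (ε := ε)
  have h3 : Continuous fun x => scale M ε x ^ (-(r + κ)) :=
    h2.rpow_const fun x => Or.inl (scale_pos hε x).ne'
  exact (h3.comp continuous_fst).mul
    (h1.comp ((h2.comp continuous_fst).mul continuous_snd))

theorem continuous_powerDeriv (hφ : IsTruncationCutoff φ) (hε : 0 < ε) (hr : 1 < r) (hκ : 0 < κ) :
    Continuous (Function.uncurry fun (x : E N) t => powerDeriv φ M ε r κ x t) := by
  unfold powerDeriv
  have h1 := (contDiff_modelPower hφ hr hκ).continuous_deriv le_rfl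
  have h2 := continuous_scale (M := M) (ε := ε)
  have h3 : Continuous fun x => scale M ε x ^ (1 - (r + κ)) :=
    h2.rpow_const fun x => Or.inl (scale_pos hε x).ne'
  exact (h3.comp continuous_fst).mul
    (h1.comp ((h2.comp continuous_fst).mul continuous_snd))

/-- The powers of the scale combine as `(1 - (r + κ)) + (r - 1) = -κ`; the negative exponent is the
source of decay at infinity. -/
theorem abs_powerDeriv_le (hφ : IsTruncationCutoff φ) (hε : 0 < ε) (hr : 1 < r) (hκ : 0 < κ)
    (x : E N) (t : ℝ) :
    |powerDeriv φ M ε r κ x t| ≤ (r + κ) * 2 ^ κ * scale M ε x ^ (-κ) * |t| ^ (r - 1) := by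
  have hl := scale_pos (M := M) hε x
  have h1 := abs_deriv_modelPower_le hφ hr hκ (scale M ε x * t)
  rw [abs_mul, abs_of_pos hl, Real.mul_rpow hl.le (abs_nonneg _)] at h1
  rw [powerDeriv, abs_mul, abs_of_pos (by positivity)]
  have e : scale M ε x ^ (-κ) = scale M ε x ^ (1 - (r + κ)) * scale M ε x ^ (r - 1) := by
    rw [← Real.rpow_add hl]; congr 1; ring
  calc _ ≤ scale M ε x ^ (1 - (r + κ))
        * ((r + κ) * 2 ^ κ * (scale M ε x ^ (r - 1) * |t| ^ (r - 1))) := by gcongr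
    _ = _ := by rw [e]; ring

theorem mul_power_le (hφ : IsTruncationCutoff φ) (hε : 0 < ε) (hr : 1 < r) (hκ : 0 < κ)
    (x : E N) (t : ℝ) :
    r * (|t| ^ r * |mTrunc φ M ε x t| ^ κ) ≤ t * powerDeriv φ M ε r κ x t := by
  have hl := scale_pos (M := M) hε x
  have h1 := (mul_deriv_modelPower hφ hr hκ (scale M ε x * t)).1
  rw [rpow_mul_mTrunc_rpow hε, powerDeriv, sub_eq_neg_add, Real.rpow_add_one hl.ne']
  have h2 : 0 ≤ scale M ε x ^ (-(r + κ)) := by positivity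
  nlinarith [mul_le_mul_of_nonneg_left h1 h2]

variable {p q μ : ℝ}

/-- The partial derivative `f_ε = ∂ₜ F_ε`. -/
def fTrunc (p q r μ : ℝ) (φ : ℝ → ℝ) (M : Set (E N)) (ε : ℝ) (x : E N) (t : ℝ) : ℝ :=
  1 / pStar N p * powerDeriv φ M ε r (pStar N p - r) x t + μ / q * powerDeriv φ M ε r (q - r) x t

/-- The weight in the growth condition of `f_ε`. -/
def fWeight (p q r μ : ℝ) (M : Set (E N)) (ε : ℝ) (x : E N) : ℝ :=
  1 / pStar N p * (pStar N p * 2 ^ (pStar N p - r) * scale M ε x ^ (-(pStar N p - r)))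
    + μ / q * (q * 2 ^ (q - r) * scale M ε x ^ (-(q - r)))

theorem hasDerivAt_FTrunc (hφ : IsTruncationCutoff φ) (hε : 0 < ε) (hr : 1 < r) (hrq : r < q)
    (hrp : r < pStar N p) (x : E N) (t : ℝ) :
    HasDerivAt (FTrunc p q r μ φ M ε x) (fTrunc p q r μ φ M ε x t) t := by
  have h1 := hasDerivAt_power (M := M) hφ hε hr (sub_pos.2 hrp) x t
  have h2 := hasDerivAt_power (M := M) hφ hε hr (sub_pos.2 hrq) x t
  have h3 := (h1.const_mul (1 / pStar N p)).add (h2.const_mul (μ / q))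
  refine h3.congr_of_eventuallyEq (.of_forall fun s => ?_)
  simp only [FTrunc, Pi.add_apply, mul_assoc]

theorem continuous_FTrunc (hφ : IsTruncationCutoff φ) (hε : 0 < ε) (hr : 1 < r) (hrq : r < q)
    (hrp : r < pStar N p) : Continuous (Function.uncurry (FTrunc p q r μ φ M ε)) := by
  have h1 := continuous_power (M := M) hφ hε hr (sub_pos.2 hrp)
  have h2 := continuous_power (M := M) hφ hε hr (sub_pos.2 hrq)
  refine ((h1.const_mul (1 / pStar N p)).add (h2.const_mul (μ / q))).congr fun z => ?_
  simp only [FTrunc, Function.uncurry_def, mul_assoc, Pi.add_apply]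

theorem continuous_fTrunc (hφ : IsTruncationCutoff φ) (hε : 0 < ε) (hr : 1 < r) (hrq : r < q)
    (hrp : r < pStar N p) : Continuous (Function.uncurry (fTrunc p q r μ φ M ε)) := by
  have h1 := continuous_powerDeriv (M := M) hφ hε hr (sub_pos.2 hrp)
  have h2 := continuous_powerDeriv (M := M) hφ hε hr (sub_pos.2 hrq)
  exact (h1.const_mul (1 / pStar N p)).add (h2.const_mul (μ / q))

theorem FTrunc_zero (hr : 1 < r) (x : E N) : FTrunc p q r μ φ M ε x 0 = 0 := by
  simp [FTrunc, Real.zero_rpow (by linarith : r ≠ 0)]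

theorem fWeight_nonneg (hε : 0 < ε) (hμ : 0 < μ) (hr : 1 < r) (hrq : r < q)
    (hrp : r < pStar N p) (x : E N) : 0 ≤ fWeight p q r μ M ε x := by
  have hl := scale_pos (M := M) hε x
  have : 0 < q := by linarith
  have : 0 < pStar N p := by linarith
  unfold fWeight; positivity

theorem continuous_fWeight (hε : 0 < ε) : Continuous (fWeight p q r μ M ε) := by
  have h : ∀ κ : ℝ, Continuous fun x => scale M ε x ^ (-κ) := fun κ =>
    continuous_scale.rpow_const fun x => Or.inl (scale_pos hε x).ne'
  have h1 := h (pStar N p - r)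
  have h2 := h (q - r)
  unfold fWeight
  fun_prop

theorem tendsto_fWeight (hε : 0 < ε) (hrq : r < q) (hrp : r < pStar N p) (hM : M.Nonempty)
    (hMb : Bornology.IsBounded M) : Tendsto (fWeight p q r μ M ε) (cocompact (E N)) (𝓝 0) := by
  have h : ∀ κ : ℝ, 0 < κ → Tendsto (fun x => scale M ε x ^ (-κ)) (cocompact (E N)) (𝓝 0) :=
    fun κ hκ => (tendsto_rpow_neg_atTop hκ).comp (tendsto_scale hε hM hMb)
  have h1 := ((h _ (sub_pos.2 hrp)).const_mul (pStar N p * 2 ^ (pStar N p - r))).const_mul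
    (1 / pStar N p)
  have h2 := ((h _ (sub_pos.2 hrq)).const_mul (q * 2 ^ (q - r))).const_mul (μ / q)
  have h3 := h1.add h2
  simp only [mul_zero, add_zero] at h3
  exact h3

theorem fWeight_le (hε : 0 < ε) (hμ : 0 < μ) (hr : 1 < r) (hrq : r < q)
    (hrp : r < pStar N p) (x : E N) : fWeight p q r μ M ε x ≤
      1 / pStar N p * (pStar N p * 2 ^ (pStar N p - r) * ε ^ (-(pStar N p - r)))
      + μ / q * (q * 2 ^ (q - r) * ε ^ (-(q - r))) := by
  have h : ∀ κ : ℝ, 0 < κ → scale M ε x ^ (-κ) ≤ ε ^ (-κ) := fun κ hκ =>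
    Real.rpow_le_rpow_of_nonpos hε (le_scale hε x) (by linarith)
  have h1 := h _ (sub_pos.2 hrp)
  have h2 := h _ (sub_pos.2 hrq)
  have : 0 < q := by linarith
  have : 0 < pStar N p := by linarith
  unfold fWeight
  gcongr

theorem abs_fTrunc_le (hφ : IsTruncationCutoff φ) (hε : 0 < ε) (hμ : 0 < μ) (hr : 1 < r)
    (hrq : r < q) (hrp : r < pStar N p) (x : E N) (t : ℝ) :
    |fTrunc p q r μ φ M ε x t| ≤ fWeight p q r μ M ε x * |t| ^ (r - 1) := by
  have h1 := abs_powerDeriv_le (M := M) hφ hε hr (sub_pos.2 hrp) x t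
  have h2 := abs_powerDeriv_le (M := M) hφ hε hr (sub_pos.2 hrq) x t
  rw [add_sub_cancel] at h1 h2
  have hq : 0 < q := by linarith
  have hP : 0 < pStar N p := by linarith
  calc _ ≤ 1 / pStar N p * |powerDeriv φ M ε r (pStar N p - r) x t|
        + μ / q * |powerDeriv φ M ε r (q - r) x t| := by
        refine (abs_add_le _ _).trans_eq ?_
        rw [abs_mul, abs_mul, abs_of_pos (by positivity : 0 < 1 / pStar N p),
          abs_of_pos (by positivity : 0 < μ / q)]
    _ ≤ _ := add_le_add (mul_le_mul_of_nonneg_left h1 (by positivity))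
        (mul_le_mul_of_nonneg_left h2 (by positivity))
    _ = _ := by rw [fWeight]; ring

/-- The Ambrosetti–Rabinowitz inequality, with the same exponent `r` for both powers. -/
theorem mul_FTrunc_le (hφ : IsTruncationCutoff φ) (hε : 0 < ε) (hμ : 0 < μ) (hr : 1 < r)
    (hrq : r < q) (hrp : r < pStar N p) (x : E N) (t : ℝ) :
    r * FTrunc p q r μ φ M ε x t ≤ t * fTrunc p q r μ φ M ε x t := by
  have h1 := mul_power_le (M := M) hφ hε hr (sub_pos.2 hrp) x t
  have h2 := mul_power_le (M := M) hφ hε hr (sub_pos.2 hrq) x t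
  have hq : 0 < q := by linarith
  have hP : 0 < pStar N p := by linarith
  have h3 := mul_le_mul_of_nonneg_left h1 (by positivity : 0 ≤ 1 / pStar N p)
  have h4 := mul_le_mul_of_nonneg_left h2 (by positivity : 0 ≤ μ / q)
  rw [FTrunc, fTrunc]
  linarith

end FTrunc

end Truncation

/-! ### Strict monotonicity of the derivative of `‖·‖ ^ p` -/

section NormPower

variable {H : Type*} [NormedAddCommGroup H] [InnerProductSpace ℝ H] {p : ℝ}

/-- The derivative of `‖·‖ ^ p`. -/
def normPowDeriv (p : ℝ) (a : H) : H →L[ℝ] ℝ := (p * ‖a‖ ^ (p - 2)) • innerSL ℝ a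

theorem hasFDerivAt_norm_pow (hp : 1 < p) (a : H) :
    HasFDerivAt (fun a : H => ‖a‖ ^ p) (normPowDeriv p a) a :=
  hasFDerivAt_norm_rpow a hp

theorem continuous_normPowDeriv (hp : 1 < p) : Continuous (normPowDeriv p : H → H →L[ℝ] ℝ) := by
  have h := (contDiff_norm_rpow (E := H) hp).continuous_fderiv one_ne_zero
  exact h.congr fun a => (hasFDerivAt_norm_pow hp a).fderiv

theorem normPowDeriv_apply (a b : H) : normPowDeriv p a b = p * ‖a‖ ^ (p - 2) * inner ℝ a b := by
  simp [normPowDeriv]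

/-- At `a = 0` the conventional value of `‖a‖ ^ (p - 2)` is harmless, being multiplied by `0`. -/
theorem norm_sq_mul_rpow {H : Type*} [NormedAddCommGroup H] (hp : 1 < p) (a : H) :
    ‖a‖ ^ (p - 2) * (‖a‖ * ‖a‖) = ‖a‖ ^ p := by
  rcases eq_or_ne a 0 with rfl | ha
  · simp [Real.zero_rpow (by linarith : p ≠ 0)]
  · have h : ‖a‖ ≠ 0 := by simpa using ha
    rw [← mul_assoc, ← Real.rpow_add_one h, ← Real.rpow_add_one h]
    congr 1; ring

theorem norm_mul_rpow {H : Type*} [NormedAddCommGroup H] (hp : 1 < p) (a : H) :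
    ‖a‖ ^ (p - 2) * ‖a‖ = ‖a‖ ^ (p - 1) := by
  rcases eq_or_ne a 0 with rfl | ha
  · simp [Real.zero_rpow (by linarith : p - 1 ≠ 0)]
  · have h : ‖a‖ ≠ 0 := by simpa using ha
    rw [← Real.rpow_add_one h]
    congr 1; ring

theorem normPowDeriv_self (hp : 1 < p) (a : H) : normPowDeriv p a a = p * ‖a‖ ^ p := by
  rw [normPowDeriv_apply, real_inner_self_eq_norm_mul_norm, mul_assoc, norm_sq_mul_rpow hp]

theorem norm_normPowDeriv_le (hp : 1 < p) (a : H) : ‖normPowDeriv p a‖ ≤ p * ‖a‖ ^ (p - 1) := by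
  rw [normPowDeriv, norm_smul, innerSL_apply_norm, Real.norm_of_nonneg (by positivity), mul_assoc,
    norm_mul_rpow hp]

/-- Young's inequality for the derivative of `‖·‖ ^ p`. -/
theorem normPowDeriv_le (hp : 1 < p) (a b : H) :
    normPowDeriv p a b ≤ (p - 1) * ‖a‖ ^ p + ‖b‖ ^ p := by
  have hpq := (Real.HolderConjugate.conjExponent hp)
  have h1 : normPowDeriv p a b ≤ p * (‖a‖ ^ (p - 1) * ‖b‖) := by
    rw [← mul_assoc]
    exact (le_abs_self _).trans (((normPowDeriv p a).le_opNorm b).trans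
      (mul_le_mul_of_nonneg_right (norm_normPowDeriv_le hp a) (norm_nonneg b)))
  have h2 := Real.young_inequality_of_nonneg (a := ‖a‖ ^ (p - 1)) (b := ‖b‖) (by positivity)
    (by positivity) hpq.symm
  rw [← Real.rpow_mul (norm_nonneg a), hpq.sub_one_mul_conj] at h2
  have h3 : p * (‖a‖ ^ p / p.conjExponent + ‖b‖ ^ p / p) = (p - 1) * ‖a‖ ^ p + ‖b‖ ^ p := by
    rw [Real.conjExponent]
    have : p ≠ 0 := by linarith
    have : p - 1 ≠ 0 := by linarith
    field_simp
  have := mul_le_mul_of_nonneg_left h2 (by linarith : 0 ≤ p)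
  linarith

/-- Separates a radial part, nonnegative since `t ↦ t^(p - 1)` increases, from an angular part,
nonnegative by Cauchy–Schwarz. -/
theorem normPowDeriv_sub_eq (hp : 1 < p) {a b : H} :
    (normPowDeriv p a - normPowDeriv p b) (a - b) =
      p * ((‖a‖ ^ (p - 1) - ‖b‖ ^ (p - 1)) * (‖a‖ - ‖b‖)
        + (‖a‖ ^ (p - 2) + ‖b‖ ^ (p - 2)) * (‖a‖ * ‖b‖ - inner ℝ a b)) := by
  simp only [sub_apply, map_sub, normPowDeriv_self hp, normPowDeriv_apply,
    real_inner_comm a b]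
  have h1 := norm_mul_rpow hp a
  have h2 := norm_mul_rpow hp b
  have h3 := norm_sq_mul_rpow hp a
  have h4 := norm_sq_mul_rpow hp b
  rw [← h1, ← h2, ← h3, ← h4]
  ring

theorem normPowDeriv_sub_nonneg (hp : 1 < p) (a b : H) :
    0 ≤ (normPowDeriv p a - normPowDeriv p b) (a - b) := by
  rw [normPowDeriv_sub_eq hp]
  have h1 : 0 ≤ (‖a‖ ^ (p - 1) - ‖b‖ ^ (p - 1)) * (‖a‖ - ‖b‖) := by
    rcases le_total ‖a‖ ‖b‖ with h | h
    · have := Real.rpow_le_rpow (norm_nonneg a) h (by linarith : 0 ≤ p - 1)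
      exact mul_nonneg_of_nonpos_of_nonpos (by linarith) (by linarith)
    · have := Real.rpow_le_rpow (norm_nonneg b) h (by linarith : 0 ≤ p - 1)
      exact mul_nonneg (by linarith) (by linarith)
  have h2 := real_inner_le_norm a b
  have : 0 ≤ p := by linarith
  have : 0 ≤ ‖a‖ * ‖b‖ - inner ℝ a b := by linarith
  positivity

/-- If the norms differ, the radial part is positive; if they agree, equality in Cauchy–Schwarz
would force `a = b`. -/
theorem normPowDeriv_sub_pos (hp : 1 < p) {a b : H} (hab : a ≠ b) :
    0 < (normPowDeriv p a - normPowDeriv p b) (a - b) := by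
  have hp0 : 0 < p := by linarith
  have hne : ∀ c : H, c ≠ 0 → 0 < normPowDeriv p c c := fun c hc => by
    rw [normPowDeriv_self hp]
    have : 0 < ‖c‖ := by simpa using hc
    positivity
  have h0 : normPowDeriv p (0 : H) = 0 := by simp [normPowDeriv]
  rcases eq_or_ne a 0 with rfl | ha
  · simpa [h0] using hne b hab.symm
  rcases eq_or_ne b 0 with rfl | hb
  · simpa [h0] using hne a ha
  rw [normPowDeriv_sub_eq hp]
  have hA : 0 < ‖a‖ := by simpa using ha
  have hB : 0 < ‖b‖ := by simpa using hb
  have h2 := real_inner_le_norm a b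
  rcases lt_trichotomy ‖a‖ ‖b‖ with h | h | h
  · have h3 := Real.rpow_lt_rpow (norm_nonneg a) h (by linarith : 0 < p - 1)
    have h4 := mul_pos_of_neg_of_neg (sub_neg.2 h3) (sub_neg.2 h)
    exact mul_pos hp0 (add_pos_of_pos_of_nonneg h4 (mul_nonneg (by positivity) (by linarith)))
  · have h3 : inner ℝ a b ≠ ‖a‖ * ‖b‖ := by
      intro h4
      rw [inner_eq_norm_mul_iff_real, h] at h4
      exact hab (smul_right_injective H hB.ne' h4).symm.symm
    have : 0 < ‖a‖ * ‖b‖ - inner ℝ a b := by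
      have := lt_of_le_of_ne h2 h3
      linarith
    rw [h] at this
    rw [h, sub_self, zero_mul, zero_add]
    exact mul_pos hp0 (mul_pos (by positivity) this)
  · have h3 := Real.rpow_lt_rpow (norm_nonneg b) h (by linarith : 0 < p - 1)
    have h4 := mul_pos (sub_pos.2 h3) (sub_pos.2 h)
    exact mul_pos hp0 (add_pos_of_pos_of_nonneg h4 (mul_nonneg (by positivity) (by linarith)))

theorem normPowDeriv_smul {t : ℝ} (ht : 0 < t) (a : H) :
    normPowDeriv p (t • a) = t ^ (p - 1) • normPowDeriv p a := by
  rw [normPowDeriv, normPowDeriv, norm_smul, Real.norm_of_nonneg ht.le,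
    Real.mul_rpow ht.le (norm_nonneg a), map_smul, smul_smul, smul_smul]
  congr 1
  have : t ^ (p - 1) = t ^ (p - 2) * t := by rw [← Real.rpow_add_one ht.ne']; congr 1; ring
  rw [this]; ring

/-- Compactness and homogeneity replace the usual separate inequalities for `p < 2` and `p ≥ 2`. On
normalized pairs with `‖a - b‖^p ≥ η` the monotonicity expression has a positive minimum; for the
other normalized pairs the `η` term alone suffices. -/
theorem exists_norm_sub_rpow_le [FiniteDimensional ℝ H] (hp : 1 < p) {η : ℝ} (hη : 0 < η) :
    ∃ C : ℝ, 0 ≤ C ∧ ∀ a b : H, ‖a - b‖ ^ p ≤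
      C * (normPowDeriv p a - normPowDeriv p b) (a - b) + η * (‖a‖ ^ p + ‖b‖ ^ p) := by
  have hp0 : 0 < p := by linarith
  have hcont : Continuous fun z : H × H =>
      (normPowDeriv p z.1 - normPowDeriv p z.2) (z.1 - z.2) := by
    have h := continuous_normPowDeriv (H := H) hp
    exact ((h.comp continuous_fst).sub (h.comp continuous_snd)).clm_apply
      (continuous_fst.sub continuous_snd)
  have hnc : Continuous fun a : H => ‖a‖ ^ p := continuous_norm.rpow_const fun _ => Or.inr hp0.le
  set S : Set (H × H) := {z | ‖z.1‖ ^ p + ‖z.2‖ ^ p = 1 ∧ η ≤ ‖z.1 - z.2‖ ^ p} with hS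
  have hn1 : ∀ a b : H, ‖a‖ ^ p + ‖b‖ ^ p = 1 → ‖a‖ ≤ 1 ∧ ‖b‖ ≤ 1 := by
    intro a b hab
    have ha : 0 ≤ ‖a‖ ^ p := by positivity
    have hb : 0 ≤ ‖b‖ ^ p := by positivity
    constructor
    · by_contra h
      have := Real.one_lt_rpow (not_le.1 h) hp0
      linarith
    · by_contra h
      have := Real.one_lt_rpow (not_le.1 h) hp0
      linarith
  have hScpt : IsCompact S := by
    refine Metric.isCompact_of_isClosed_isBounded ?_ ?_
    · exact (isClosed_eq ((hnc.comp continuous_fst).add (hnc.comp continuous_snd))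
        continuous_const).inter (isClosed_le continuous_const
          (hnc.comp (continuous_fst.sub continuous_snd)))
    · refine (Metric.isBounded_closedBall (x := (0 : H × H)) (r := 1)).subset fun z hz => ?_
      rw [mem_closedBall_zero_iff, Prod.norm_def]
      exact max_le (hn1 _ _ hz.1).1 (hn1 _ _ hz.1).2
  have hunit : ∃ C : ℝ, 0 ≤ C ∧ ∀ a b : H, ‖a‖ ^ p + ‖b‖ ^ p = 1 → ‖a - b‖ ^ p ≤
      C * (normPowDeriv p a - normPowDeriv p b) (a - b) + η := by
    rcases S.eq_empty_or_nonempty with he | hne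
    · refine ⟨0, le_rfl, fun a b hab => ?_⟩
      have : (a, b) ∉ S := by rw [he]; exact notMem_empty _
      have h1 : ¬ η ≤ ‖a - b‖ ^ p := fun h => this ⟨hab, h⟩
      linarith
    · obtain ⟨z, hz, hmin⟩ := hScpt.exists_isMinOn hne hcont.continuousOn
      set d := (normPowDeriv p z.1 - normPowDeriv p z.2) (z.1 - z.2) with hd
      have hdpos : 0 < d := by
        refine normPowDeriv_sub_pos hp fun h => ?_
        have h2 := hz.2
        rw [h, sub_self, norm_zero, Real.zero_rpow hp0.ne'] at h2
        linarith
      -- Normalized pairs satisfy `‖a - b‖ ≤ 2`, while the expression is at least `d` on `S`.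
      refine ⟨2 ^ p / d, by positivity, fun a b hab => ?_⟩
      have hD := normPowDeriv_sub_nonneg hp a b
      rcases le_total (‖a - b‖ ^ p) η with h | h
      · have : 0 ≤ 2 ^ p / d * (normPowDeriv p a - normPowDeriv p b) (a - b) := by positivity
        linarith
      · have h1 : d ≤ (normPowDeriv p a - normPowDeriv p b) (a - b) := hmin (a := (a, b)) ⟨hab, h⟩
        have h2 : ‖a - b‖ ^ p ≤ 2 ^ p := by
          gcongr
          have := hn1 a b hab
          linarith [norm_sub_le a b]
        have h3 : 2 ^ p ≤ 2 ^ p / d * (normPowDeriv p a - normPowDeriv p b) (a - b) := by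
          rw [div_mul_eq_mul_div, le_div_iff₀ hdpos]
          gcongr
        linarith
  obtain ⟨C, hC, h⟩ := hunit
  refine ⟨C, hC, fun a b => ?_⟩
  rcases eq_or_lt_of_le (by positivity : 0 ≤ ‖a‖ ^ p + ‖b‖ ^ p) with h0 | hpos
  · have ha : a = 0 := by
      by_contra ha
      have : 0 < ‖a‖ := by simpa using ha
      have : 0 < ‖a‖ ^ p + ‖b‖ ^ p := by positivity
      linarith
    have hb : b = 0 := by
      by_contra hb
      have : 0 < ‖b‖ := by simpa using hb
      have : 0 < ‖a‖ ^ p + ‖b‖ ^ p := by positivity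
      linarith
    simp [ha, hb, Real.zero_rpow hp0.ne']
  · set T := ‖a‖ ^ p + ‖b‖ ^ p with hT
    set t := T ^ (1 / p) with ht
    have htpos : 0 < t := by positivity
    have htp : t ^ p = T := by
      rw [ht, ← Real.rpow_mul hpos.le, one_div, inv_mul_cancel₀ hp0.ne', Real.rpow_one]
    -- All terms are homogeneous of degree `p`, so dividing by `t = T^(1/p)` normalizes the pair.
    have key := h (t⁻¹ • a) (t⁻¹ • b) (by
      rw [norm_smul, norm_smul, Real.norm_of_nonneg (by positivity),
        Real.mul_rpow (by positivity) (by positivity),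
        Real.mul_rpow (by positivity) (by positivity), ← mul_add, ← hT,
        Real.inv_rpow htpos.le, htp, inv_mul_cancel₀ hpos.ne'])
    have e : (t⁻¹ ^ (p - 1) • normPowDeriv p a - t⁻¹ ^ (p - 1) • normPowDeriv p b) (t⁻¹ • (a - b))
        = T⁻¹ * (normPowDeriv p a - normPowDeriv p b) (a - b) := by
      rw [← htp, ← Real.inv_rpow htpos.le]
      have e1 : t⁻¹ ^ p = t⁻¹ ^ (p - 1) * t⁻¹ := by
        rw [← Real.rpow_add_one (by positivity), sub_add_cancel]
      simp only [e1, sub_apply, smul_apply, map_smul, smul_eq_mul]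
      ring
    rw [← smul_sub, normPowDeriv_smul (by positivity), normPowDeriv_smul (by positivity), e,
      norm_smul, Real.norm_of_nonneg (by positivity),
      Real.mul_rpow (by positivity) (by positivity), Real.inv_rpow htpos.le, htp] at key
    have h5 := mul_le_mul_of_nonneg_left key hpos.le
    rw [← mul_assoc, mul_inv_cancel₀ hpos.ne', one_mul] at h5
    refine h5.trans_eq ?_
    field_simp

end NormPower

/-! ### Weighted `p`-th powers and their pairings -/

section WeightedPower

variable {N : ℕ} {H : Type*} [NormedAddCommGroup H] [InnerProductSpace ℝ H] {p : ℝ}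

/-- Serves three weights: `1` for the gradient, `V(ε·)` for the potential and `ξ_ε` for the penalty.
-/
theorem isNemytskii_weighted_norm_rpow (hp : 1 < p) {V : E N → ℝ} (hV : Continuous V) {b : ℝ}
    (hV0 : ∀ x, 0 ≤ V x) (hVb : ∀ x, V x ≤ b) :
    IsNemytskii (volume : Measure (E N)) p (fun x (t : H) => V x * ‖t‖ ^ p)
      (fun x t => V x • normPowDeriv p t) where
  hasFDerivAt x t := (hasFDerivAt_norm_pow hp t).const_mul (V x)
  continuous x := (continuous_normPowDeriv hp).const_smul (V x)
  map_zero x := by simp [Real.zero_rpow (by linarith : p ≠ 0)]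
  growth := by
    have hb : 0 ≤ b := (hV0 0).trans (hVb 0)
    refine ⟨b * p, by positivity, fun x t => ?_⟩
    rw [norm_smul, Real.norm_of_nonneg (hV0 x), mul_assoc]
    exact mul_le_mul (hVb x) (norm_normPowDeriv_le hp t) (norm_nonneg _) hb
  aesm v hv := by
    have h : Continuous fun z : E N × H => V z.1 * ‖z.2‖ ^ p :=
      (hV.comp continuous_fst).mul
        (continuous_snd.norm.rpow_const fun _ => Or.inr (by linarith))
    exact h.comp_aestronglyMeasurable (continuous_id.aestronglyMeasurable.prodMk hv)
  aesm' v hv := by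
    have h : Continuous fun z : E N × H => V z.1 • normPowDeriv p z.2 :=
      (hV.comp continuous_fst).smul ((continuous_normPowDeriv hp).comp continuous_snd)
    exact h.comp_aestronglyMeasurable (continuous_id.aestronglyMeasurable.prodMk hv)

theorem integral_norm_rpow {H : Type*} [NormedAddCommGroup H] (hp : 1 < p)
    (v : Lp H (ENNReal.ofReal p) (volume : Measure (E N))) :
    ∫ x, ‖v x‖ ^ p = ‖v‖ ^ p := by
  have h := lintegral_enorm_rpow_eq (by linarith : 0 < p) v
  rw [integral_eq_lintegral_of_nonneg_ae (.of_forall fun x => by positivity)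
    ((Lp.aestronglyMeasurable v).norm.aemeasurable.pow_const p).aestronglyMeasurable]
  have h2 : ∀ x, ENNReal.ofReal (‖v x‖ ^ p) = ‖v x‖ₑ ^ p := fun x => by
    rw [← ENNReal.ofReal_rpow_of_nonneg (norm_nonneg _) (by linarith), ofReal_norm]
  simp_rw [h2]
  rw [h, ← ENNReal.toReal_rpow, Lp.enorm_def, ← Lp.norm_def]

theorem integrable_norm_rpow_Lp (hp : 1 < p)
    (v : Lp H (ENNReal.ofReal p) (volume : Measure (E N))) : Integrable fun x => ‖v x‖ ^ p := by
  have := (isNemytskii_weighted_norm_rpow (N := N) (H := H) hp (V := fun _ => 1) continuous_const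
    (b := 1) (by simp) (by simp)).integrable hp (Lp.memLp v)
  simpa using this

variable {V : E N → ℝ} {b : ℝ}

theorem integral_weighted_self (hp : 1 < p)
    (v : Lp H (ENNReal.ofReal p) (volume : Measure (E N))) :
    ∫ x, (V x • normPowDeriv p (v x)) (v x) = p * ∫ x, V x * ‖v x‖ ^ p := by
  rw [← integral_const_mul]
  refine integral_congr_ae (.of_forall fun x => ?_)
  simp only [smul_apply, normPowDeriv_self hp, smul_eq_mul]
  ring

theorem integral_weighted_le (hp : 1 < p) (hV : Continuous V) (hV0 : ∀ x, 0 ≤ V x)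
    (hVb : ∀ x, V x ≤ b) (v w : Lp H (ENNReal.ofReal p) (volume : Measure (E N))) :
    ∫ x, (V x • normPowDeriv p (v x)) (w x) ≤
      (p - 1) * (∫ x, V x * ‖v x‖ ^ p) + ∫ x, V x * ‖w x‖ ^ p := by
  have hN := isNemytskii_weighted_norm_rpow (N := N) (H := H) hp hV hV0 hVb
  have h1 := hN.integrable hp (Lp.memLp v)
  have h2 := hN.integrable hp (Lp.memLp w)
  rw [← integral_const_mul, ← integral_add (h1.const_mul _) h2]
  refine integral_mono (hN.integrable_deriv hp (Lp.memLp v) (Lp.memLp w))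
    ((h1.const_mul _).add h2) fun x => ?_
  have := mul_le_mul_of_nonneg_left (normPowDeriv_le hp (v x) (w x)) (hV0 x)
  simp only [smul_apply, smul_eq_mul]
  linarith

/-- The pointwise inequality is integrated; the lower bound `V ≥ a` inserts the weight, whence the
constant `C / a`. -/
theorem exists_norm_sub_rpow_le_integral [FiniteDimensional ℝ H] (hp : 1 < p) (hV : Continuous V)
    {a : ℝ} (ha : 0 < a) (hVa : ∀ x, a ≤ V x) (hVb : ∀ x, V x ≤ b) {η : ℝ} (hη : 0 < η)
    [Fact (1 ≤ ENNReal.ofReal p)] :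
    ∃ C : ℝ, 0 ≤ C ∧ ∀ v w : Lp H (ENNReal.ofReal p) (volume : Measure (E N)),
      0 ≤ (∫ x, (V x • normPowDeriv p (v x)) ((v - w) x))
        - ∫ x, (V x • normPowDeriv p (w x)) ((v - w) x) ∧
      ‖v - w‖ ^ p ≤ C * ((∫ x, (V x • normPowDeriv p (v x)) ((v - w) x))
        - ∫ x, (V x • normPowDeriv p (w x)) ((v - w) x)) + η * (‖v‖ ^ p + ‖w‖ ^ p) := by
  obtain ⟨C, hC, h⟩ := exists_norm_sub_rpow_le (H := H) hp hη
  have hN := isNemytskii_weighted_norm_rpow (N := N) (H := H) hp hV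
    (fun x => ha.le.trans (hVa x)) hVb
  refine ⟨C / a, by positivity, fun v w => ?_⟩
  have i1 := hN.integrable_deriv hp (Lp.memLp v) (Lp.memLp (v - w))
  have i2 := hN.integrable_deriv hp (Lp.memLp w) (Lp.memLp (v - w))
  rw [← integral_sub i1 i2]
  have hpt : ∀ᵐ x, (V x • normPowDeriv p (v x)) ((v - w) x)
      - (V x • normPowDeriv p (w x)) ((v - w) x)
      = V x * (normPowDeriv p (v x) - normPowDeriv p (w x)) (v x - w x) := by
    filter_upwards [Lp.coeFn_sub v w] with x hx
    rw [hx]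
    simp only [smul_apply, sub_apply, smul_eq_mul, Pi.sub_apply]
    ring
  constructor
  · refine integral_nonneg_of_ae ?_
    filter_upwards [hpt] with x hx
    rw [hx]
    exact mul_nonneg (ha.le.trans (hVa x)) (normPowDeriv_sub_nonneg hp _ _)
  · have i3 : Integrable fun x => C / a * ((V x • normPowDeriv p (v x)) ((v - w) x)
        - (V x • normPowDeriv p (w x)) ((v - w) x)) := (i1.sub i2).const_mul _
    have i4 : Integrable fun x => ‖v x‖ ^ p + ‖w x‖ ^ p :=
      (integrable_norm_rpow_Lp hp v).add (integrable_norm_rpow_Lp hp w)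
    rw [← integral_norm_rpow hp, ← integral_norm_rpow hp v, ← integral_norm_rpow hp w,
      ← integral_const_mul, ← integral_add (integrable_norm_rpow_Lp hp v)
      (integrable_norm_rpow_Lp hp w), ← integral_const_mul, ← integral_add i3 (i4.const_mul _)]
    refine integral_mono_ae (integrable_norm_rpow_Lp hp _) (i3.add (i4.const_mul _)) ?_
    filter_upwards [hpt, Lp.coeFn_sub v w] with x hx hx2
    rw [hx, hx2, Pi.sub_apply]
    refine (h (v x) (w x)).trans ?_
    have h3 := normPowDeriv_sub_nonneg hp (v x) (w x)
    have h4 : C * (normPowDeriv p (v x) - normPowDeriv p (w x)) (v x - w x) ≤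
        C / a * (V x * (normPowDeriv p (v x) - normPowDeriv p (w x)) (v x - w x)) := by
      rw [div_mul_eq_mul_div, le_div_iff₀ ha, mul_assoc]
      refine mul_le_mul_of_nonneg_left ?_ hC
      rw [mul_comm]
      exact mul_le_mul_of_nonneg_right (hVa x) h3
    linarith

end WeightedPower

/-! ### Scalar estimates for the penalty -/

section Penalty

variable {β : ℝ}

theorem hasDerivAt_posPart_rpow (hβ : 1 < β) (s : ℝ) :
    HasDerivAt (fun s : ℝ => max s 0 ^ β) (β * max s 0 ^ (β - 1)) s := by
  rcases lt_trichotomy s 0 with h | rfl | h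
  · rw [max_eq_right h.le, Real.zero_rpow (by linarith), mul_zero]
    refine (hasDerivAt_const s (0 : ℝ)).congr_of_eventuallyEq ?_
    filter_upwards [gt_mem_nhds h] with t ht
    rw [max_eq_right ht.le, Real.zero_rpow (by linarith)]
  · rw [max_self, Real.zero_rpow (by linarith), mul_zero]
    have h1 := hasDerivAt_norm_rpow (0 : ℝ) hβ
    rw [mul_zero, hasDerivAt_iff_isLittleO] at h1
    rw [hasDerivAt_iff_isLittleO]
    refine (Asymptotics.isBigO_of_le _ fun t => ?_).trans_isLittleO h1
    simp only [max_self, norm_zero, smul_zero, sub_zero, Real.zero_rpow (by linarith : β ≠ 0)]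
    rw [Real.norm_of_nonneg (by positivity), Real.norm_of_nonneg (by positivity)]
    refine Real.rpow_le_rpow (le_max_right _ _) ?_ (by linarith)
    exact max_le (le_abs_self t) (abs_nonneg t)
  · rw [max_eq_left h.le, mul_comm β, mul_comm]
    refine (Real.hasDerivAt_rpow_const (Or.inl h.ne')).congr_of_eventuallyEq ?_
    filter_upwards [lt_mem_nhds h] with t ht
    rw [max_eq_left ht.le]

/-- With `s = P - 1 > 0` and `δ = 1/(pβ) - 1/r`, positive since `β < r/p`, the expression is `s^(β -
1)(δs - 1/r)`; it is negative only for `s < 1/(rδ)`, hence bounded below. -/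
theorem exists_penalty_lower_bound {p r : ℝ} (hp : 0 < p) (hr : 0 < r) (hβ : 1 < β)
    (hβr : β < r / p) : ∃ K : ℝ, ∀ P : ℝ,
      -K ≤ 1 / (p * β) * max (P - 1) 0 ^ β - 1 / r * (max (P - 1) 0 ^ (β - 1) * P) := by
  set δ := 1 / (p * β) - 1 / r with hδ
  have hδ0 : 0 < δ := by
    rw [hδ, sub_pos]
    rw [lt_div_iff₀ hp] at hβr
    exact one_div_lt_one_div_of_lt (by positivity) (by linarith)
  refine ⟨1 / r * (1 / (r * δ)) ^ (β - 1), fun P => ?_⟩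
  have hK : 0 ≤ 1 / r * (1 / (r * δ)) ^ (β - 1) := by positivity
  rcases le_total P 1 with h | h
  · rw [max_eq_right (by linarith), Real.zero_rpow (by linarith), Real.zero_rpow (by linarith)]
    linarith
  rcases h.eq_or_lt with rfl | h
  · rw [sub_self, max_self, Real.zero_rpow (by linarith), Real.zero_rpow (by linarith)]
    linarith
  have hs : 0 < P - 1 := by linarith
  rw [max_eq_left hs.le]
  set s := P - 1 with hsdef
  have e1 : s ^ β = s ^ (β - 1) * s := by rw [← Real.rpow_add_one hs.ne', sub_add_cancel]
  have e2 : P = s + 1 := by rw [hsdef]; ring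
  have hA : 0 ≤ s ^ (β - 1) := by positivity
  have e3 : 1 / (p * β) * s ^ β - 1 / r * (s ^ (β - 1) * P)
      = s ^ (β - 1) * (δ * s - 1 / r) := by
    rw [e1, e2, hδ]; ring
  rw [e3]
  rcases le_total (1 / (r * δ)) s with h1 | h1
  · have h2 : 0 ≤ δ * s - 1 / r := by
      have := mul_le_mul_of_nonneg_left h1 hδ0.le
      have e4 : δ * (1 / (r * δ)) = 1 / r := by field_simp
      linarith
    have := mul_nonneg hA h2
    linarith
  · have h2 : s ^ (β - 1) ≤ (1 / (r * δ)) ^ (β - 1) := Real.rpow_le_rpow hs.le h1 (by linarith)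
    have h3 : 0 ≤ s ^ (β - 1) * (δ * s) := by positivity
    have h4 : s ^ (β - 1) * (1 / r) ≤ (1 / (r * δ)) ^ (β - 1) * (1 / r) := by gcongr
    linarith

/-- The Young-type hypotheses give `pP₁ - x₁₂ ≥ P₁ - P₂ ≥ x₂₁ - pP₂`, so the expression is at least
`(c₁ - c₂)(P₁ - P₂)`. -/
theorem penalty_monotone {p c₁ c₂ P₁ P₂ x₁₂ x₂₁ : ℝ} (hc₁ : 0 ≤ c₁) (hc₂ : 0 ≤ c₂)
    (hmono : 0 ≤ (c₁ - c₂) * (P₁ - P₂)) (h₁ : x₁₂ ≤ (p - 1) * P₁ + P₂)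
    (h₂ : x₂₁ ≤ (p - 1) * P₂ + P₁) :
    0 ≤ c₁ * (p * P₁ - x₁₂) - c₂ * (x₂₁ - p * P₂) := by
  have h3 := mul_le_mul_of_nonneg_left h₁ hc₁
  have h4 := mul_le_mul_of_nonneg_left h₂ hc₂
  nlinarith

/-- Since `p > 1`, the power beats any affine function of `X`. -/
theorem exists_bound_of_rpow_le {p c A A' : ℝ} (hp : 1 < p) (hc : 0 < c) :
    ∃ B : ℝ, ∀ X : ℝ, 0 ≤ X → c * X ^ p ≤ A + A' * X → X ≤ B := by
  have h := (tendsto_rpow_atTop (by linarith : 0 < p - 1)).eventually_gt_atTop ((|A| + |A'|) / c)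
  obtain ⟨B, hB⟩ := eventually_atTop.1 h
  refine ⟨max B 1, fun X hX hle => ?_⟩
  by_contra hlt
  rw [not_le, max_lt_iff] at hlt
  have h1 := hB X hlt.1.le
  rw [div_lt_iff₀ hc] at h1
  have h2 : X ^ p = X ^ (p - 1) * X := by
    rw [← Real.rpow_add_one (by linarith), sub_add_cancel]
  rw [h2] at hle
  have h3 : (|A| + |A'|) * X < c * X ^ p := by
    rw [h2]; nlinarith [hlt.2]
  have h4 : A ≤ |A| * X := (le_abs_self A).trans (le_mul_of_one_le_right (abs_nonneg A) hlt.2.le)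
  have h5 : A' * X ≤ |A'| * X := mul_le_mul_of_nonneg_right (le_abs_self A') hX
  rw [h2] at h3
  linarith

end Penalty

/-! ### Hölder's inequality for the nonlinear term -/

section Holder

variable {N : ℕ} {r : ℝ}

/-- The whole weight is placed on the factor `d`, so that the weighted compactness applies to the
difference of two functions. -/
theorem enorm_integral_le_of_growth (hr : 1 < r) {f : E N → ℝ → ℝ} {wt : E N → ℝ} {v d : E N → ℝ}
    (hwt : ∀ x, 0 ≤ wt x) (hwtc : Continuous wt) (hv : AEStronglyMeasurable v volume)
    (hd : AEStronglyMeasurable d volume) (hf : ∀ x t, |f x t| ≤ wt x * |t| ^ (r - 1)) :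
    ‖∫ x, f x (v x) * d x‖ₑ ≤ (∫⁻ x, ‖v x‖ₑ ^ r) ^ (1 / r.conjExponent) *
      (∫⁻ x, ENNReal.ofReal (wt x ^ r) * ‖d x‖ₑ ^ r) ^ (1 / r) := by
  have hpq := (Real.HolderConjugate.conjExponent hr).symm
  have h1 : AEMeasurable (fun x => ‖v x‖ₑ ^ (r - 1)) := hv.enorm.pow_const _
  have h2 : AEMeasurable (fun x => ENNReal.ofReal (wt x) * ‖d x‖ₑ) :=
    (hwtc.measurable.ennreal_ofReal.aemeasurable).mul hd.enorm
  calc _ ≤ ∫⁻ x, ‖f x (v x) * d x‖ₑ := enorm_integral_le_lintegral_enorm _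
    _ ≤ ∫⁻ x, ((fun x => ‖v x‖ₑ ^ (r - 1)) * fun x => ENNReal.ofReal (wt x) * ‖d x‖ₑ) x := by
        refine lintegral_mono fun x => ?_
        have h3 : ‖f x (v x)‖ₑ ≤ ENNReal.ofReal (wt x) * ‖v x‖ₑ ^ (r - 1) := by
          rw [← ofReal_norm, ← ofReal_norm,
            ENNReal.ofReal_rpow_of_nonneg (norm_nonneg _) (by linarith),
            ← ENNReal.ofReal_mul (hwt x)]
          exact ENNReal.ofReal_le_ofReal (hf x (v x))
        rw [enorm_mul]
        refine (mul_le_mul' h3 le_rfl).trans_eq ?_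
        simp only [Pi.mul_apply]
        ring
    _ ≤ _ := ENNReal.lintegral_mul_le_Lp_mul_Lq _ hpq h1 h2
    _ = _ := by
        congr 2
        · refine lintegral_congr fun x => ?_
          rw [← ENNReal.rpow_mul, hpq.symm.sub_one_mul_conj]
        · refine lintegral_congr fun x => ?_
          rw [ENNReal.mul_rpow_of_nonneg _ _ (by linarith),
            ENNReal.ofReal_rpow_of_nonneg (hwt x) (by linarith)]

end Holder

/-! ### The penalty weight and the nonlinearity as superposition data -/

section Penalization

variable {N : ℕ} {ζ : ℝ → ℝ} {a γ ε : ℝ} {M : Set (E N)}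

/-- The case distinction disappears because `ζ 0 = 0`, which also makes the weight continuous. -/
theorem xi_eq (hζ : IsPenaltyCutoff ζ a) (x : E N) :
    xi ζ γ M ε x = ε ^ (-γ) * ζ (Metric.infDist x (scaled M ε)) := by
  unfold xi
  split_ifs with h
  · rw [Metric.infDist_zero_of_mem h, hζ.eq_zero 0 le_rfl, mul_zero]
  · rfl

theorem continuous_xi (hζ : IsPenaltyCutoff ζ a) : Continuous (xi ζ γ M ε) := by
  rw [funext fun x => xi_eq (γ := γ) (M := M) (ε := ε) hζ x]
  exact (hζ.contDiff.continuous.comp (Metric.continuous_infDist_pt _)).const_mul _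

theorem xi_nonneg (hζ : IsPenaltyCutoff ζ a) (hε : 0 < ε) (x : E N) : 0 ≤ xi ζ γ M ε x := by
  rw [xi_eq hζ]
  exact mul_nonneg (by positivity) (hζ.nonneg _)

theorem xi_le (hζ : IsPenaltyCutoff ζ a) (hε : 0 < ε) (x : E N) : xi ζ γ M ε x ≤ ε ^ (-γ) := by
  rw [xi_eq hζ]
  exact mul_le_of_le_one_right (by positivity) (hζ.le_one _)

theorem isNemytskii_FTrunc {p q r μ : ℝ} {φ : ℝ → ℝ} (hrp1 : 1 < r)
    (hrq : r < q) (hrs : r < pStar N p) (hμ : 0 < μ)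
    (hφ : IsTruncationCutoff φ) (hε : 0 < ε) :
    IsNemytskii (volume : Measure (E N)) r (FTrunc p q r μ φ M ε)
      (fun x t => ContinuousLinearMap.toSpanSingleton ℝ (fTrunc p q r μ φ M ε x t)) := by
  refine IsNemytskii.of_hasDerivAt (hasDerivAt_FTrunc hφ hε hrp1 hrq hrs)
    (continuous_FTrunc hφ hε hrp1 hrq hrs) (continuous_fTrunc hφ hε hrp1 hrq hrs)
    (FTrunc_zero hrp1) ((fWeight_nonneg (M := M) hε hμ hrp1 hrq hrs 0).trans
      (fWeight_le hε hμ hrp1 hrq hrs 0)) fun x t => ?_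
  exact (abs_fTrunc_le hφ hε hμ hrp1 hrq hrs x t).trans
    (mul_le_mul_of_nonneg_right (fWeight_le hε hμ hrp1 hrq hrs x) (by positivity))

end Penalization

/-! ### The functional and its derivative -/

section Functional

open W1p

variable {N : ℕ} {p : ℝ} [hp : Fact (1 < p)] {q r μ : ℝ} {V : E N → ℝ} {M : Set (E N)}
  {φ ζ : ℝ → ℝ} {a γ β ε a' b' : ℝ}

/-- The pairing `∫ V (‖·‖ ^ p)'(v) w`. -/
def pairing {H : Type*} [NormedAddCommGroup H] [InnerProductSpace ℝ H] (p : ℝ) (V : E N → ℝ)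
    (v w : Lp H (ENNReal.ofReal p) (volume : Measure (E N))) : ℝ :=
  ∫ x, (V x • normPowDeriv p (v x)) (w x)

/-- The weighted power `∫ V ‖v‖ ^ p`. -/
def weightedPow {H : Type*} [NormedAddCommGroup H] (p : ℝ) (V : E N → ℝ)
    (v : Lp H (ENNReal.ofReal p) (volume : Measure (E N))) : ℝ :=
  ∫ x, V x * ‖v x‖ ^ p

/-- Exhibits the functional as superposition integrals composed with the continuous linear maps
`gradL`, `fnL` and `J`. -/
theorem modifiedFunctional_eq [Fact (1 ≤ ENNReal.ofReal r)] (hVc : Continuous V)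
    (hV : ∀ x, a' ≤ V x ∧ V x ≤ b') (ha' : 0 < a')
    {J : W1p N p →L[ℝ] Lp ℝ (ENNReal.ofReal r) (volume : Measure (E N))}
    (hJ : ∀ u, (J u : E N → ℝ) =ᵐ[volume] fn u) (u : W1p N p) :
    modifiedFunctional q r μ β γ φ ζ V M ε u =
      1 / p * (weightedPow p (fun _ => 1) (gradL N p u)
        + weightedPow p (fun x => V (ε • x)) (fnL N p u))
      + 1 / (p * β) * max (weightedPow p (xi ζ γ M ε) (fnL N p u) - 1) 0 ^ β
      - ∫ x, FTrunc p q r μ φ M ε x (J u x) := by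
  have h1 : ∫ x, FTrunc p q r μ φ M ε x (fn u x) = ∫ x, FTrunc p q r μ φ M ε x (J u x) := by
    refine integral_congr_ae ?_
    filter_upwards [hJ u] with x hx
    rw [hx]
  have i1 := (isNemytskii_weighted_norm_rpow (N := N) (H := E N) hp.out (V := fun _ => 1)
    continuous_const (b := 1) (by simp) (by simp)).integrable hp.out (Lp.memLp (gradL N p u))
  have i2 := (isNemytskii_weighted_norm_rpow (N := N) (H := ℝ) hp.out
    (V := fun x => V (ε • x)) (hVc.comp (continuous_const_smul ε)) (b := b')
    (fun x => ha'.le.trans (hV _).1) (fun x => (hV _).2)).integrable hp.out (Lp.memLp (fnL N p u))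
  rw [modifiedFunctional, penalization, h1, weightedPow, weightedPow, weightedPow,
    ← integral_add i1 i2]
  simp only [one_mul]
  rfl

theorem IsNemytskii.exists_derivative_comp {α H X : Type*} [MeasurableSpace α] {ν : Measure α}
    [NormedAddCommGroup H] [NormedSpace ℝ H] [NormedAddCommGroup X] [NormedSpace ℝ X] {s : ℝ}
    [Fact (1 ≤ ENNReal.ofReal s)] {G : α → H → ℝ} {g : α → H → H →L[ℝ] ℝ}
    (hG : IsNemytskii ν s G g) (hs : 1 < s) (T : X →L[ℝ] Lp H (ENNReal.ofReal s) ν) :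
    ∃ D : X → X →L[ℝ] ℝ, Continuous D ∧
      (∀ u, HasFDerivAt (fun u => ∫ x, G x (T u x) ∂ν) (D u) u) ∧
      ∀ u v, D u v = ∫ x, g x (T u x) (T v x) ∂ν := by
  obtain ⟨D, hc, hD, hD'⟩ := hG.hasFDerivAt_integral hs
  exact ⟨fun u => (D (T u)).comp T, (hc.comp T.continuous).clm_comp continuous_const,
    fun u => (hD (T u)).comp u T.hasFDerivAt, fun u v => hD' (T u) (T v)⟩

theorem exists_derivative_of_penalized {X : Type*} [NormedAddCommGroup X] [NormedSpace ℝ X]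
    {p β : ℝ} (hp : 0 < p) (hβ : 1 < β) {f₁ f₂ f₃ f₄ : X → ℝ} {D₁ D₂ D₃ D₄ : X → X →L[ℝ] ℝ}
    (h₁ : ∀ u, HasFDerivAt f₁ (D₁ u) u) (h₂ : ∀ u, HasFDerivAt f₂ (D₂ u) u)
    (h₃ : ∀ u, HasFDerivAt f₃ (D₃ u) u) (h₄ : ∀ u, HasFDerivAt f₄ (D₄ u) u)
    (c₁ : Continuous D₁) (c₂ : Continuous D₂) (c₃ : Continuous D₃) (c₄ : Continuous D₄) :
    ∃ I' : X → X →L[ℝ] ℝ, Continuous I' ∧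
      (∀ u, HasFDerivAt (fun u => 1 / p * (f₁ u + f₂ u) + 1 / (p * β) * max (f₃ u - 1) 0 ^ β - f₄ u)
        (I' u) u) ∧
      ∀ u v, I' u v = 1 / p * (D₁ u v + D₂ u v)
        + 1 / p * max (f₃ u - 1) 0 ^ (β - 1) * D₃ u v - D₄ u v := by
  have hf₃ : Continuous f₃ := continuous_iff_continuousAt.2 fun u => (h₃ u).continuousAt
  refine ⟨fun u => (1 / p) • (D₁ u + D₂ u) + (1 / p * max (f₃ u - 1) 0 ^ (β - 1)) • D₃ u - D₄ u,
    ?_, fun u => ?_, fun u v => ?_⟩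
  · have c₅ : Continuous fun u => 1 / p * max (f₃ u - 1) 0 ^ (β - 1) :=
      (((hf₃.sub continuous_const).max continuous_const).rpow_const
        fun _ => Or.inr (by linarith)).const_mul _
    exact (((c₁.add c₂).const_smul (1 / p)).add (c₅.smul c₃)).sub c₄
  · have d₅ := ((hasDerivAt_posPart_rpow hβ _).comp_hasFDerivAt u ((h₃ u).sub_const 1)).const_mul
      (1 / (p * β))
    have d := ((((h₁ u).add (h₂ u)).const_mul (1 / p)).add d₅).sub (h₄ u)
    -- The factor `β` from the chain rule cancels the one in `1 / (p * β)`.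
    have e : (1 / p * max (f₃ u - 1) 0 ^ (β - 1)) • D₃ u =
        (1 / (p * β)) • ((β * max (f₃ u - 1) 0 ^ (β - 1)) • D₃ u) := by
      rw [smul_smul]
      congr 1
      have : β ≠ 0 := by linarith
      field_simp
    change HasFDerivAt _ ((1 / p) • (D₁ u + D₂ u) +
      (1 / p * max (f₃ u - 1) 0 ^ (β - 1)) • D₃ u - D₄ u) u
    rw [e]
    exact d
  · simp only [add_apply, sub_apply, smul_apply, smul_eq_mul]

/-- The slope `(∫ ξ |u| ^ p - 1)_+ ^ (β - 1)` of the penalization. -/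
def penaltySlope (β γ : ℝ) (ζ : ℝ → ℝ) (M : Set (E N)) (ε : ℝ) (u : W1p N p) : ℝ :=
  max (weightedPow p (xi ζ γ M ε) (fnL N p u) - 1) 0 ^ (β - 1)

/-- The derivative of the modified functional at `u` in the direction `v`. -/
def derivForm [Fact (1 ≤ ENNReal.ofReal r)] (q μ β γ : ℝ) (φ ζ : ℝ → ℝ) (V : E N → ℝ)
    (M : Set (E N)) (ε : ℝ) (J : W1p N p →L[ℝ] Lp ℝ (ENNReal.ofReal r) (volume : Measure (E N)))
    (u v : W1p N p) : ℝ :=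
  1 / p * (pairing p (fun _ => 1) (gradL N p u) (gradL N p v)
      + pairing p (fun x => V (ε • x)) (fnL N p u) (fnL N p v))
    + 1 / p * penaltySlope β γ ζ M ε u * pairing p (xi ζ γ M ε) (fnL N p u) (fnL N p v)
    - ∫ x, fTrunc p q r μ φ M ε x (J u x) * J v x

set_option maxHeartbeats 1000000 in
theorem exists_derivative [Fact (1 ≤ ENNReal.ofReal r)] (hr : p < r) (hrq : r < q)
    (hrs : r < pStar N p) (hμ : 0 < μ) (hVc : Continuous V) (hV : ∀ x, a' ≤ V x ∧ V x ≤ b')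
    (ha' : 0 < a') (hφ : IsTruncationCutoff φ) (hζ : IsPenaltyCutoff ζ a) (hβ : 1 < β)
    (hε : 0 < ε) {J : W1p N p →L[ℝ] Lp ℝ (ENNReal.ofReal r) (volume : Measure (E N))}
    (hJ : ∀ u, (J u : E N → ℝ) =ᵐ[volume] fn u) :
    ∃ I' : W1p N p → W1p N p →L[ℝ] ℝ, Continuous I' ∧
      (∀ u, HasFDerivAt (modifiedFunctional q r μ β γ φ ζ V M ε) (I' u) u) ∧
      ∀ u v, I' u v = derivForm q μ β γ φ ζ V M ε J u v := by
  have hp1 := hp.out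
  have hr1 : 1 < r := by linarith
  obtain ⟨D₁, c₁, e₁, hD₁⟩ := (isNemytskii_weighted_norm_rpow (N := N) (H := E N) hp1
    (V := fun _ => 1) continuous_const (b := 1) (by simp) (by simp)).exists_derivative_comp hp1
    (gradL N p)
  obtain ⟨D₂, c₂, e₂, hD₂⟩ := (isNemytskii_weighted_norm_rpow (N := N) (H := ℝ) hp1
    (V := fun x => V (ε • x)) (hVc.comp (continuous_const_smul ε)) (b := b')
    (fun x => ha'.le.trans (hV _).1) (fun x => (hV _).2)).exists_derivative_comp hp1 (fnL N p)
  obtain ⟨D₃, c₃, e₃, hD₃⟩ := (isNemytskii_weighted_norm_rpow (N := N) (H := ℝ) hp1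
    (V := xi ζ γ M ε) (continuous_xi hζ) (xi_nonneg hζ hε) (xi_le hζ hε)).exists_derivative_comp
    hp1 (fnL N p)
  obtain ⟨D₄, c₄, e₄, hD₄⟩ :=
    (isNemytskii_FTrunc (M := M) (p := p) hr1 hrq hrs hμ hφ hε).exists_derivative_comp hr1 J
  obtain ⟨I', hI'c, hI', hI'v⟩ := exists_derivative_of_penalized (by linarith : 0 < p) hβ
    e₁ e₂ e₃ e₄ c₁ c₂ c₃ c₄
  refine ⟨I', hI'c, fun u => ?_, fun u v => ?_⟩
  · rw [funext (modifiedFunctional_eq hVc hV ha' hJ)]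
    exact hI' u
  · have h4 : D₄ u v = ∫ x, fTrunc p q r μ φ M ε x (J u x) * J v x := by
      rw [hD₄]
      refine integral_congr_ae (.of_forall fun x => ?_)
      exact mul_comm _ _
    rw [hI'v, hD₁, hD₂, hD₃, h4]
    rfl

end Functional

/-- Coercivity bounds the sequence. On a bounded sequence with `I' → 0` the pairing of differences
vanishes, and `T`, the compact part, vanishes along `θ`; the inequality then makes the subsequence
Cauchy, and completeness supplies the limit. -/
theorem palaisSmale_of_coercive_of_monotone {X : Type*} [NormedAddCommGroup X] [NormedSpace ℝ X]
    [CompleteSpace X] {I : X → ℝ} {I' : X → X →L[ℝ] ℝ} {p ρ κ K c : ℝ} (hp : 1 < p)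
    (hI : ∀ u, HasFDerivAt I (I' u) u) (hκ : 0 < κ)
    (hcoer : ∀ u, κ * ‖u‖ ^ p - K ≤ I u - ρ * I' u u)
    (hcpt : ∀ (u : ℕ → X) (B : ℝ), (∀ n, ‖u n‖ ≤ B) → ∃ θ : ℕ → ℕ, StrictMono θ ∧
      ∃ T : ℕ × ℕ → ℝ, Tendsto T (atTop ×ˢ atTop) (𝓝 0) ∧ ∀ η, 0 < η → ∃ C, ∀ m : ℕ × ℕ,
        ‖u (θ m.1) - u (θ m.2)‖ ^ p ≤
          C * ((I' (u (θ m.1)) - I' (u (θ m.2))) (u (θ m.1) - u (θ m.2)) + T m) + η) :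
    PalaisSmale I c := by
  intro u hu hu'
  have hd : (fun n => fderiv ℝ I (u n)) = fun n => I' (u n) := funext fun n => (hI _).fderiv
  rw [hd] at hu'
  obtain ⟨A, hA⟩ := hu.bddAbove_range
  obtain ⟨A', hA'⟩ := hu'.norm.bddAbove_range
  obtain ⟨B, hB⟩ := exists_bound_of_rpow_le (A := A + K) (A' := |ρ| * A') hp hκ
  have hbd : ∀ n, ‖u n‖ ≤ B := fun n => by
    refine hB _ (norm_nonneg _) ?_
    have h1 := hcoer (u n)
    have h2 : I (u n) ≤ A := hA ⟨n, rfl⟩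
    have h3 : ‖I' (u n)‖ ≤ A' := hA' ⟨n, rfl⟩
    have h4 : -(ρ * I' (u n) (u n)) ≤ |ρ| * A' * ‖u n‖ := by
      refine (neg_le_abs _).trans ?_
      rw [abs_mul, mul_assoc]
      exact mul_le_mul_of_nonneg_left (((I' (u n)).le_opNorm _).trans
        (mul_le_mul_of_nonneg_right h3 (norm_nonneg _))) (abs_nonneg _)
    linarith
  obtain ⟨θ, hθ, T, hT, h⟩ := hcpt u B hbd
  have hD : Tendsto (fun m : ℕ × ℕ => (I' (u (θ m.1)) - I' (u (θ m.2)))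
      (u (θ m.1) - u (θ m.2))) (atTop ×ˢ atTop) (𝓝 0) := by
    have h1 := hu'.comp hθ.tendsto_atTop
    have h2 := ((h1.comp tendsto_fst).sub (h1.comp tendsto_snd)).norm.mul_const (2 * B)
    rw [sub_zero, norm_zero, zero_mul] at h2
    refine squeeze_zero_norm (fun m => ?_) h2
    refine (ContinuousLinearMap.le_opNorm _ _).trans
      (mul_le_mul_of_nonneg_left ?_ (norm_nonneg _))
    linarith [norm_sub_le (u (θ m.1)) (u (θ m.2)), hbd (θ m.1), hbd (θ m.2)]
  have hpow : Tendsto (fun m : ℕ × ℕ => ‖u (θ m.1) - u (θ m.2)‖ ^ p) (atTop ×ˢ atTop) (𝓝 0) := by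
    refine tendsto_order.2 ⟨fun b hb => .of_forall fun m => hb.trans_le (by positivity),
      fun b hb => ?_⟩
    obtain ⟨C, hC⟩ := h (b / 2) (by positivity)
    have h1 := (hD.add hT).const_mul C
    rw [add_zero, mul_zero] at h1
    filter_upwards [h1.eventually_lt_const (half_pos hb)] with m hm
    linarith [hC m]
  have hcau : CauchySeq (u ∘ θ) := by
    rw [cauchySeq_iff_tendsto_dist_atTop_0, ← prod_atTop_atTop_eq]
    have h1 := hpow.rpow_const (p := 1 / p) (Or.inr (by positivity))
    rw [Real.zero_rpow (by positivity)] at h1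
    refine h1.congr fun m => ?_
    rw [← Real.rpow_mul (norm_nonneg _), mul_one_div_cancel (by linarith), Real.rpow_one,
      dist_eq_norm]
    rfl
  obtain ⟨v, hv⟩ := cauchySeq_tendsto_of_complete hcau
  exact ⟨v, θ, hθ, hv⟩

theorem mul_integral_FTrunc_le {N : ℕ} {p q r μ ε : ℝ} {M : Set (E N)}
    {φ : ℝ → ℝ} (hr : 1 < r) (hrq : r < q) (hrs : r < pStar N p) (hμ : 0 < μ)
    (hφ : IsTruncationCutoff φ) (hε : 0 < ε)
    (v : Lp ℝ (ENNReal.ofReal r) (volume : Measure (E N))) :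
    r * ∫ x, FTrunc p q r μ φ M ε x (v x) ≤ ∫ x, fTrunc p q r μ φ M ε x (v x) * v x := by
  have hN := isNemytskii_FTrunc (M := M) hr hrq hrs hμ hφ hε
  have h2 := hN.integrable_deriv hr (Lp.memLp v) (Lp.memLp v)
  simp only [ContinuousLinearMap.toSpanSingleton_apply, smul_eq_mul] at h2
  simp only [mul_comm (fTrunc _ _ _ _ _ _ _ _ _)]
  rw [← integral_const_mul]
  exact integral_mono ((hN.integrable hr (Lp.memLp v)).const_mul r) h2 fun x =>
    mul_FTrunc_le hφ hε hμ hr hrq hrs x (v x)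

/-! ### Coercivity and monotonicity of the functional -/

section Functional

open W1p

variable {N : ℕ} {p : ℝ} [hp : Fact (1 < p)] {q r μ : ℝ} {V : E N → ℝ} {M : Set (E N)}
  {φ ζ : ℝ → ℝ} {a γ β ε a' b' : ℝ} [Fact (1 ≤ ENNReal.ofReal r)]
  {J : W1p N p →L[ℝ] Lp ℝ (ENNReal.ofReal r) (volume : Measure (E N))}

theorem pairing_self {H : Type*} [NormedAddCommGroup H] [InnerProductSpace ℝ H] (V : E N → ℝ)
    (v : Lp H (ENNReal.ofReal p) (volume : Measure (E N))) :
    pairing p V v v = p * weightedPow p V v :=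
  integral_weighted_self hp.out v

theorem pairing_sub {H : Type*} [NormedAddCommGroup H] [InnerProductSpace ℝ H]
    (hV : Continuous V) (hV0 : ∀ x, 0 ≤ V x) {b : ℝ} (hVb : ∀ x, V x ≤ b)
    (v w w' : Lp H (ENNReal.ofReal p) (volume : Measure (E N))) :
    pairing p V v (w - w') = pairing p V v w - pairing p V v w' := by
  have hN := isNemytskii_weighted_norm_rpow (N := N) (H := H) hp.out hV hV0 hVb
  unfold pairing
  rw [← integral_sub (hN.integrable_deriv hp.out (Lp.memLp v) (Lp.memLp w))
    (hN.integrable_deriv hp.out (Lp.memLp v) (Lp.memLp w'))]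
  refine integral_congr_ae ?_
  filter_upwards [Lp.coeFn_sub w w'] with x hx
  rw [hx, Pi.sub_apply, map_sub]

theorem weightedPow_const_one {H : Type*} [NormedAddCommGroup H] [InnerProductSpace ℝ H]
    (v : Lp H (ENNReal.ofReal p) (volume : Measure (E N))) :
    weightedPow p (fun _ => 1) v = ‖v‖ ^ p := by
  rw [← integral_norm_rpow hp.out v, weightedPow]
  simp

theorem mul_norm_rpow_le_weightedPow {H : Type*} [NormedAddCommGroup H] [InnerProductSpace ℝ H]
    (hV : Continuous V) {b c : ℝ} (hc : 0 ≤ c) (hVc : ∀ x, c ≤ V x) (hVb : ∀ x, V x ≤ b)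
    (v : Lp H (ENNReal.ofReal p) (volume : Measure (E N))) :
    c * ‖v‖ ^ p ≤ weightedPow p V v := by
  rw [← integral_norm_rpow hp.out v, weightedPow, ← integral_const_mul]
  refine integral_mono ((integrable_norm_rpow_Lp hp.out v).const_mul c)
    ((isNemytskii_weighted_norm_rpow (N := N) (H := H) hp.out hV
      (fun x => hc.trans (hVc x)) hVb).integrable hp.out (Lp.memLp v)) fun x => ?_
  exact mul_le_mul_of_nonneg_right (hVc x) (by positivity)

-- Subtracting `1/r` times the derivative along `u` leaves `1/p - 1/r` of the principal part, a
-- penalty remainder bounded below, and a nonnegative contribution of the nonlinearity.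
set_option maxHeartbeats 1000000 in
theorem exists_coercive (hr : p < r) (hrq : r < q) (hrs : r < pStar N p) (hμ : 0 < μ)
    (hVc : Continuous V) (hV : ∀ x, a' ≤ V x ∧ V x ≤ b') (ha' : 0 < a')
    (hφ : IsTruncationCutoff φ) (hβ : 1 < β) (hβr : β < r / p) (hε : 0 < ε)
    (hJ : ∀ u, (J u : E N → ℝ) =ᵐ[volume] fn u) :
    ∃ κ K : ℝ, 0 < κ ∧ ∀ u : W1p N p, κ * ‖u‖ ^ p - K ≤
      modifiedFunctional q r μ β γ φ ζ V M ε u - 1 / r * derivForm q μ β γ φ ζ V M ε J u u := by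
  have hp1 := hp.out
  have hp0 : 0 < p := by linarith
  have hr0 : 0 < r := by linarith
  obtain ⟨K, hK⟩ := exists_penalty_lower_bound hp0 hr0 hβ hβr
  have hpr : 0 < 1 / p - 1 / r := sub_pos.2 (one_div_lt_one_div_of_lt hp0 hr)
  refine ⟨(1 / p - 1 / r) * min 1 a', K, by positivity, fun u => ?_⟩
  have h1 := weightedPow_const_one (gradL N p u)
  have h2 := mul_norm_rpow_le_weightedPow (hVc.comp (continuous_const_smul ε)) ha'.le
    (fun x => (hV _).1) (fun x => (hV _).2) (fnL N p u)
  have h3 := mul_integral_FTrunc_le (M := M) (p := p) (by linarith : 1 < r) hrq hrs hμ hφ hε (J u)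
  have h4 := hK (weightedPow p (xi ζ γ M ε) (fnL N p u))
  have h5 : min 1 a' * ‖u‖ ^ p ≤ weightedPow p (fun _ => 1) (gradL N p u)
      + weightedPow p (fun x => V (ε • x)) (fnL N p u) := by
    rw [W1p.norm_rpow_eq, h1]
    have h6 := mul_le_mul_of_nonneg_right (min_le_left 1 a')
      (by positivity : 0 ≤ ‖gradL N p u‖ ^ p)
    have h7 := mul_le_mul_of_nonneg_right (min_le_right 1 a')
      (by positivity : 0 ≤ ‖fnL N p u‖ ^ p)
    have h8 : a' * ‖fnL N p u‖ ^ p ≤ weightedPow p (fun x => V (ε • x)) (fnL N p u) := h2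
    linarith
  have h6 := mul_le_mul_of_nonneg_left h5 hpr.le
  rw [modifiedFunctional_eq hVc hV ha' hJ, derivForm, pairing_self, pairing_self, pairing_self,
    penaltySlope]
  generalize weightedPow p (fun _ => 1) (gradL N p u) = G at *
  generalize weightedPow p (fun x => V (ε • x)) (fnL N p u) = W at *
  generalize weightedPow p (xi ζ γ M ε) (fnL N p u) = P at *
  generalize (∫ x, FTrunc p q r μ φ M ε x (J u x)) = F at *
  generalize (∫ x, fTrunc p q r μ φ M ε x (J u x) * J u x) = f at *
  generalize max (P - 1) 0 ^ (β - 1) = c at *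
  have h7 : F ≤ 1 / r * f := by
    rw [one_div, inv_mul_eq_div, le_div_iff₀ hr0]
    linarith
  have h8 : 1 / r * (1 / p * (p * G + p * W) + 1 / p * c * (p * P) - f) =
      1 / r * (G + W) + 1 / r * (c * P) - 1 / r * f := by
    field_simp
  rw [h8]
  linarith

/-- Monotonicity of the derivative of the convex penalty, obtained from Young's inequality and the
fact that the slope increases with `∫ ξ|u|^p`. -/
theorem penalty_pairing_nonneg (hζ : IsPenaltyCutoff ζ a) (hε : 0 < ε) (hβ : 1 < β)
    (u v : W1p N p) :
    0 ≤ penaltySlope β γ ζ M ε u * pairing p (xi ζ γ M ε) (fnL N p u) (fnL N p u - fnL N p v)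
      - penaltySlope β γ ζ M ε v
        * pairing p (xi ζ γ M ε) (fnL N p v) (fnL N p u - fnL N p v) := by
  have hx := xi_nonneg (γ := γ) (M := M) hζ hε
  have hx' := xi_le (γ := γ) (M := M) hζ hε
  have hxc := continuous_xi (γ := γ) (M := M) (ε := ε) hζ
  have h₁ := integral_weighted_le hp.out hxc hx hx' (fnL N p u) (fnL N p v)
  have h₂ := integral_weighted_le hp.out hxc hx hx' (fnL N p v) (fnL N p u)
  rw [pairing_sub hxc hx hx', pairing_sub hxc hx hx', pairing_self, pairing_self]
  refine penalty_monotone ?_ ?_ ?_ h₁ h₂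
  · unfold penaltySlope; positivity
  · unfold penaltySlope; positivity
  · unfold penaltySlope
    have hmono : ∀ s t : ℝ, s ≤ t → max (s - 1) 0 ^ (β - 1) ≤ max (t - 1) 0 ^ (β - 1) :=
      fun s t hst => Real.rpow_le_rpow (le_max_right _ _)
        (max_le_max_right _ (by linarith)) (by linarith)
    rcases le_total (weightedPow p (xi ζ γ M ε) (fnL N p u))
      (weightedPow p (xi ζ γ M ε) (fnL N p v)) with h | h
    · exact mul_nonneg_of_nonpos_of_nonpos (sub_nonpos.2 (hmono _ _ h)) (sub_nonpos.2 h)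
    · exact mul_nonneg (sub_nonneg.2 (hmono _ _ h)) (sub_nonneg.2 h)

theorem exists_norm_sub_rpow_le_pairing {H : Type*} [NormedAddCommGroup H]
    [InnerProductSpace ℝ H] [FiniteDimensional ℝ H] (hV : Continuous V) {c b : ℝ} (hc : 0 < c)
    (hVc : ∀ x, c ≤ V x) (hVb : ∀ x, V x ≤ b) {η : ℝ} (hη : 0 < η) :
    ∃ C : ℝ, 0 ≤ C ∧ ∀ v w : Lp H (ENNReal.ofReal p) (volume : Measure (E N)),
      0 ≤ pairing p V v (v - w) - pairing p V w (v - w) ∧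
      ‖v - w‖ ^ p ≤ C * (pairing p V v (v - w) - pairing p V w (v - w))
        + η * (‖v‖ ^ p + ‖w‖ ^ p) :=
  exists_norm_sub_rpow_le_integral hp.out hV hc hVc hVb hη

/-- All three monotone differences are nonnegative, so each may be multiplied by `C₁ + C₂`; the
factor `p` undoes the `1 / p`, and adding `f₁ - f₂` removes the nonlinearity. -/
theorem add_le_of_monotone_parts {p C₁ C₂ η G₁ G₂ W₁ W₂ X₁ X₂ s₁ s₂ f₁ f₂ g w gu gv wu wv : ℝ}
    (hp : 0 < p) (hC₁ : 0 ≤ C₁) (hC₂ : 0 ≤ C₂) (nG : 0 ≤ G₁ - G₂) (nW : 0 ≤ W₁ - W₂)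
    (nX : 0 ≤ s₁ * X₁ - s₂ * X₂) (hg : g ≤ C₁ * (G₁ - G₂) + η * (gu + gv))
    (hw : w ≤ C₂ * (W₁ - W₂) + η * (wu + wv)) :
    w + g ≤ (C₁ + C₂) * p * (1 / p * (G₁ + W₁) + 1 / p * s₁ * X₁ - f₁
      - (1 / p * (G₂ + W₂) + 1 / p * s₂ * X₂ - f₂) + (f₁ - f₂))
      + η * (wu + gu + (wv + gv)) := by
  have e : (C₁ + C₂) * p * (1 / p * (G₁ + W₁) + 1 / p * s₁ * X₁ - f₁
      - (1 / p * (G₂ + W₂) + 1 / p * s₂ * X₂ - f₂) + (f₁ - f₂)) =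
      (C₁ + C₂) * ((G₁ - G₂) + (W₁ - W₂) + (s₁ * X₁ - s₂ * X₂)) := by
    field_simp
    ring
  rw [e]
  have h4 := mul_nonneg hC₁ (add_nonneg nW nX)
  have h5 := mul_nonneg hC₂ (add_nonneg nG nX)
  linarith

set_option maxHeartbeats 1000000 in
theorem exists_norm_sub_rpow_le_derivForm (hVc : Continuous V)
    (hV : ∀ x, a' ≤ V x ∧ V x ≤ b') (ha' : 0 < a') (hζ : IsPenaltyCutoff ζ a) (hβ : 1 < β)
    (hε : 0 < ε) {η : ℝ} (hη : 0 < η) :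
    ∃ C : ℝ, ∀ u v : W1p N p, ‖u - v‖ ^ p ≤
      C * (derivForm q μ β γ φ ζ V M ε J u (u - v) - derivForm q μ β γ φ ζ V M ε J v (u - v)
        + ((∫ x, fTrunc p q r μ φ M ε x (J u x) * J (u - v) x)
          - ∫ x, fTrunc p q r μ φ M ε x (J v x) * J (u - v) x)) + η * (‖u‖ ^ p + ‖v‖ ^ p) := by
  obtain ⟨C₁, hC₁, h₁⟩ := exists_norm_sub_rpow_le_pairing (N := N) (H := E N) (p := p)
    (V := fun _ => 1) continuous_const one_pos (fun _ => le_rfl) (fun _ => le_rfl) hη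
  obtain ⟨C₂, hC₂, h₂⟩ := exists_norm_sub_rpow_le_pairing (N := N) (H := ℝ) (p := p)
    (V := fun x => V (ε • x)) (hVc.comp (continuous_const_smul ε)) ha' (fun x => (hV _).1)
    (fun x => (hV _).2) hη
  refine ⟨(C₁ + C₂) * p, fun u v => ?_⟩
  rw [W1p.norm_rpow_eq, W1p.norm_rpow_eq u, W1p.norm_rpow_eq v, derivForm, derivForm,
    map_sub (fnL N p), map_sub (gradL N p)]
  exact add_le_of_monotone_parts (by linarith [hp.out]) hC₁ hC₂ (h₁ _ _).1 (h₂ _ _).1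
    (penalty_pairing_nonneg hζ hε hβ u v) (h₁ _ _).2 (h₂ _ _).2

end Functional

/-! ### Compactness of the nonlinear term and the Palais–Smale condition -/

section Functional

open W1p

variable {N : ℕ} {p : ℝ} [hp : Fact (1 < p)] {q r μ : ℝ} {V : E N → ℝ} {M : Set (E N)}
  {φ ζ : ℝ → ℝ} {a γ β ε a' b' : ℝ} [Fact (1 ≤ ENNReal.ofReal r)]
  {J : W1p N p →L[ℝ] Lp ℝ (ENNReal.ofReal r) (volume : Measure (E N))}

-- Hölder separates a bounded `L^r` factor from the weighted norm of the difference, which tends to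
-- zero because the weight decays at infinity and `p < r < p*`.
set_option maxHeartbeats 1000000 in
theorem exists_subseq_tendsto_integral_fTrunc (hpN : p < N) (hr : p < r) (hrq : r < q)
    (hrs : r < pStar N p) (hμ : 0 < μ) (hM : M.Nonempty) (hMb : Bornology.IsBounded M)
    (hφ : IsTruncationCutoff φ) (hε : 0 < ε) (hJ : ∀ u, (J u : E N → ℝ) =ᵐ[volume] fn u)
    (u : ℕ → W1p N p) {B : ℝ} (hB : ∀ n, ‖u n‖ ≤ B) :
    ∃ θ : ℕ → ℕ, StrictMono θ ∧ Tendsto (fun m : ℕ × ℕ =>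
      (∫ x, fTrunc p q r μ φ M ε x (J (u (θ m.1)) x) * J (u (θ m.1) - u (θ m.2)) x)
        - ∫ x, fTrunc p q r μ φ M ε x (J (u (θ m.2)) x) * J (u (θ m.1) - u (θ m.2)) x)
      (atTop ×ˢ atTop) (𝓝 0) := by
  have hr1 : 1 < r := hp.out.trans hr
  have hr0 : 0 < r := by linarith
  have hw0 := fWeight_nonneg (M := M) hε hμ hr1 hrq hrs
  have hwc := continuous_fWeight (p := p) (q := q) (r := r) (μ := μ) (M := M) hε
  obtain ⟨θ, hθ, h⟩ := exists_subseq_cauchy_weight hpN u hB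
  refine ⟨θ, hθ, ?_⟩
  set d : ℕ × ℕ → ℝ≥0∞ := fun m => ∫⁻ x, ENNReal.ofReal (fWeight p q r μ M ε x ^ r) *
    ‖fn (u (θ m.1)) x - fn (u (θ m.2)) x‖ₑ ^ r with hd
  have hd0 : Tendsto d (atTop ×ˢ atTop) (𝓝 0) := by
    refine h r (fun x => ENNReal.ofReal (fWeight p q r μ M ε x ^ r)) _ hr hrs
      (hwc.measurable.pow_const r).ennreal_ofReal ENNReal.ofReal_ne_top
      (fun x => ENNReal.ofReal_le_ofReal
        (Real.rpow_le_rpow (hw0 x) (fWeight_le hε hμ hr1 hrq hrs x) hr0.le)) fun η hη => ?_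
    have h1 := (tendsto_fWeight (μ := μ) hε hrq hrs hM hMb).rpow_const (p := r) (Or.inr hr0.le)
    rw [Real.zero_rpow hr0.ne'] at h1
    have h2 := ENNReal.tendsto_ofReal h1
    rw [ENNReal.ofReal_zero] at h2
    have h3 := h2.eventually_le_const hη
    rw [← Metric.cobounded_eq_cocompact, ← comap_norm_atTop] at h3
    obtain ⟨R, hR⟩ := eventually_atTop.1 (eventually_comap.1 h3)
    exact ⟨R, fun x hx => hR _ hx x rfl⟩
  set K : ℝ≥0∞ := (ENNReal.ofReal (‖J‖ * B) ^ r) ^ (1 / r.conjExponent) with hK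
  have hKtop : K ≠ ⊤ :=
    ENNReal.rpow_ne_top_of_nonneg (one_div_nonneg.2 (Real.HolderConjugate.conjExponent hr1).symm.nonneg)
      (ENNReal.rpow_ne_top_of_nonneg hr0.le ENNReal.ofReal_ne_top)
  have key : ∀ n (m : ℕ × ℕ), ‖∫ x, fTrunc p q r μ φ M ε x (J (u n) x) *
      J (u (θ m.1) - u (θ m.2)) x‖ₑ ≤ K * d m ^ (1 / r) := fun n m => by
    refine (enorm_integral_le_of_growth hr1 hw0 hwc (Lp.aestronglyMeasurable _)
      (Lp.aestronglyMeasurable _) (abs_fTrunc_le hφ hε hμ hr1 hrq hrs)).trans ?_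
    refine mul_le_mul' (ENNReal.rpow_le_rpow ?_ (one_div_nonneg.2
      (Real.HolderConjugate.conjExponent hr1).symm.nonneg)) (ENNReal.rpow_le_rpow (le_of_eq ?_)
      (by positivity))
    · rw [lintegral_enorm_rpow_eq hr0, ← ofReal_norm]
      refine ENNReal.rpow_le_rpow (ENNReal.ofReal_le_ofReal ((J.le_opNorm _).trans ?_)) hr0.le
      exact mul_le_mul_of_nonneg_left (hB n) J.opNorm_nonneg
    · refine lintegral_congr_ae ?_
      filter_upwards [hJ (u (θ m.1)), hJ (u (θ m.2)), Lp.coeFn_sub (J (u (θ m.1)))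
        (J (u (θ m.2)))] with x h1 h2 h3
      rw [map_sub, h3, Pi.sub_apply, h1, h2]
  have hlim : Tendsto (fun m => K * d m ^ (1 / r)) (atTop ×ˢ atTop) (𝓝 0) := by
    have h1 := (ENNReal.continuous_rpow_const (y := 1 / r)).continuousAt.tendsto.comp hd0
    rw [ENNReal.zero_rpow_of_pos (by positivity)] at h1
    have h2 := ENNReal.Tendsto.const_mul h1 (Or.inr hKtop)
    rwa [mul_zero] at h2
  -- The bound `key` is uniform in the function inside `f`, so one statement covers both integrals
  -- through the selector `n`.
  have t1 : ∀ n : ℕ × ℕ → ℕ, Tendsto (fun m : ℕ × ℕ => ∫ x, fTrunc p q r μ φ M ε x (J (u (n m)) x) *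
      J (u (θ m.1) - u (θ m.2)) x) (atTop ×ˢ atTop) (𝓝 0) := fun n => by
    rw [tendsto_zero_iff_enorm_tendsto_zero]
    exact tendsto_of_tendsto_of_tendsto_of_le_of_le tendsto_const_nhds hlim (fun _ => zero_le)
      fun m => key (n m) m
  have t2 := (t1 fun m => θ m.1).sub (t1 fun m => θ m.2)
  rwa [sub_zero] at t2

set_option maxHeartbeats 1000000 in
theorem palaisSmale_modifiedFunctional (hpN : p < N) (hr : p < r) (hrq : r < q)
    (hrs : r < pStar N p) (hμ : 0 < μ) (hVc : Continuous V) (hV : ∀ x, a' ≤ V x ∧ V x ≤ b')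
    (ha' : 0 < a') (hM : M.Nonempty) (hMb : Bornology.IsBounded M) (hφ : IsTruncationCutoff φ)
    (hζ : IsPenaltyCutoff ζ a) (hβ : 1 < β) (hβr : β < r / p) (hε : 0 < ε)
    (hJ : ∀ u, (J u : E N → ℝ) =ᵐ[volume] fn u) {I' : W1p N p → W1p N p →L[ℝ] ℝ}
    (hI : ∀ u, HasFDerivAt (modifiedFunctional q r μ β γ φ ζ V M ε) (I' u) u)
    (hI' : ∀ u v, I' u v = derivForm q μ β γ φ ζ V M ε J u v) (c : ℝ) :
    PalaisSmale (modifiedFunctional (N := N) (p := p) q r μ β γ φ ζ V M ε) c := by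
  obtain ⟨κ, K, hκ, hcoer⟩ := exists_coercive (γ := γ) (ζ := ζ) hr hrq hrs hμ hVc hV ha' (M := M)
    hφ hβ hβr hε hJ
  refine palaisSmale_of_coercive_of_monotone (ρ := 1 / r) (K := K) hp.out hI hκ (fun u => ?_)
    fun u B hB => ?_
  · rw [hI']
    exact hcoer u
  obtain ⟨θ, hθ, hT⟩ := exists_subseq_tendsto_integral_fTrunc hpN hr hrq hrs hμ hM hMb hφ hε hJ u hB
  refine ⟨θ, hθ, _, hT, fun η hη => ?_⟩
  have hB0 : 0 ≤ B := (norm_nonneg _).trans (hB 0)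
  -- Chosen so that the error `δ(‖u‖^p + ‖v‖^p) ≤ 2δB^p` stays below `η`; the `1` covers `B = 0`.
  have hδ : 0 < η / (2 * B ^ p + 1) := by positivity
  obtain ⟨C, hC⟩ := exists_norm_sub_rpow_le_derivForm (q := q) (μ := μ) (γ := γ) (φ := φ) (M := M)
    (J := J) hVc hV ha' hζ hβ hε hδ
  refine ⟨C, fun m => ?_⟩
  rw [sub_apply, hI', hI']
  refine (hC _ _).trans (add_le_add_right ?_ _)
  have h1 : ∀ n, ‖u n‖ ^ p ≤ B ^ p := fun n =>
    Real.rpow_le_rpow (norm_nonneg _) (hB n) (by linarith [hp.out])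
  rw [div_mul_eq_mul_div, div_le_iff₀ (by positivity)]
  exact mul_le_mul_of_nonneg_left (by linarith [h1 (θ m.1), h1 (θ m.2)]) hη.le

end Functional

end PSLemma

end

theorem lemma2p1 (N : ℕ) (p : ℝ) [Fact (1 < p)] (hpN : p < N)
    (q r μ : ℝ) (hr : max p (PSLemma.pStar N p - 1) < r) (hrq : r < q)
    (hq : q < PSLemma.pStar N p) (hμ : 0 < μ)
    (V : PSLemma.E N → ℝ) (hV : ContDiff ℝ 1 V)
    (hVbd : ∃ a' b' : ℝ, 0 < a' ∧ a' < b' ∧ ∀ x, a' ≤ V x ∧ V x ≤ b')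
    (M : Set (PSLemma.E N)) (hM : M.Nonempty) (hMbd : Bornology.IsBounded M)
    (φ : ℝ → ℝ) (hφ : PSLemma.IsTruncationCutoff φ)
    (ζ : ℝ → ℝ) (a : ℝ) (ha : 0 < a) (hζ : PSLemma.IsPenaltyCutoff ζ a)
    (γ : ℝ) (hγ : max ((p + a) * p / (N - p)) (p ^ 2 * r / ((r - p) * (N - p))) < γ)
    (β : ℝ) (hβ : 1 < β) (hβr : β < r / p) (hβp : p < 2 → β ≤ 1 / (2 - p))
    (ε : ℝ) (hε : 0 < ε) :
    ContDiff ℝ 1 (PSLemma.modifiedFunctional (N := N) (p := p) q r μ β γ φ ζ V M ε) ∧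
      ∀ c : ℝ,
        PSLemma.PalaisSmale (PSLemma.modifiedFunctional (N := N) (p := p) q r μ β γ φ ζ V M ε) c := by
  obtain ⟨a', b', ha', -, hV'⟩ := hVbd
  have hp1 : 1 < p := Fact.out
  have hpr : p < r := (le_max_left _ _).trans_lt hr
  have hrs : r < PSLemma.pStar N p := hrq.trans hq
  have : Fact (1 ≤ ENNReal.ofReal r) := ⟨ENNReal.one_le_ofReal.2 (hp1.trans hpr).le⟩
  obtain ⟨J, hJ⟩ := PSLemma.W1p.exists_embedding (N := N) hpN hpr.le hrs.le
  obtain ⟨I', hc, hI, hI'⟩ := PSLemma.exists_derivative (γ := γ) (M := M) hpr hrq hrs hμ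
    hV.continuous hV' ha' hφ hζ hβ hε hJ
  exact ⟨contDiff_one_iff_hasFDerivAt.2 ⟨I', hc, hI⟩,
    PSLemma.palaisSmale_modifiedFunctional hpN hpr hrq hrs hμ hV.continuous hV' ha' hM hMbd hφ hζ
      hβ hβr hε hJ hI hI'⟩
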